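/- Let $\alpha=\frac{1+i\sqrt7}{2}$, let $r_\phi(z)=z-2\frac{\langle\phi|z\rangle}{\langle\phi|\phi\rangle}\phi$ be the complex reflection of $\mathbb C^3$ with root $\phi$ (where $\langle x|y\rangle=\sum\bar x_iy_i$), and let $G=\langle r_{\phi_1},r_{\phi_2},r_{\phi_3}\rangle\subset GL_3(\mathbb C)$ (a group of order $336$) with $\phi_1=(0,\alpha,-\alpha)$, $\phi_2=(0,0,2)$, $\phi_3=(1,1,\bar\alpha)$. Put $$C=\begin{pmatrix}1&0&0\\-1&1&0\\0&-1&2\end{pmatrix},\quad \omega_1=-2\bar\alpha\,({}^tC)^{-1},\quad \omega_2=\alpha C,\quad Z=\omega_2^{-1}\omega_1 ,$$ and let $\Lambda=\omega_1\mathbb Z^3+\omega_2\mathbb Z^3$, a $G$-invariant lattice, and $J=\mathbb C^3/\Lambda$ (the Jacobian of the Klein quartic). For $z\in\mathbb C^3$ write $v=\omega_2^{-1}z$. For an integer $k\ge0$ let $H^0(J,\mathcal L^k)$ be the space of theta functions of degree $k$, i.e. of entire functions $f$ on $\mathbb C^3$ with $$f(z+\omega_1u'+\omega_2u'')=e^{-2\pi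 i k\left({}^tv\,u'+\frac12{}^tu'Zu'\right)}f(z)\qquad(z\in\mathbb C^3,\ u',u''\in\mathbb Z^3).$$ For $g\in G$ let $\gamma_g=\begin{pmatrix}a&b\\c&d\end{pmatrix}\in Sp(6,\mathbb Z)$ be the matrix with $(\omega_1|\omega_2)\,{}^t\gamma_g=g\,(\omega_1|\omega_2)$, and let $g$ act on theta functions of degree $k$ by $$(g\cdot f)(z)=e^{-\pi i k\,{}^tv(cZ+d)^{-1}c\,v}\,f(g^{-1}z).$$ Let $H^0(J,\mathcal L^k)^G$ be the space of those $f\in H^0(J,\mathcal L^k)$ with $g\cdot f=f$ for all $g\in G$, and let $S(\mathcal L^2)^G=\bigoplus_{p\ge0}H^0(J,\mathcal L^{2p})^G$ be the graded algebra of invariant theta functions. **Theorem.** For every even integer $k\ge0$, the Hilbert function $h(p)=\dim_{\mathbb C} H^0(J,\mathcal L^{2p})^G$ of $S(\mathcal L^2)^G$ satisfies $$h\left(\tfrac k2\right)=\frac1{336}\left[k^3+21k^2+140k+294+42\,(-1)^{k/2}+48\left(\frac k7\right)\right],$$ where $\left(\frac k7\right)$ is the Legendre symbol. Moreover $h$ coincides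 with the Hilbert function of the second Veronese algebra of $\mathbb P(1,2,4,7)$, i.e. $h(p)=\dim_{\mathbb C} R_{2p}$ for all $p\ge0$, where $R=\mathbb C[x_0,x_1,x_2,x_3]$ is graded by $\deg x_0=1$, $\deg x_1=2$, $\deg x_2=4$, $\deg x_3=7$; and the Hilbert series of this Veronese algebra is $$\sum_{p\ge0}\dim_{\mathbb C} (R_{2p})\,t^p=\frac{1+t^4}{(1-t)^2(1-t^2)(1-t^7)}.$$ -/

import Mathlib

open scoped Matrix

noncomputable section

namespace KleinTheta

/-- The vector space `V = ℂ³`. -/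
abbrev V : Type := Fin 3 → ℂ

/-- The quadratic integer `α = (1 + i√7) / 2`. -/
def α : ℂ := (1 + Complex.I * (Real.sqrt 7 : ℂ)) / 2

/-- The complex conjugate `ᾱ = (1 - i√7) / 2`. -/
def αbar : ℂ := star α

/-! ### The complex reflection group `G` of order 336 -/

/-- The matrix of `z ↦ z - 2 (⟨φ|z⟩ / ⟨φ|φ⟩) φ`, where `⟨x|y⟩ = ∑ x̄ᵢ yᵢ`. -/
def reflMatrix (φ : V) : Matrix (Fin 3) (Fin 3) ℂ :=
  1 - (2 / (star φ ⬝ᵥ φ)) • Matrix.vecMulVec φ (star φ)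

theorem reflMatrix_mul_self (φ : V) : reflMatrix φ * reflMatrix φ = 1 := by
  have h : Matrix.vecMulVec φ (star φ) * Matrix.vecMulVec φ (star φ)
      = (star φ ⬝ᵥ φ) • Matrix.vecMulVec φ (star φ) := by
    rw [Matrix.vecMulVec_mul_vecMulVec, Matrix.vecMulVec_smul]
  unfold reflMatrix
  rw [sub_mul, mul_sub, mul_sub, one_mul, mul_one, one_mul, smul_mul_smul_comm, h, smul_smul]
  by_cases h0 : star φ ⬝ᵥ φ = 0
  · simp [h0]
  · have : 2 / (star φ ⬝ᵥ φ) * (2 / (star φ ⬝ᵥ φ)) * (star φ ⬝ᵥ φ)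
        = 2 / (star φ ⬝ᵥ φ) + 2 / (star φ ⬝ᵥ φ) := by
      field_simp
      ring
    rw [this, add_smul]
    abel

/-- The complex reflection of order two with root `φ`, as an invertible matrix. -/
def refl (φ : V) : GL (Fin 3) ℂ :=
  ⟨reflMatrix φ, reflMatrix φ, reflMatrix_mul_self φ, reflMatrix_mul_self φ⟩

/-- The basic roots. -/
def φ₁ : V := ![0, α, -α]
def φ₂ : V := ![0, 0, 2]
def φ₃ : V := ![1, 1, αbar]

/-- The group `G`, generated by the three basic reflections. -/
def G : Subgroup (GL (Fin 3) ℂ) := Subgroup.closure {refl φ₁, refl φ₂, refl φ₃}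

/-! ### The period lattice `Λ = ω₁ ℤ³ + ω₂ ℤ³` -/

def C : Matrix (Fin 3) (Fin 3) ℂ := !![1, 0, 0; -1, 1, 0; 0, -1, 2]

def ω₁ : Matrix (Fin 3) (Fin 3) ℂ := (-2 * αbar) • (Cᵀ)⁻¹

def ω₂ : Matrix (Fin 3) (Fin 3) ℂ := α • C

/-- The period matrix `(ω₁ | ω₂)`. -/
def Ω : Matrix (Fin 3) (Fin 3 ⊕ Fin 3) ℂ := Matrix.fromCols ω₁ ω₂

/-- The normalized period matrix, a point of the Siegel upper half-space. -/
def Z : Matrix (Fin 3) (Fin 3) ℂ := ω₂⁻¹ * ω₁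

/-- The coordinate `v = ω₂⁻¹ z`, in which `Λ` becomes `Z ℤ³ + ℤ³`. -/
def normCoord (z : V) : V := ω₂⁻¹ *ᵥ z

/-- An integer vector, as a complex vector. -/
def intVec (u : Fin 3 → ℤ) : V := fun i => (u i : ℂ)

/-- An integer matrix, as a complex matrix. -/
def intMat {m n : Type} (A : Matrix m n ℤ) : Matrix m n ℂ := A.map (fun x => (x : ℂ))

/-! ### The modular matrices `γ_g` -/

/-- `γ` expresses the action of `g` on the columns of the period matrix. -/
def IsModularMatrix (g : GL (Fin 3) ℂ) (γ : Matrix (Fin 3 ⊕ Fin 3) (Fin 3 ⊕ Fin 3) ℤ) : Prop :=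
  Ω * (intMat γ)ᵀ = (g : Matrix (Fin 3) (Fin 3) ℂ) * Ω

theorem α_sq : α ^ 2 = α - 2 := by
  have h7 : ((Real.sqrt 7 : ℝ) : ℂ) ^ 2 = 7 := by
    rw [← Complex.ofReal_pow, Real.sq_sqrt (by norm_num)]; norm_num
  unfold α
  linear_combination (Complex.I ^ 2 / 4) * h7 + 7 / 4 * Complex.I_sq

theorem αbar_eq : αbar = 1 - α := by
  unfold αbar α
  simp
  ring

theorem star_α : star α = 1 - α := αbar_eq

theorem star_αbar : star αbar = α := star_star α

theorem α_ne_zero : α ≠ 0 := by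
  intro h
  have := α_sq
  rw [h] at this
  norm_num at this

theorem C_transpose_inv : (Cᵀ)⁻¹ = !![1, 1, 1/2; 0, 1, 1/2; 0, 0, 1/2] := by
  apply Matrix.inv_eq_right_inv
  ext i j
  fin_cases i <;> fin_cases j <;> simp [C, Matrix.mul_apply, Fin.sum_univ_three]

theorem intMat_mul {l m n : Type} [Fintype m] (A : Matrix l m ℤ) (B : Matrix m n ℤ) :
    intMat (A * B) = intMat A * intMat B := by
  ext i j
  simp [intMat, Matrix.mul_apply]

theorem intMat_one {m : Type} [DecidableEq m] : intMat (1 : Matrix m m ℤ) = 1 := by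
  ext i j
  by_cases h : i = j <;> simp [intMat, Matrix.one_apply, h]

def γ₁ : Matrix (Fin 3 ⊕ Fin 3) (Fin 3 ⊕ Fin 3) ℤ :=
  Matrix.fromBlocks !![1, 0, 0; 1, -1, 2; 0, 0, 1] 0 0 !![1, 1, 0; 0, -1, 0; 0, 2, 1]

def γ₂ : Matrix (Fin 3 ⊕ Fin 3) (Fin 3 ⊕ Fin 3) ℤ :=
  Matrix.fromBlocks !![1, 0, 0; 0, 1, 0; 0, 1, -1] 0 0 !![1, 0, 0; 0, 1, 1; 0, 0, -1]

def γ₃ : Matrix (Fin 3 ⊕ Fin 3) (Fin 3 ⊕ Fin 3) ℤ :=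
  Matrix.fromBlocks !![1, -1, 1; 0, -1, 2; 0, -1, 1] !![0, 0, -1; 0, 0, -2; 1, 2, 0]
    !![0, 0, 0; 0, 0, 1; 0, -1, 0] !![1, 0, 0; -1, -1, -1; 1, 2, 1]

theorem γ₁_mem : γ₁ ∈ Matrix.symplecticGroup (Fin 3) ℤ := by
  rw [SymplecticGroup.mem_iff]; decide +revert

theorem γ₂_mem : γ₂ ∈ Matrix.symplecticGroup (Fin 3) ℤ := by
  rw [SymplecticGroup.mem_iff]; decide +revert

theorem γ₃_mem : γ₃ ∈ Matrix.symplecticGroup (Fin 3) ℤ := by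
  rw [SymplecticGroup.mem_iff]; decide +revert

theorem star_φ₁ : star φ₁ = ![0, 1 - α, -(1 - α)] := by
  funext i
  fin_cases i
  · exact star_zero ℂ
  · exact star_α
  · exact (star_neg α).trans (congrArg Neg.neg star_α)

theorem star_φ₂ : star φ₂ = ![0, 0, 2] := by
  funext i
  fin_cases i
  · exact star_zero ℂ
  · exact star_zero ℂ
  · exact star_ofNat 2

theorem star_φ₃ : star φ₃ = ![1, 1, α] := by
  funext i
  fin_cases i
  · exact star_one ℂ
  · exact star_one ℂ
  · exact star_αbar

theorem reflMatrix_apply (φ : V) (i j : Fin 3) :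
    reflMatrix φ i j =
      (if i = j then 1 else 0) - 2 / (star φ ⬝ᵥ φ) * (φ i * (star φ) j) := by
  simp only [reflMatrix, Matrix.sub_apply, Matrix.smul_apply, Matrix.vecMulVec_apply,
    Matrix.one_apply, smul_eq_mul]

theorem refl_φ₁ : reflMatrix φ₁ = !![1, 0, 0; 0, 0, 1; 0, 1, 0] := by
  have h1 := α_sq
  have h : star φ₁ ⬝ᵥ φ₁ = 4 := by
    rw [star_φ₁]
    simp [φ₁, dotProduct, Fin.sum_univ_three]
    linear_combination -2 * h1
  ext i j
  rw [reflMatrix_apply, h, star_φ₁]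
  fin_cases i <;> fin_cases j <;> simp [φ₁] <;>
    first | done | linear_combination (1 / 2) * h1 | linear_combination (-1 / 2) * h1

theorem refl_φ₂ : reflMatrix φ₂ = !![1, 0, 0; 0, 1, 0; 0, 0, -1] := by
  have h : star φ₂ ⬝ᵥ φ₂ = 4 := by
    rw [star_φ₂]
    simp [φ₂, dotProduct, Fin.sum_univ_three]
    norm_num
  ext i j
  rw [reflMatrix_apply, h, star_φ₂]
  fin_cases i <;> fin_cases j <;> simp [φ₂] <;> norm_num

theorem refl_φ₃ : reflMatrix φ₃ =
    !![1/2, -1/2, -α/2; -1/2, 1/2, -α/2; -αbar/2, -αbar/2, 0] := by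
  have h1 := α_sq
  have h : star φ₃ ⬝ᵥ φ₃ = 4 := by
    rw [star_φ₃]
    simp [φ₃, dotProduct, Fin.sum_univ_three, αbar_eq]
    linear_combination -h1
  ext i j
  rw [reflMatrix_apply, h, star_φ₃]
  fin_cases i <;> fin_cases j <;> simp [φ₃, αbar_eq] <;>
    first | done | ring1 | linear_combination (1 / 2) * h1

theorem isModularMatrix_φ₁ : IsModularMatrix (refl φ₁) γ₁ := by
  have h1 := α_sq
  change Ω * (intMat γ₁)ᵀ = reflMatrix φ₁ * Ω
  rw [refl_φ₁, Ω, ω₁, C_transpose_inv]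
  ext i (j | j) <;> fin_cases i <;> fin_cases j <;>
    simp [ω₂, C, γ₁, intMat, Matrix.mul_apply, Fin.sum_univ_three,
      αbar_eq] <;>
    first | done | ring1

theorem isModularMatrix_φ₂ : IsModularMatrix (refl φ₂) γ₂ := by
  have h1 := α_sq
  change Ω * (intMat γ₂)ᵀ = reflMatrix φ₂ * Ω
  rw [refl_φ₂, Ω, ω₁, C_transpose_inv]
  ext i (j | j) <;> fin_cases i <;> fin_cases j <;>
    simp [ω₂, C, γ₂, intMat, Matrix.mul_apply, Fin.sum_univ_three,
      αbar_eq] <;>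
    first | done | ring1

theorem isModularMatrix_φ₃ : IsModularMatrix (refl φ₃) γ₃ := by
  have h1 := α_sq
  change Ω * (intMat γ₃)ᵀ = reflMatrix φ₃ * Ω
  rw [refl_φ₃, Ω, ω₁, C_transpose_inv]
  ext i (j | j) <;> fin_cases i <;> fin_cases j <;>
    simp [ω₂, C, γ₃, intMat, Matrix.mul_apply, Fin.sum_univ_three,
      αbar_eq] <;>
    first | done | ring1 | grind

theorem exists_modularMatrix (g : G) :
    ∃ γ : Matrix.symplecticGroup (Fin 3) ℤ, IsModularMatrix g.1 γ.1 := by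
  obtain ⟨g, hg⟩ := g
  change ∃ γ : Matrix.symplecticGroup (Fin 3) ℤ, IsModularMatrix g γ.1
  induction hg using Subgroup.closure_induction with
  | mem x hx =>
    rcases hx with rfl | rfl | rfl
    · exact ⟨⟨γ₁, γ₁_mem⟩, isModularMatrix_φ₁⟩
    · exact ⟨⟨γ₂, γ₂_mem⟩, isModularMatrix_φ₂⟩
    · exact ⟨⟨γ₃, γ₃_mem⟩, isModularMatrix_φ₃⟩
  | one => exact ⟨1, by simp [IsModularMatrix, intMat_one]⟩
  | mul x y _ _ hx hy =>
    obtain ⟨γ, hγ⟩ := hx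
    obtain ⟨δ, hδ⟩ := hy
    refine ⟨δ * γ, ?_⟩
    unfold IsModularMatrix at *
    rw [Submonoid.coe_mul, intMat_mul, Matrix.transpose_mul, ← Matrix.mul_assoc, hγ,
      Matrix.mul_assoc, hδ, Units.val_mul, Matrix.mul_assoc]
  | inv x _ hx =>
    obtain ⟨γ, hγ⟩ := hx
    refine ⟨γ⁻¹, ?_⟩
    unfold IsModularMatrix at *
    have h : (intMat (γ⁻¹ : Matrix.symplecticGroup (Fin 3) ℤ).1 * intMat γ.1) = 1 := by
      rw [← intMat_mul, ← Submonoid.coe_mul, inv_mul_cancel, Submonoid.coe_one, intMat_one]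
    have hx : ((x⁻¹ : GL (Fin 3) ℂ) : Matrix (Fin 3) (Fin 3) ℂ) * (x : Matrix _ _ ℂ) = 1 := by
      rw [← Units.val_mul, inv_mul_cancel, Units.val_one]
    calc Ω * (intMat (γ⁻¹ : Matrix.symplecticGroup (Fin 3) ℤ).1)ᵀ
        = ((x⁻¹ : GL (Fin 3) ℂ) : Matrix (Fin 3) (Fin 3) ℂ) *
            ((x : Matrix (Fin 3) (Fin 3) ℂ) * Ω) *
            (intMat (γ⁻¹ : Matrix.symplecticGroup (Fin 3) ℤ).1)ᵀ := by
          rw [← Matrix.mul_assoc _ (x : Matrix (Fin 3) (Fin 3) ℂ), hx, Matrix.one_mul]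
      _ = ((x⁻¹ : GL (Fin 3) ℂ) : Matrix (Fin 3) (Fin 3) ℂ) * Ω := by
          rw [← hγ, Matrix.mul_assoc, Matrix.mul_assoc, ← Matrix.transpose_mul, h,
            Matrix.transpose_one, Matrix.mul_one]

/-- The symplectic matrix `γ_g = (a b; c d) ∈ Sp(6, ℤ)` of `g ∈ G`, characterized by
`(ω₁ | ω₂) γ_gᵀ = g (ω₁ | ω₂)` (it is unique, as the columns of the period matrix are linearly
independent over `ℝ`). -/
def modularMatrix (g : G) : Matrix.symplecticGroup (Fin 3) ℤ := (exists_modularMatrix g).choose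

theorem modularMatrix_spec (g : G) : IsModularMatrix g.1 (modularMatrix g).1 :=
  (exists_modularMatrix g).choose_spec

/-- The lower left block `c` of `γ_g`. -/
def blockC (g : G) : Matrix (Fin 3) (Fin 3) ℂ := intMat (modularMatrix g).1.toBlocks₂₁

/-- The lower right block `d` of `γ_g`. -/
def blockD (g : G) : Matrix (Fin 3) (Fin 3) ℂ := intMat (modularMatrix g).1.toBlocks₂₂

/-! ### Theta functions of degree `k` and the action of `G` -/

/-- `H⁰(J, 𝓛ᵏ)`, the space of theta functions of degree `k` for `Λ`: entire functions `f` on `ℂ³`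
with `f(z + ω₁ u' + ω₂ u'') = exp(-2πik (ᵗv u' + ½ ᵗu' Z u')) f(z)`, where `v = ω₂⁻¹ z`. -/
def H0 (k : ℕ) : Submodule ℂ (V → ℂ) where
  carrier := {f | Differentiable ℂ f ∧ ∀ (z : V) (u' u'' : Fin 3 → ℤ),
    f (z + ω₁ *ᵥ intVec u' + ω₂ *ᵥ intVec u'') =
      Complex.exp (-(2 * Real.pi * Complex.I * k *
        (normCoord z ⬝ᵥ intVec u' + 1 / 2 * (intVec u' ⬝ᵥ (Z *ᵥ intVec u'))))) * f z}
  add_mem' := by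
    rintro f g ⟨hf, hf'⟩ ⟨hg, hg'⟩
    refine ⟨hf.add hg, fun z u' u'' => ?_⟩
    simp only [Pi.add_apply, hf', hg']
    ring
  zero_mem' := ⟨differentiable_const 0, fun z u' u'' => by simp⟩
  smul_mem' := by
    rintro a f ⟨hf, hf'⟩
    refine ⟨hf.const_smul a, fun z u' u'' => ?_⟩
    simp only [Pi.smul_apply, hf', smul_eq_mul]
    ring

/-- The modular action of `g ∈ G` on theta functions of degree `k`: with `γ_g = (a b; c d)` and
`v = ω₂⁻¹ z`, the function `f` is sent to
`z ↦ exp(-πik ᵗv (cZ + d)⁻¹ c v) f(g⁻¹ z)`. In the coordinate `v`, the substitution `z ↦ g⁻¹ z`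
is `v ↦ ᵗ(cZ + d)⁻¹ v`, and `(aZ + b)(cZ + d)⁻¹ = Z`, so that this is `f ↦ f^{γ_g}` divided by the
exponential factor of the theta transformation formula. For even `k` it is the linearization of
`𝓛ᵏ` that is trivial on the fibre over the origin. -/
def thetaAction (k : ℕ) (g : G) : (V → ℂ) →ₗ[ℂ] (V → ℂ) where
  toFun f := fun z =>
    Complex.exp (-(Real.pi * Complex.I * k *
      (normCoord z ⬝ᵥ (((blockC g * Z + blockD g)⁻¹ * blockC g) *ᵥ normCoord z)))) *
      f (((g⁻¹ : G) : GL (Fin 3) ℂ).val *ᵥ z)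
  map_add' f h := by
    funext z
    simp only [Pi.add_apply]
    ring
  map_smul' a f := by
    funext z
    simp only [Pi.smul_apply, smul_eq_mul, RingHom.id_apply]
    ring

/-- `H⁰(J, 𝓛ᵏ)^G`. -/
def H0Inv (k : ℕ) : Submodule ℂ (V → ℂ) where
  carrier := {f | f ∈ H0 k ∧ ∀ g : G, thetaAction k g f = f}
  add_mem' := by
    rintro f h ⟨hf, hf'⟩ ⟨hh, hh'⟩
    exact ⟨(H0 k).add_mem hf hh, fun g => by rw [map_add, hf', hh']⟩
  zero_mem' := ⟨(H0 k).zero_mem, fun g => map_zero _⟩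
  smul_mem' := by
    rintro a f ⟨hf, hf'⟩
    exact ⟨(H0 k).smul_mem a hf, fun g => by rw [map_smul, hf']⟩

theorem one_mem_H0Inv : (1 : V → ℂ) ∈ H0Inv 0 := by
  refine ⟨⟨differentiable_const 1, fun z u' u'' => by simp⟩, fun g => ?_⟩
  funext z
  simp [thetaAction]

theorem mul_mem_H0Inv {k l : ℕ} {f h : V → ℂ} (hf : f ∈ H0Inv k) (hh : h ∈ H0Inv l) :
    f * h ∈ H0Inv (k + l) := by
  obtain ⟨⟨hf, hf'⟩, hfG⟩ := hf
  obtain ⟨⟨hh, hh'⟩, hhG⟩ := hh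
  refine ⟨⟨hf.mul hh, fun z u' u'' => ?_⟩, fun g => ?_⟩
  · simp only [Pi.mul_apply, hf', hh']
    rw [mul_mul_mul_comm, ← Complex.exp_add]
    congr 2
    push_cast
    ring
  · funext z
    have h1 := congrFun (hfG g) z
    have h2 := congrFun (hhG g) z
    simp only [thetaAction, LinearMap.coe_mk, AddHom.coe_mk, Pi.mul_apply] at h1 h2 ⊢
    conv_rhs => rw [← h1, ← h2]
    rw [mul_mul_mul_comm, ← Complex.exp_add]
    congr 2
    push_cast
    ring

/-- The graded pieces of the algebra of invariant theta functions
`S(𝓛²)^G = ⨁ₚ H⁰(J, 𝓛²ᵖ)^G`. -/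
def invTheta (p : ℕ) : Submodule ℂ (V → ℂ) := H0Inv (2 * p)

/-- The graded algebra structure on `S(𝓛²)^G = ⨁ₚ invTheta p`. -/
instance : SetLike.GradedMonoid invTheta where
  one_mem := one_mem_H0Inv
  mul_mem i j f h hf hh := by
    unfold invTheta at *
    rw [mul_add]
    exact mul_mem_H0Inv hf hh

/-! ### Hilbert functions, weighted projective spaces, Veronese algebras -/

/-- The Hilbert function `p ↦ dim 𝒜ₚ` of a graded algebra over `ℂ`, given by its graded pieces. (`finrank` of
an infinite-dimensional piece is `0`; a positive value includes finite-dimensionality.) -/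
def hilbertFunction {A : Type} [CommRing A] [Algebra ℂ A] (𝒜 : ℕ → Submodule ℂ A)
    [SetLike.GradedMonoid 𝒜] (p : ℕ) : ℕ :=
  Module.finrank ℂ (𝒜 p)

/-- The Hilbert series `∑ₚ (dim 𝒜ₚ) tᵖ`. -/
def hilbertSeries {A : Type} [CommRing A] [Algebra ℂ A] (𝒜 : ℕ → Submodule ℂ A)
    [SetLike.GradedMonoid 𝒜] : PowerSeries ℚ :=
  PowerSeries.mk fun p => (hilbertFunction 𝒜 p : ℚ)

/-- The homogeneous coordinate ring of the weighted projective space `ℙ(w₀, …, wₙ₋₁)`: the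
polynomial ring graded by `deg xᵢ = wᵢ`. -/
def weightedCoordRing {n : ℕ} (w : Fin n → ℕ) : ℕ → Submodule ℂ (MvPolynomial (Fin n) ℂ) :=
  fun p => MvPolynomial.weightedHomogeneousSubmodule ℂ w p

instance {n : ℕ} (w : Fin n → ℕ) : SetLike.GradedMonoid (weightedCoordRing w) :=
  (MvPolynomial.weightedGradedAlgebra ℂ w).toGradedMonoid

/-- The graded pieces `𝒜_{dp}` of the `d`-th Veronese algebra of a graded algebra. -/
def veronese {A : Type} [CommRing A] [Algebra ℂ A] (d : ℕ) (𝒜 : ℕ → Submodule ℂ A) :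
    ℕ → Submodule ℂ A :=
  fun p => 𝒜 (d * p)

instance {A : Type} [CommRing A] [Algebra ℂ A] (d : ℕ) (𝒜 : ℕ → Submodule ℂ A)
    [SetLike.GradedMonoid 𝒜] : SetLike.GradedMonoid (veronese d 𝒜) where
  one_mem := SetLike.GradedOne.one_mem (A := 𝒜)
  mul_mem i j f h hf hh := by
    unfold veronese at *
    rw [mul_add]
    exact SetLike.GradedMul.mul_mem hf hh

instance fact_prime_seven : Fact (Nat.Prime 7) := ⟨by norm_num⟩

end KleinTheta

end

/-! The dimension of the space of invariants is 1/336 times the sum of the traces of the elements of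
`G` on theta functions of degree k, so everything rests on computing these traces.

A Gaussian factor (`gaussMul`) turns theta functions of even degree k into entire functions fixed by
the Heisenberg translations `heis k` along Λ, which are built from the standard Hermitian form.
Since `G` is unitary and preserves Λ, the modular action becomes plain substitution
(`gaussMul_thetaAction`). For k > 0 the normalized Fourier coefficients identify this space with the
functions on (ℤ/k)³ (`coeffEquiv`). Injectivity is uniqueness of Fourier coefficients. For
surjectivity, translations along Λ/k become, up to scalars, the finite Heisenberg operators; these
act irreducibly, so one nonzero theta function suffices.

If γ_g is block diagonal, g permutes (ℤ/k)³ and its trace counts fixed points (`chi_eq_card`). Up to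
conjugacy and sign this settles every element except those of order 7 and 14. Such a g still
normalizes the Heisenberg operators, hence |χ(g)χ(g⁻¹)| is at most its number of fixed points on
(ℤ/k)⁶ (`norm_chi_mul_chi_inv_le`), which is at most gcd(k, 7) for order 7 and 1 for order 14. The
space of invariants of a subgroup of order 21 has integral dimension, and this determines χ(g) +
χ(g⁻¹) modulo 7. The bound and the congruence leave a single value (`chi_seven`, `chi_fourteen`).

For the comparison with ℙ(1,2,4,7), the generating series of the dimension formula and the Hilbert
series of the Veronese algebra both become 1 + X⁴ after multiplication by (1 − X)²(1 − X²)(1 − X⁷).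
-/

noncomputable section

/-! ### Fourier coefficients of entire ℤᵈ-periodic functions -/

namespace TorusFourier

open MeasureTheory Complex Topology

local instance : MeasureSpace UnitAddCircle := ⟨AddCircle.haarAddCircle⟩

local instance : Measure.IsAddHaarMeasure (volume : Measure UnitAddCircle) :=
  inferInstanceAs (Measure.IsAddHaarMeasure AddCircle.haarAddCircle)

local instance : IsProbabilityMeasure (volume : Measure UnitAddCircle) :=
  inferInstanceAs (IsProbabilityMeasure AddCircle.haarAddCircle)

variable {d : Type} [Fintype d]

/-- Functions on `ℂᵈ` that are periodic for `ℤᵈ`. -/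
def IsPeriodic (g : (d → ℂ) → ℂ) : Prop :=
  ∀ (v : d → ℂ) (m : d → ℤ), g (v + fun i => (m i : ℂ)) = g v

/-- The projection `ℝᵈ → (ℝ/ℤ)ᵈ`. -/
def torusMk (x : d → ℝ) : UnitAddTorus d := fun i => (x i : UnitAddCircle)

/-- The restriction of a periodic function to real arguments, as a function on the torus. -/
def onTorus (g : (d → ℂ) → ℂ) (t : UnitAddTorus d) : ℂ :=
  g fun i => ((AddCircle.equivIco 1 0 (t i) : ℝ) : ℂ)

/-- The exponential `v ↦ exp(2πi n·v)`. -/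
def expDot (n : d → ℤ) (v : d → ℂ) : ℂ := exp (2 * Real.pi * I * ((fun i => (n i : ℂ)) ⬝ᵥ v))

/-- The Fourier coefficients of a periodic function on `ℂᵈ`, computed on `ℝᵈ`. -/
def fourierCoeff (g : (d → ℂ) → ℂ) (n : d → ℤ) : ℂ := UnitAddTorus.mFourierCoeff (onTorus g) n

theorem torusMk_add (x y : d → ℝ) : torusMk (x + y) = torusMk x + torusMk y := rfl

theorem exists_torusMk (t : UnitAddTorus d) : ∃ x, torusMk x = t :=
  ⟨fun i => (AddCircle.equivIco 1 0 (t i) : ℝ), funext fun _ => AddCircle.coe_equivIco⟩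

theorem onTorus_mk {g : (d → ℂ) → ℂ} (hg : IsPeriodic g) (x : d → ℝ) :
    onTorus g (torusMk x) = g fun i => (x i : ℂ) := by
  have h : ∀ i, ∃ m : ℤ, (AddCircle.equivIco 1 0 (torusMk x i) : ℝ) = x i + m := by
    intro i
    have h := AddCircle.coe_equivIco (p := (1 : ℝ)) (a := 0) (y := torusMk x i)
    obtain ⟨m, hm⟩ := AddSubgroup.mem_zmultiples_iff.1 (QuotientAddGroup.eq.1 h.symm)
    exact ⟨m, by rw [zsmul_one] at hm; linarith⟩
  choose m hm using h
  rw [onTorus, ← hg (fun i => (x i : ℂ)) m]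
  congr 1
  funext i
  simp [hm]

theorem torusMk_isOpenQuotientMap : IsOpenQuotientMap (torusMk : (d → ℝ) → UnitAddTorus d) :=
  IsOpenQuotientMap.piMap fun _ => QuotientAddGroup.isOpenQuotientMap_mk

theorem IsPeriodic.comp_add {g : (d → ℂ) → ℂ} (hg : IsPeriodic g) (w : d → ℂ) :
    IsPeriodic fun v => g (v + w) := fun v m => by
  simp only; rw [add_right_comm]; exact hg _ m

theorem IsPeriodic.mul {g h : (d → ℂ) → ℂ} (hg : IsPeriodic g) (hh : IsPeriodic h) :
    IsPeriodic fun v => g v * h v := fun v m => by simp only [hg v m, hh v m]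

theorem IsPeriodic.add {g h : (d → ℂ) → ℂ} (hg : IsPeriodic g) (hh : IsPeriodic h) :
    IsPeriodic (g + h) := fun v m => by simp only [Pi.add_apply, hg v m, hh v m]

theorem expDot_add (n : d → ℤ) (v w : d → ℂ) : expDot n (v + w) = expDot n v * expDot n w := by
  rw [expDot, dotProduct_add, mul_add, Complex.exp_add]; rfl

theorem expDot_add_left (m n : d → ℤ) (v : d → ℂ) :
    expDot (m + n) v = expDot m v * expDot n v := by
  simp only [expDot, ← Complex.exp_add, ← mul_add, ← add_dotProduct]
  congr 3
  funext i
  simp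

theorem expDot_ne_zero (n : d → ℤ) (v : d → ℂ) : expDot n v ≠ 0 := Complex.exp_ne_zero _

theorem expDot_zero_left (v : d → ℂ) : expDot 0 v = 1 := by simp [expDot, dotProduct]

theorem expDot_neg (n : d → ℤ) (v : d → ℂ) : expDot (-n) v = (expDot n v)⁻¹ := by
  refine eq_inv_of_mul_eq_one_left ?_
  rw [← expDot_add_left, neg_add_cancel, expDot_zero_left]

theorem expDot_intCast (n m : d → ℤ) : expDot n (fun i => (m i : ℂ)) = 1 := by
  rw [expDot, Complex.exp_eq_one_iff]
  exact ⟨n ⬝ᵥ m, by simp [dotProduct]; ring⟩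

theorem isPeriodic_expDot (n : d → ℤ) : IsPeriodic (expDot n) := fun v m => by
  rw [expDot_add, expDot_intCast, mul_one]

theorem differentiable_expDot (n : d → ℤ) : Differentiable ℂ (expDot n) := by
  unfold expDot dotProduct
  fun_prop

theorem continuous_onTorus {g : (d → ℂ) → ℂ} (hg : IsPeriodic g) (hc : Continuous g) :
    Continuous (onTorus g) := by
  rw [torusMk_isOpenQuotientMap.isQuotientMap.continuous_iff]
  have : onTorus g ∘ torusMk = fun x : d → ℝ => g fun i => (x i : ℂ) :=
    funext fun x => onTorus_mk hg x
  rw [this]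
  fun_prop

theorem mFourier_torusMk (n : d → ℤ) (x : d → ℝ) :
    UnitAddTorus.mFourier n (torusMk x) = expDot n fun i => (x i : ℂ) := by
  simp only [UnitAddTorus.mFourier, ContinuousMap.coe_mk, torusMk, fourier_coe_apply, expDot,
    dotProduct, ← Complex.exp_sum, Finset.mul_sum]
  congr 1
  exact Finset.sum_congr rfl fun i _ => by push_cast; ring

/-- Cauchy's theorem on the rectangle with opposite corners Re ζ and ζ + 1: the vertical sides
cancel by periodicity, which moves the contour down to the real axis; the remaining real shift is
again absorbed by periodicity. -/
theorem integral_add_single_periodic {φ : ℂ → ℂ} (hφ : Differentiable ℂ φ)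
    (hp : ∀ z, φ (z + 1) = φ z) (ζ : ℂ) :
    ∫ x in (0 : ℝ)..1, φ (x + ζ) = ∫ x in (0 : ℝ)..1, φ x := by
  have h := Complex.integral_boundary_rect_eq_zero_of_differentiableOn φ ζ.re (ζ + 1)
    hφ.differentiableOn
  simp only [ofReal_re, ofReal_im, add_re, one_re, add_im, one_im, add_zero, ofReal_zero, zero_mul,
    ofReal_add, ofReal_one] at h
  have h1 : ∀ y : ℝ, φ (ζ.re + 1 + y * I) = φ (ζ.re + y * I) := fun y => by
    rw [← hp (ζ.re + y * I)]; congr 1; ring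
  simp only [h1, add_sub_cancel_right] at h
  have hper : Function.Periodic (fun x : ℝ => φ x) 1 := fun x => by
    simp only [ofReal_add, ofReal_one]; exact hp _
  have h2 := hper.intervalIntegral_add_eq ζ.re 0
  rw [zero_add] at h2
  rw [← h2, sub_eq_zero.1 h]
  have h3 := intervalIntegral.integral_comp_add_right (a := 0) (b := 1)
    (fun x : ℝ => φ (x + ζ.im * I)) ζ.re
  rw [zero_add, add_comm 1 ζ.re] at h3
  rw [← h3]
  refine intervalIntegral.integral_congr fun x _ => congrArg φ ?_
  conv_lhs => rw [← re_add_im ζ]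
  push_cast; ring

variable [DecidableEq d]

theorem integral_onTorus_add_single {Φ : (d → ℂ) → ℂ} (hd : Differentiable ℂ Φ)
    (hp : IsPeriodic Φ) (j : d) (ζ : ℂ) :
    ∫ t, onTorus (fun v => Φ (v + Pi.single j ζ)) t = ∫ t, onTorus Φ t := by
  -- The right side does not involve ζ. It arises by averaging over real shifts s in the j-th
  -- direction, which do not change the Haar integral, exchanging the integrals, and shifting the
  -- contour of the inner one.
  have key : ∀ ζ : ℂ, ∫ t, onTorus (fun v => Φ (v + Pi.single j ζ)) t =
      ∫ t : UnitAddTorus d, ∫ s in (0 : ℝ)..1, onTorus (fun v => Φ (v + Pi.single j (s : ℂ))) t := by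
    intro ζ
    set Ψ : (d → ℂ) → ℂ := fun v => Φ (v + Pi.single j ζ) with hΨ
    have hdΨ : Differentiable ℂ Ψ := by fun_prop
    have hpΨ : IsPeriodic Ψ := fun v m => by
      simp only [hΨ]; rw [add_right_comm]; exact hp _ m
    have hpS : ∀ w : d → ℂ, IsPeriodic fun v => Φ (v + w) := fun w v m => by
      simp only; rw [add_right_comm]; exact hp _ m
    have h1 : ∀ s : ℝ, ∫ t, onTorus Ψ (t + torusMk (Pi.single j s)) = ∫ t, onTorus Ψ t :=
      fun s => integral_add_right_eq_self (onTorus Ψ) _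
    have h2 : ∫ s in (0 : ℝ)..1, ∫ t, onTorus Ψ (t + torusMk (Pi.single j s)) =
        ∫ t, onTorus Ψ t := by simp [h1]
    have hcs : Continuous (fun s : ℝ => torusMk (Pi.single j s : d → ℝ)) := by
      refine torusMk_isOpenQuotientMap.continuous.comp ?_
      exact continuous_pi fun i => by
        by_cases h : i = j
        · subst h; simpa using continuous_id'
        · simpa [Pi.single_apply, h] using continuous_const
    have hc : Continuous (Function.uncurry fun (s : ℝ) (t : UnitAddTorus d) =>
        onTorus Ψ (t + torusMk (Pi.single j s))) :=
      (continuous_onTorus hpΨ hdΨ.continuous).comp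
        (continuous_snd.add (hcs.comp continuous_fst))
    rw [← h2, intervalIntegral_integral_swap]
    · refine integral_congr_ae (.of_forall fun t => ?_)
      obtain ⟨x, rfl⟩ := exists_torusMk t
      simp only [← torusMk_add, onTorus_mk hpΨ, onTorus_mk (hpS _)]
      set φ : ℂ → ℂ := fun z => Φ ((fun i => (x i : ℂ)) + Pi.single j z) with hφ
      have hdφ : Differentiable ℂ φ := by
        refine hd.comp ((differentiable_const _).add ?_)
        rw [differentiable_pi]
        intro i
        by_cases h : i = j
        · subst h; simp
        · simp [Pi.single_apply, h]
      have hpφ : ∀ z, φ (z + 1) = φ z := fun z => by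
        simp only [hφ]
        refine Eq.trans ?_ (hp ((fun i => (x i : ℂ)) + Pi.single j z) (Pi.single j 1))
        congr 1
        funext i
        by_cases h : i = j
        · subst h; simp; ring
        · simp [Pi.single_apply, h]
      rw [← integral_add_single_periodic hdφ hpφ ζ]
      refine intervalIntegral.integral_congr fun s _ => ?_
      simp only [hφ, hΨ]
      congr 1
      funext i
      by_cases h : i = j
      · subst h; simp; ring
      · simp [Pi.single_apply, h]
    · have : Integrable (Function.uncurry fun (s : ℝ) (t : UnitAddTorus d) =>
          onTorus Ψ (t + torusMk (Pi.single j s)))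
          ((volume.prod volume).restrict (Set.uIoc (0:ℝ) 1 ×ˢ Set.univ)) := by
        refine (hc.continuousOn.integrableOn_compact (K := Set.Icc (0:ℝ) 1 ×ˢ Set.univ)
          (isCompact_Icc.prod isCompact_univ)).mono_set ?_
        rw [Set.uIoc_of_le zero_le_one]
        exact Set.prod_mono Set.Ioc_subset_Icc_self subset_rfl
      rw [← Measure.prod_restrict, Measure.restrict_univ] at this
      exact this
  rw [key ζ, ← key 0]
  simp

theorem integral_onTorus_add {Φ : (d → ℂ) → ℂ} (hd : Differentiable ℂ Φ)
    (hp : IsPeriodic Φ) (w : d → ℂ) :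
    ∫ t, onTorus (fun v => Φ (v + w)) t = ∫ t, onTorus Φ t := by
  have key : ∀ s : Finset d, ∫ t, onTorus (fun v => Φ (v + ∑ j ∈ s, Pi.single j (w j))) t =
      ∫ t, onTorus Φ t := by
    intro s
    induction s using Finset.induction_on with
    | empty => simp
    | insert j s hj ih =>
      rw [← ih, ← integral_onTorus_add_single (Φ := fun v => Φ (v + ∑ j ∈ s, Pi.single j (w j)))
        (by fun_prop) (fun v m => by simp only; rw [add_right_comm]; exact hp _ m) j (w j)]
      simp only [Finset.sum_insert hj, add_assoc]
  have := key Finset.univ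
  rwa [Finset.univ_sum_single] at this

theorem fourierCoeff_eq {g : (d → ℂ) → ℂ} (hp : IsPeriodic g) (n : d → ℤ) :
    fourierCoeff g n = ∫ t, onTorus (fun v => expDot (-n) v * g v) t := by
  refine integral_congr_ae (.of_forall fun t => ?_)
  obtain ⟨x, rfl⟩ := exists_torusMk t
  simp only [smul_eq_mul]
  rw [mFourier_torusMk, onTorus_mk hp, onTorus_mk ((isPeriodic_expDot _).mul hp)]

/-- Complex translations, not only real ones, preserve the integral of the entire periodic function
`expDot (-n) * g`. This replaces the expansion of g in a Fourier series converging on all of ℂᵈ. -/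
theorem fourierCoeff_comp_add {g : (d → ℂ) → ℂ} (hd : Differentiable ℂ g) (hp : IsPeriodic g)
    (w : d → ℂ) (n : d → ℤ) :
    fourierCoeff (fun v => g (v + w)) n = expDot n w * fourierCoeff g n := by
  have h1 : (fun v => expDot (-n) v * g (v + w)) =
      fun v => expDot n w * (fun v => (fun u => expDot (-n) u * g u) (v + w)) v := by
    funext v
    simp only
    rw [expDot_add, expDot_neg, expDot_neg]
    field_simp [expDot_ne_zero]
  rw [fourierCoeff_eq (hp.comp_add w), h1, fourierCoeff_eq hp,
    ← integral_onTorus_add (Φ := fun u => expDot (-n) u * g u)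
      ((differentiable_expDot _).mul hd) ((isPeriodic_expDot _).mul hp) w]
  exact integral_const_mul (expDot n w) _

/-- For each complex w the function v ↦ g (v + w) has vanishing coefficients too. Its Fourier series
is then trivially summable and represents it on the real torus, and evaluation at 0 gives g w = 0.
No identity theorem is needed. -/
theorem eq_zero_of_fourierCoeff_eq_zero {g : (d → ℂ) → ℂ} (hd : Differentiable ℂ g)
    (hp : IsPeriodic g) (h : ∀ n, fourierCoeff g n = 0) : g = 0 := by
  funext w
  have hc := continuous_onTorus (hp.comp_add w) (g := fun v => g (v + w))
    (hd.continuous.comp (by fun_prop))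
  have h0 : UnitAddTorus.mFourierCoeff
      (⟨_, hc⟩ : C(UnitAddTorus d, ℂ)) = fun _ => 0 := by
    funext n
    change fourierCoeff (fun v => g (v + w)) n = 0
    rw [fourierCoeff_comp_add hd hp, h, mul_zero]
  have hs := UnitAddTorus.hasSum_mFourier_series_apply_of_summable
    (f := (⟨_, hc⟩ : C(UnitAddTorus d, ℂ))) (by rw [h0]; exact summable_zero) (torusMk 0)
  rw [h0] at hs
  simp only [zero_smul] at hs
  have := hs.unique hasSum_zero
  rw [ContinuousMap.coe_mk, onTorus_mk (hp.comp_add w)] at this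
  have h1 : (fun i : d => (((0 : d → ℝ) i : ℝ) : ℂ)) + w = w := by funext i; simp
  rwa [h1] at this

theorem integrable_onTorus {g : (d → ℂ) → ℂ} (hp : IsPeriodic g) (hc : Continuous g) :
    Integrable (onTorus g) :=
  (continuous_onTorus hp hc).integrable_of_hasCompactSupport (HasCompactSupport.of_compactSpace _)

theorem fourierCoeff_add {g h : (d → ℂ) → ℂ} (hg : IsPeriodic g) (hh : IsPeriodic h)
    (hcg : Continuous g) (hch : Continuous h) (n : d → ℤ) :
    fourierCoeff (g + h) n = fourierCoeff g n + fourierCoeff h n := by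
  rw [fourierCoeff_eq hg, fourierCoeff_eq hh, fourierCoeff_eq (hg.add hh), ← integral_add
    (integrable_onTorus ((isPeriodic_expDot _).mul hg)
      ((differentiable_expDot _).continuous.mul hcg))
    (integrable_onTorus ((isPeriodic_expDot _).mul hh)
      ((differentiable_expDot _).continuous.mul hch))]
  exact integral_congr_ae (.of_forall fun t => mul_add _ _ _)

theorem fourierCoeff_smul (a : ℂ) (g : (d → ℂ) → ℂ) (n : d → ℤ) :
    fourierCoeff (a • g) n = a * fourierCoeff g n := by
  rw [fourierCoeff, fourierCoeff, UnitAddTorus.mFourierCoeff, UnitAddTorus.mFourierCoeff,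
    ← integral_const_mul]
  exact integral_congr_ae (.of_forall fun t => mul_left_comm _ _ _)

theorem fourierCoeff_expDot_mul {g : (d → ℂ) → ℂ} (hp : IsPeriodic g) (m n : d → ℤ) :
    fourierCoeff (fun v => expDot m v * g v) n = fourierCoeff g (n - m) := by
  rw [fourierCoeff_eq ((isPeriodic_expDot m).mul hp), fourierCoeff_eq hp]
  simp only [← mul_assoc, ← expDot_add_left]
  rw [neg_sub, neg_add_eq_sub]

theorem fourierCoeff_const (a : ℂ) (n : d → ℤ) :
    fourierCoeff (fun _ : d → ℂ => a) n = if n = 0 then a else 0 := by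
  have hp : IsPeriodic fun _ : d → ℂ => a := fun _ _ => rfl
  split_ifs with h
  · subst h
    rw [fourierCoeff_eq hp]
    simp [expDot_zero_left, onTorus]
  · obtain ⟨i, hi⟩ := Function.ne_iff.1 h
    -- A constant is unchanged by the shift by eᵢ/(2nᵢ), but its n-th coefficient gets multiplied by
    -- exp(πi) = −1.
    have h1 := fourierCoeff_comp_add (differentiable_const a) hp (Pi.single i (1 / (2 * n i))) n
    have h2 : expDot n (Pi.single i (1 / (2 * n i))) = -1 := by
      rw [expDot, dotProduct_single, ← Complex.exp_pi_mul_I]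
      congr 1
      have : (n i : ℂ) ≠ 0 := by exact_mod_cast hi
      field_simp
    rw [h2] at h1
    linear_combination (1 / 2) * h1

/-- Fourier coefficients under a unimodular substitution. -/
theorem fourierCoeff_comp_mulVec {g : (d → ℂ) → ℂ} (hp : IsPeriodic g) (hc : Continuous g)
    (B B' : Matrix d d ℤ)
    (hB : B * B' = 1) (n : d → ℤ) :
    fourierCoeff (fun v => g (B.map (fun x => (x : ℂ)) *ᵥ v)) (B.transpose *ᵥ n) =
      fourierCoeff g n := by
  have hpB : IsPeriodic fun v => g (B.map (fun x => (x : ℂ)) *ᵥ v) := fun v m => by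
    simp only [Matrix.mulVec_add]
    refine Eq.trans ?_ (hp _ (B *ᵥ m))
    congr 2
    funext i
    simp [Matrix.mulVec, dotProduct]
  let T : UnitAddTorus d →+ UnitAddTorus d :=
    { toFun := fun t i => ∑ j, B i j • t j
      map_zero' := by funext i; simp
      map_add' := fun s t => by funext i; simp [Finset.sum_add_distrib] }
  have hT : ∀ x : d → ℝ, T (torusMk x) = torusMk (B.map (fun x => (x : ℝ)) *ᵥ x) := by
    intro x
    funext i
    simp only [T, AddMonoidHom.coe_mk, ZeroHom.coe_mk, torusMk, Matrix.mulVec, dotProduct,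
      Matrix.map_apply]
    refine Eq.trans ?_ (map_sum (QuotientAddGroup.mk' (AddSubgroup.zmultiples (1 : ℝ))) _ _).symm
    refine Finset.sum_congr rfl fun j _ => ?_
    rw [← AddCircle.coe_zsmul, zsmul_eq_mul]
    rfl
  have hcont : Continuous T := by
    refine continuous_pi fun i => continuous_finsetSum _ fun j _ => ?_
    exact (continuous_apply j).zsmul _
  have hsurj : Function.Surjective T := fun t => by
    obtain ⟨x, rfl⟩ := exists_torusMk t
    refine ⟨torusMk (B'.map (fun x => (x : ℝ)) *ᵥ x), ?_⟩
    rw [hT, Matrix.mulVec_mulVec]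
    have : B.map (fun x => (x : ℝ)) * B'.map (fun x => (x : ℝ)) = 1 := by
      have h := congrArg (fun M : Matrix d d ℤ => M.map (Int.castRingHom ℝ)) hB
      simp only [Matrix.map_mul] at h
      exact h.trans (by simp)
    rw [this, Matrix.one_mulVec]
  -- A continuous surjective endomorphism of a compact group preserves Haar measure; surjectivity
  -- comes from the right inverse B' of B.
  have hmp : MeasurePreserving T (volume : Measure (UnitAddTorus d)) volume :=
    AddMonoidHom.measurePreserving hcont hsurj rfl
  have hdot : ∀ v, expDot (-(B.transpose *ᵥ n)) v =
      expDot (-n) (B.map (fun x => (x : ℂ)) *ᵥ v) := fun v => by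
    rw [expDot_neg, expDot_neg, expDot, expDot, Matrix.dotProduct_mulVec]
    congr 4
    funext i
    simp [Matrix.vecMul, Matrix.mulVec, dotProduct, mul_comm]
  rw [fourierCoeff_eq hp, fourierCoeff_eq hpB]
  simp only [hdot]
  set Φ : (d → ℂ) → ℂ := fun v => expDot (-n) v * g v with hΦ
  have hpΦ : IsPeriodic Φ := (isPeriodic_expDot _).mul hp
  have hpΦB : IsPeriodic fun v => Φ (B.map (fun x => (x : ℂ)) *ᵥ v) := fun v m => by
    have := ((isPeriodic_expDot (-(B.transpose *ᵥ n))).mul hpB) v m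
    simpa only [hdot] using this
  have hTi : ∀ t, onTorus (fun v => Φ (B.map (fun x => (x : ℂ)) *ᵥ v)) t = onTorus Φ (T t) := by
    intro t
    obtain ⟨x, rfl⟩ := exists_torusMk t
    rw [onTorus_mk hpΦB, hT, onTorus_mk hpΦ]
    congr 1
    funext i
    simp [Matrix.mulVec, dotProduct]
  calc ∫ t, onTorus (fun v => Φ (B.map (fun x => (x : ℂ)) *ᵥ v)) t
      = ∫ t, onTorus Φ (T t) := by simp only [hTi]
    _ = ∫ t, onTorus Φ t := by
      rw [← integral_map hmp.measurable.aemeasurable, hmp.map_eq]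
      exact (continuous_onTorus hpΦ
        ((differentiable_expDot _).continuous.mul hc)).aestronglyMeasurable

end TorusFourier

/-! ### The Hermitian normalization of theta functions -/

namespace KleinTheta

open Complex

/-- The scale `πk/√7` of the invariant Hermitian form of degree `k`. -/
def kap (k : ℕ) : ℂ := Real.pi * k / (Real.sqrt 7 : ℝ)

/-- Since 2α − 1 = i√7, all exponents become κ times elements of ℚ(α), and later identities between
them need only α² = α − 2. -/
theorem kap_mul (k : ℕ) : kap k * (2 * α - 1) = Real.pi * k * I := by
  have h : ((Real.sqrt 7 : ℝ) : ℂ) ≠ 0 := by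
    exact_mod_cast (Real.sqrt_pos.2 (by norm_num : (0 : ℝ) < 7)).ne'
  unfold kap α
  field_simp
  ring

/-- The standard Hermitian form on `ℂ³`. -/
def herm (x z : V) : ℂ := star x ⬝ᵥ z

theorem herm_add_left (x y z : V) : herm (x + y) z = herm x z + herm y z := by
  simp [herm, add_dotProduct]

theorem herm_add_right (x y z : V) : herm x (y + z) = herm x y + herm x z := by
  simp [herm, dotProduct_add]

theorem herm_smul_left (c : ℂ) (x z : V) : herm (c • x) z = star c * herm x z := by
  simp [herm, smul_dotProduct]

theorem herm_smul_right (c : ℂ) (x z : V) : herm x (c • z) = c * herm x z := by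
  simp [herm, dotProduct_smul]

/-- The Heisenberg translation `T_x`. -/
def heis (k : ℕ) (x : V) : (V → ℂ) →ₗ[ℂ] (V → ℂ) where
  toFun F := fun z => exp (-(kap k * (herm x z + herm x x / 2))) * F (z + x)
  map_add' F H := by funext z; simp only [Pi.add_apply]; ring
  map_smul' a F := by funext z; simp only [Pi.smul_apply, smul_eq_mul, RingHom.id_apply]; ring

theorem heis_apply (k : ℕ) (x : V) (F : V → ℂ) (z : V) :
    heis k x F z = exp (-(kap k * (herm x z + herm x x / 2))) * F (z + x) := rfl

theorem heis_zero (k : ℕ) (F : V → ℂ) : heis k 0 F = F := by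
  funext z
  simp [heis_apply, herm]

theorem heis_heis (k : ℕ) (x y : V) (F : V → ℂ) :
    heis k x (heis k y F) = exp (kap k / 2 * (herm x y - herm y x)) • heis k (x + y) F := by
  funext z
  simp only [heis_apply, Pi.smul_apply, smul_eq_mul, ← mul_assoc, ← Complex.exp_add]
  rw [add_assoc z x y]
  congr 2
  simp only [herm_add_left, herm_add_right]
  ring

theorem heis_differentiable (k : ℕ) (x : V) {F : V → ℂ} (hF : Differentiable ℂ F) :
    Differentiable ℂ (heis k x F) := by
  change Differentiable ℂ fun z => exp (-(kap k * (herm x z + herm x x / 2))) * F (z + x)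
  have : Differentiable ℂ fun z => herm x z := by
    unfold herm dotProduct
    fun_prop
  fun_prop

/-- The period `ω₁ a + ω₂ b`. -/
def period (a b : Fin 3 → ℤ) : V := ω₁ *ᵥ intVec a + ω₂ *ᵥ intVec b

/-- Theta functions of degree `k` in the Hermitian normalization. -/
def NT (k : ℕ) : Submodule ℂ (V → ℂ) where
  carrier := {F | Differentiable ℂ F ∧ ∀ a b, heis k (period a b) F = F}
  add_mem' := by
    rintro f g ⟨hf, hf'⟩ ⟨hg, hg'⟩
    exact ⟨hf.add hg, fun a b => by rw [map_add, hf', hg']⟩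
  zero_mem' := ⟨differentiable_const 0, fun a b => map_zero _⟩
  smul_mem' := by
    rintro c f ⟨hf, hf'⟩
    exact ⟨hf.const_smul c, fun a b => by rw [map_smul, hf']⟩

/-- The vector `ᵗC⁻¹ a`. -/
def dualVec (a : Fin 3 → ℤ) : V := (Cᵀ)⁻¹ *ᵥ intVec a

/-- The vector `C b`. -/
def latVec (b : Fin 3 → ℤ) : V := C *ᵥ intVec b

theorem C_mul_inv : C * ((Cᵀ)⁻¹)ᵀ = 1 := by
  rw [C_transpose_inv]
  ext i j
  fin_cases i <;> fin_cases j <;> simp [C, Matrix.mul_apply, Fin.sum_univ_three]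

theorem inv_mul_C : ((Cᵀ)⁻¹)ᵀ * C = 1 := mul_eq_one_comm.1 C_mul_inv

theorem star_dualVec (a : Fin 3 → ℤ) : star (dualVec a) = dualVec a := by
  rw [dualVec, C_transpose_inv]
  funext i
  fin_cases i <;> simp [Matrix.mulVec, dotProduct, Fin.sum_univ_three, intVec]

theorem star_latVec (a : Fin 3 → ℤ) : star (latVec a) = latVec a := by
  rw [latVec, C]
  funext i
  fin_cases i <;> simp [Matrix.mulVec, dotProduct, Fin.sum_univ_three, intVec]

theorem ω₁_mulVec (a : Fin 3 → ℤ) : ω₁ *ᵥ intVec a = (-2 * (1 - α)) • dualVec a := by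
  rw [ω₁, Matrix.smul_mulVec, αbar_eq, dualVec]

theorem ω₂_mulVec (b : Fin 3 → ℤ) : ω₂ *ᵥ intVec b = α • latVec b := by
  rw [ω₂, Matrix.smul_mulVec, latVec]

theorem α_inv : α⁻¹ = (1 - α) / 2 := by
  rw [inv_eq_iff_eq_inv]
  refine eq_inv_of_mul_eq_one_left ?_
  linear_combination (-1 / 2) * α_sq

theorem ω₂_inv : ω₂⁻¹ = ((1 - α) / 2) • ((Cᵀ)⁻¹)ᵀ := by
  apply Matrix.inv_eq_right_inv
  rw [ω₂, Matrix.smul_mul, Matrix.mul_smul, C_mul_inv, smul_smul, ← α_inv,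
    mul_inv_cancel₀ α_ne_zero, one_smul]

theorem normCoord_dot (z : V) (a : Fin 3 → ℤ) :
    normCoord z ⬝ᵥ intVec a = (1 - α) / 2 * (z ⬝ᵥ dualVec a) := by
  rw [normCoord, ω₂_inv, Matrix.smul_mulVec, smul_dotProduct, smul_eq_mul, dualVec,
    Matrix.mulVec_transpose, Matrix.dotProduct_mulVec]

theorem Z_eq : Z = (-(1 - α) ^ 2) • (((Cᵀ)⁻¹)ᵀ * (Cᵀ)⁻¹) := by
  rw [Z, ω₂_inv, ω₁, αbar_eq, Matrix.smul_mul, Matrix.mul_smul, smul_smul]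
  congr 1
  ring

theorem intVec_Z (a : Fin 3 → ℤ) :
    intVec a ⬝ᵥ (Z *ᵥ intVec a) = -(1 - α) ^ 2 * (dualVec a ⬝ᵥ dualVec a) := by
  rw [Z_eq, Matrix.smul_mulVec, dotProduct_smul, smul_eq_mul, ← Matrix.mulVec_mulVec,
    Matrix.dotProduct_mulVec, Matrix.vecMul_transpose]
  rfl

theorem dualVec_dot_latVec (a b : Fin 3 → ℤ) : dualVec a ⬝ᵥ latVec b = ((a ⬝ᵥ b : ℤ) : ℂ) := by
  rw [dualVec, latVec, Matrix.dotProduct_mulVec, ← Matrix.vecMul_transpose, Matrix.vecMul_vecMul,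
    inv_mul_C, Matrix.vecMul_one]
  simp [dotProduct, intVec]

theorem herm_ω₂ (t : ℝ) (b : Fin 3 → ℤ) (z : V) :
    herm ((t : ℂ) • (ω₂ *ᵥ intVec b)) z = t * (1 - α) * (z ⬝ᵥ latVec b) := by
  rw [ω₂_mulVec, herm_smul_left, herm_smul_left, herm, star_latVec, star_α, dotProduct_comm]
  simp [mul_assoc]

theorem herm_ω₁ (t : ℝ) (a : Fin 3 → ℤ) (z : V) :
    herm ((t : ℂ) • (ω₁ *ᵥ intVec a)) z = t * (-2 * α) * (z ⬝ᵥ dualVec a) := by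
  have : star (-2 * (1 - α)) = -2 * α := by
    rw [star_mul', star_sub, star_one, star_α, star_neg, star_ofNat]
    ring
  rw [ω₁_mulVec, herm_smul_left, herm_smul_left, herm, star_dualVec, this, dotProduct_comm]
  simp [mul_assoc]

/-- The commutator pairing of two periods. -/
theorem herm_period_sub (a b a' b' : Fin 3 → ℤ) :
    herm (period a b) (period a' b') - herm (period a' b') (period a b) =
      -2 * (2 * α - 1) * ((a ⬝ᵥ b' - b ⬝ᵥ a' : ℤ) : ℂ) := by
  have h1 : ∀ (a : Fin 3 → ℤ) (z : V), herm (ω₁ *ᵥ intVec a) z = -2 * α * (z ⬝ᵥ dualVec a) :=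
    fun a z => by simpa using herm_ω₁ 1 a z
  have h2 : ∀ (b : Fin 3 → ℤ) (z : V), herm (ω₂ *ᵥ intVec b) z = (1 - α) * (z ⬝ᵥ latVec b) :=
    fun b z => by simpa using herm_ω₂ 1 b z
  simp only [period, herm_add_left, h1, h2, add_dotProduct]
  simp only [ω₁_mulVec, ω₂_mulVec, smul_dotProduct, smul_eq_mul, dualVec_dot_latVec,
    dotProduct_comm (latVec _) (dualVec _)]
  rw [dotProduct_comm (dualVec a') (dualVec a), dotProduct_comm (latVec b') (latVec b),
    dotProduct_comm b a']
  push_cast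
  ring

/-- Multiplication by the Gaussian factor that passes to the Hermitian normalization. -/
def gaussMul (k : ℕ) : (V → ℂ) ≃ₗ[ℂ] (V → ℂ) where
  toFun f := fun z => exp (kap k * (1 - α) ^ 2 / 4 * (z ⬝ᵥ z)) * f z
  invFun f := fun z => exp (-(kap k * (1 - α) ^ 2 / 4 * (z ⬝ᵥ z))) * f z
  map_add' F H := by funext z; simp only [Pi.add_apply]; ring
  map_smul' a F := by funext z; simp only [Pi.smul_apply, smul_eq_mul, RingHom.id_apply]; ring
  left_inv f := by
    funext z
    simp only [← mul_assoc, ← Complex.exp_add, neg_add_cancel, Complex.exp_zero, one_mul]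
  right_inv f := by
    funext z
    simp only [← mul_assoc, ← Complex.exp_add, add_neg_cancel, Complex.exp_zero, one_mul]

theorem gaussMul_apply (k : ℕ) (f : V → ℂ) (z : V) :
    gaussMul k f z = exp (kap k * (1 - α) ^ 2 / 4 * (z ⬝ᵥ z)) * f z := rfl

theorem gaussMul_symm_apply (k : ℕ) (f : V → ℂ) (z : V) :
    (gaussMul k).symm f z = exp (-(kap k * (1 - α) ^ 2 / 4 * (z ⬝ᵥ z))) * f z := rfl

/-- The constant (1 − α)²/4 in `gaussMul` is chosen for this: by α(1 − α) = 2, the change of the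
Gaussian under the translation cancels the Heisenberg factor. The real parameter t will be 1 for
periods and 1/k for torsion points. -/
theorem heis_ω₂_gaussMul (k : ℕ) (t : ℝ) (b : Fin 3 → ℤ) (f : V → ℂ) :
    heis k ((t : ℂ) • (ω₂ *ᵥ intVec b)) (gaussMul k f) =
      gaussMul k fun z => f (z + (t : ℂ) • (ω₂ *ᵥ intVec b)) := by
  funext z
  simp only [heis_apply, gaussMul_apply, ← mul_assoc, ← Complex.exp_add, herm_ω₂]
  congr 2
  simp only [ω₂_mulVec, add_dotProduct, dotProduct_add, smul_dotProduct, dotProduct_smul,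
    smul_eq_mul, dotProduct_comm (latVec b) z]
  grind [α_sq]

/-- In the complementary direction the same Gaussian leaves, for t = 1, the inverse of the classical
automorphy factor. -/
theorem heis_ω₁_gaussMul (k : ℕ) (t : ℝ) (a : Fin 3 → ℤ) (f : V → ℂ) :
    heis k ((t : ℂ) • (ω₁ *ᵥ intVec a)) (gaussMul k f) =
      gaussMul k fun z => exp (2 * Real.pi * I * k * (t * (normCoord z ⬝ᵥ intVec a) +
        t ^ 2 / 2 * (intVec a ⬝ᵥ (Z *ᵥ intVec a)))) * f (z + (t : ℂ) • (ω₁ *ᵥ intVec a)) := by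
  funext z
  simp only [heis_apply, gaussMul_apply, ← mul_assoc, ← Complex.exp_add, herm_ω₁]
  congr 2
  have h := kap_mul k
  rw [show 2 * (Real.pi : ℂ) * I * k = 2 * (kap k * (2 * α - 1)) by rw [h]; ring,
    normCoord_dot, intVec_Z]
  simp only [ω₁_mulVec, add_dotProduct, dotProduct_add, smul_dotProduct, dotProduct_smul,
    smul_eq_mul, dotProduct_comm (dualVec a) z]
  grind [α_sq]

theorem period_add (a b a' b' : Fin 3 → ℤ) :
    period a b + period a' b' = period (a + a') (b + b') := by
  have : ∀ a b : Fin 3 → ℤ, intVec (a + b) = intVec a + intVec b := fun a b => by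
    funext i; simp [intVec]
  simp only [period, this, Matrix.mulVec_add]
  abel

/-- The composition law of the operators `T_{λ/k}`, `λ` a period. -/
theorem heis_period_heis_period (k : ℕ) (s t : ℝ) (a b a' b' : Fin 3 → ℤ) (F : V → ℂ) :
    heis k ((s : ℂ) • period a b) (heis k ((t : ℂ) • period a' b') F) =
      exp (-(Real.pi * I * k * s * t * ((a ⬝ᵥ b' - b ⬝ᵥ a' : ℤ) : ℂ))) •
        heis k ((s : ℂ) • period a b + (t : ℂ) • period a' b') F := by
  rw [heis_heis]
  congr 2
  simp only [herm_smul_left, herm_smul_right]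
  have h := herm_period_sub a b a' b'
  have h2 := kap_mul k
  simp only [Complex.star_def, conj_ofReal]
  linear_combination kap k / 2 * s * t * h - s * t * ((a ⬝ᵥ b' - b ⬝ᵥ a' : ℤ) : ℂ) * h2

theorem period_zero_right (a : Fin 3 → ℤ) : period a 0 = ω₁ *ᵥ intVec a := by
  have : intVec 0 = 0 := by funext i; simp [intVec]
  simp [period, this]

theorem period_zero_left (b : Fin 3 → ℤ) : period 0 b = ω₂ *ᵥ intVec b := by
  have : intVec 0 = 0 := by funext i; simp [intVec]
  simp [period, this]

theorem exp_int_mul_pi_mul_I {k : ℕ} (hk : Even k) (n : ℤ) :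
    exp (-(Real.pi * I * k * n)) = 1 := by
  obtain ⟨m, rfl⟩ := hk
  rw [Complex.exp_eq_one_iff]
  exact ⟨-(m * n), by push_cast; ring⟩

/-- Here the parity of k enters: the cocycle exp(−πik n), n an integer, is trivial on periods, so
invariance may be tested on ω₁ℤ³ and ω₂ℤ³ separately. -/
theorem heis_period_eq {k : ℕ} (hk : Even k) (a b : Fin 3 → ℤ) (F : V → ℂ) :
    heis k (period a b) F = heis k (ω₁ *ᵥ intVec a) (heis k (ω₂ *ᵥ intVec b) F) := by
  have h := heis_period_heis_period k 1 1 a 0 0 b F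
  simp only [ofReal_one, one_smul, mul_one, exp_int_mul_pi_mul_I hk] at h
  rw [period_add, period_zero_right, period_zero_left, add_zero, zero_add] at h
  exact h.symm

theorem differentiable_gauss (c : ℂ) : Differentiable ℂ fun z : V => exp (c * (z ⬝ᵥ z)) := by
  unfold dotProduct
  fun_prop

theorem gaussMul_mem_NT {k : ℕ} (hk : Even k) (f : V → ℂ) : gaussMul k f ∈ NT k ↔ f ∈ H0 k := by
  have hd : Differentiable ℂ (gaussMul k f) ↔ Differentiable ℂ f := by
    constructor
    · intro h
      have h1 : f = (gaussMul k).symm (gaussMul k f) := by simp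
      rw [h1]
      simp only [gaussMul_symm_apply, ← neg_mul, funext_iff.2 (gaussMul_symm_apply k _)]
      exact (differentiable_gauss _).mul h
    · intro h
      exact (differentiable_gauss _).mul h
  have hb : (∀ b, heis k (ω₂ *ᵥ intVec b) (gaussMul k f) = gaussMul k f) ↔
      ∀ z b, f (z + ω₂ *ᵥ intVec b) = f z := by
    have h1 : ∀ b, heis k (ω₂ *ᵥ intVec b) (gaussMul k f) = gaussMul k f ↔
        ∀ z, f (z + ω₂ *ᵥ intVec b) = f z := fun b => by
      have := heis_ω₂_gaussMul k 1 b f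
      simp only [ofReal_one, one_smul] at this
      rw [this, (gaussMul k).injective.eq_iff, funext_iff]
    simp only [h1]
    exact forall_comm
  have ha : (∀ a, heis k (ω₁ *ᵥ intVec a) (gaussMul k f) = gaussMul k f) ↔
      ∀ z a, f (z + ω₁ *ᵥ intVec a) = exp (-(2 * Real.pi * I * k *
        (normCoord z ⬝ᵥ intVec a + 1 / 2 * (intVec a ⬝ᵥ (Z *ᵥ intVec a))))) * f z := by
    have h1 : ∀ a, heis k (ω₁ *ᵥ intVec a) (gaussMul k f) = gaussMul k f ↔
        ∀ z, f (z + ω₁ *ᵥ intVec a) = exp (-(2 * Real.pi * I * k *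
        (normCoord z ⬝ᵥ intVec a + 1 / 2 * (intVec a ⬝ᵥ (Z *ᵥ intVec a))))) * f z := fun a => by
      have := heis_ω₁_gaussMul k 1 a f
      simp only [ofReal_one, one_smul, one_mul, one_pow] at this
      rw [this, (gaussMul k).injective.eq_iff, funext_iff]
      refine forall_congr' fun z => ?_
      rw [Complex.exp_neg, eq_inv_mul_iff_mul_eq₀ (Complex.exp_ne_zero _)]
    simp only [h1]
    exact forall_comm
  constructor
  · rintro ⟨h1, h2⟩
    have hb' := hb.1 fun b => by rw [← period_zero_left]; exact h2 0 b
    have ha' := ha.1 fun a => by rw [← period_zero_right]; exact h2 a 0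
    exact ⟨hd.1 h1, fun z a b => by rw [hb', ha']⟩
  · rintro ⟨h1, h2⟩
    have h0 : intVec 0 = 0 := by funext i; simp [intVec]
    have hb' := hb.2 fun z b => by simpa [h0] using h2 z 0 b
    have ha' := ha.2 fun z a => by simpa [h0] using h2 z a 0
    exact ⟨hd.2 h1, fun a b => by rw [heis_period_eq hk, hb', ha']⟩

end KleinTheta

/-! ### The action of `G` becomes substitution -/

namespace KleinTheta

open Complex

theorem reflMatrix_conjTranspose (φ : V) : (reflMatrix φ)ᴴ = reflMatrix φ := by
  have h : star (star φ ⬝ᵥ φ) = star φ ⬝ᵥ φ := by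
    rw [← Matrix.star_dotProduct_star, star_star]
  rw [reflMatrix, Matrix.conjTranspose_sub, Matrix.conjTranspose_one, Matrix.conjTranspose_smul,
    Matrix.conjTranspose_vecMulVec, star_star, star_div₀, h, star_ofNat]

/-- The generating reflections are Hermitian involutions, hence unitary. -/
theorem G_unitary (g : G) : (g.1.val)ᴴ * g.1.val = 1 := by
  obtain ⟨g, hg⟩ := g
  change (g.val)ᴴ * g.val = 1
  have hr : ∀ φ, (reflMatrix φ)ᴴ * reflMatrix φ = 1 := fun φ => by
    rw [reflMatrix_conjTranspose, reflMatrix_mul_self]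
  induction hg using Subgroup.closure_induction with
  | mem x hx =>
    rcases hx with rfl | rfl | rfl <;> exact hr _
  | one => simp
  | mul x y _ _ hx hy =>
    rw [Units.val_mul, Matrix.conjTranspose_mul, Matrix.mul_assoc, ← Matrix.mul_assoc _ x.val, hx,
      Matrix.one_mul, hy]
  | inv x _ hx =>
    have h1 : x.val * (x⁻¹).val = 1 := by rw [← Units.val_mul, mul_inv_cancel, Units.val_one]
    have h2 : (x⁻¹).val = (x.val)ᴴ := by
      rw [← Matrix.one_mul (x⁻¹).val, ← hx, Matrix.mul_assoc, h1, Matrix.mul_one]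
    rw [h2, Matrix.conjTranspose_conjTranspose, ← h2, h1]

theorem herm_mulVec (g : G) (x z : V) : herm (g.1.val *ᵥ x) (g.1.val *ᵥ z) = herm x z := by
  rw [herm, Matrix.star_mulVec, Matrix.dotProduct_mulVec, Matrix.vecMul_vecMul, G_unitary,
    Matrix.vecMul_one]
  rfl

theorem mulVec_inv_mulVec (g : G) (z : V) : g.1.val *ᵥ ((g⁻¹).1.val *ᵥ z) = z := by
  rw [Matrix.mulVec_mulVec, ← Units.val_mul, ← Subgroup.coe_mul, mul_inv_cancel]
  simp

theorem inv_mulVec_mulVec (g : G) (z : V) : (g⁻¹).1.val *ᵥ (g.1.val *ᵥ z) = z := by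
  simpa using mulVec_inv_mulVec g⁻¹ z

/-- The action of `G` on functions by substitution. -/
def act (g : G) : (V → ℂ) →ₗ[ℂ] (V → ℂ) where
  toFun F := fun z => F ((g⁻¹).1.val *ᵥ z)
  map_add' _ _ := rfl
  map_smul' _ _ := rfl

theorem act_apply (g : G) (F : V → ℂ) (z : V) : act g F z = F ((g⁻¹).1.val *ᵥ z) := rfl

/-- The exponent of the Heisenberg factor depends only on Hermitian products, which g preserves. -/
theorem act_heis (k : ℕ) (g : G) (x : V) (F : V → ℂ) :
    act g (heis k x F) = heis k (g.1.val *ᵥ x) (act g F) := by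
  funext z
  have h : herm (g.1.val *ᵥ x) z = herm x ((g⁻¹).1.val *ᵥ z) := by
    rw [← herm_mulVec g x, mulVec_inv_mulVec]
  rw [act_apply, heis_apply, heis_apply, act_apply, h, herm_mulVec, Matrix.mulVec_add,
    inv_mulVec_mulVec]

theorem act_mul (g h : G) (F : V → ℂ) : act (g * h) F = act g (act h F) := by
  funext z
  simp only [act_apply, mul_inv_rev, Subgroup.coe_mul, Units.val_mul, Matrix.mulVec_mulVec]

theorem act_one (F : V → ℂ) : act 1 F = F := by
  funext z
  simp [act_apply]

/-- The matrix of `g` in the basis of periods. -/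
def IsPeriodMatrix (g : G) (M : Matrix (Fin 3 ⊕ Fin 3) (Fin 3 ⊕ Fin 3) ℤ) : Prop :=
  g.1.val * Ω = Ω * intMat M

theorem Ω_mulVec (a b : Fin 3 → ℤ) : Ω *ᵥ (fun i => ((Sum.elim a b i : ℤ) : ℂ)) = period a b := by
  have : (fun i => ((Sum.elim a b i : ℤ) : ℂ)) = Sum.elim (intVec a) (intVec b) := by
    funext i; cases i <;> rfl
  rw [this, Ω, Matrix.fromCols_mulVec_sumElim, period]

theorem intMat_mulVec {m n : Type} [Fintype n] (M : Matrix m n ℤ) (u : n → ℤ) :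
    intMat M *ᵥ (fun i => (u i : ℂ)) = fun i => ((M *ᵥ u) i : ℂ) := by
  funext i
  simp [intMat, Matrix.mulVec, dotProduct]

theorem IsPeriodMatrix.mulVec_period {g : G} {M} (h : IsPeriodMatrix g M) (u : Fin 3 ⊕ Fin 3 → ℤ) :
    g.1.val *ᵥ period (u ∘ Sum.inl) (u ∘ Sum.inr) =
      period ((M *ᵥ u) ∘ Sum.inl) ((M *ᵥ u) ∘ Sum.inr) := by
  rw [← Ω_mulVec, ← Ω_mulVec, Sum.elim_comp_inl_inr, Sum.elim_comp_inl_inr, Matrix.mulVec_mulVec,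
    h, ← Matrix.mulVec_mulVec, intMat_mulVec]

theorem IsPeriodMatrix.mul {g h : G} {M N} (hg : IsPeriodMatrix g M) (hh : IsPeriodMatrix h N) :
    IsPeriodMatrix (g * h) (M * N) := by
  unfold IsPeriodMatrix at *
  rw [Subgroup.coe_mul, Units.val_mul, Matrix.mul_assoc, hh, ← Matrix.mul_assoc, hg, intMat_mul,
    Matrix.mul_assoc]

theorem isPeriodMatrix_modularMatrix (g : G) :
    IsPeriodMatrix g (modularMatrix g).1ᵀ := (modularMatrix_spec g).symm

theorem exists_mulVec_period (g : G) (a b : Fin 3 → ℤ) :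
    ∃ a' b', g.1.val *ᵥ period a b = period a' b' := by
  have h := (isPeriodMatrix_modularMatrix g).mulVec_period (Sum.elim a b)
  rw [Sum.elim_comp_inl, Sum.elim_comp_inr] at h
  exact ⟨_, _, h⟩

theorem act_mem_NT {k : ℕ} (g : G) {F : V → ℂ} (hF : F ∈ NT k) : act g F ∈ NT k := by
  refine ⟨hF.1.comp ?_, fun a b => ?_⟩
  · rw [differentiable_pi]
    intro i
    unfold Matrix.mulVec dotProduct
    fun_prop
  · obtain ⟨a', b', h⟩ := exists_mulVec_period g⁻¹ a b
    have := act_heis k g (period a' b') F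
    rw [hF.2, ← h, mulVec_inv_mulVec] at this
    exact this.symm

/-- The representation of `G` on theta functions of degree `k`. -/
def rep (k : ℕ) : Representation ℂ G (NT k) where
  toFun g := (act g).restrict fun _ hF => act_mem_NT g hF
  map_one' := by
    ext F : 2
    exact act_one F.1
  map_mul' g h := by
    ext F : 2
    exact act_mul g h F.1

theorem rep_coe (k : ℕ) (g : G) (F : NT k) : (rep k g F).1 = act g F.1 := rfl

theorem Z_transpose : Zᵀ = Z := by
  rw [Z_eq, Matrix.transpose_smul, Matrix.transpose_mul, Matrix.transpose_transpose]

theorem C_map_star : C.map star = C := by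
  rw [C]
  ext i j
  fin_cases i <;> fin_cases j <;> simp
  exact map_ofNat _ 2

theorem transpose_C_mul_inv : Cᵀ * (Cᵀ)⁻¹ = 1 := by
  have := congrArg Matrix.transpose inv_mul_C
  rwa [Matrix.transpose_mul, Matrix.transpose_transpose, Matrix.transpose_one] at this

theorem inv_transpose_C_mul : (Cᵀ)⁻¹ * Cᵀ = 1 := mul_eq_one_comm.1 transpose_C_mul_inv

theorem intMat_map_star {m n : Type} (A : Matrix m n ℤ) : (intMat A).map star = intMat A := by
  ext i j
  simp [intMat]

theorem map_star_mul (A B : Matrix (Fin 3) (Fin 3) ℂ) :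
    (A * B).map star = A.map star * B.map star := by
  ext i j
  simp [Matrix.mul_apply]

/-- The second block column of the defining relation of `γ_g`, in normalized coordinates. -/
theorem C_mul_block (g : G) :
    C * (Z * (blockC g)ᵀ + (blockD g)ᵀ) = g.1.val * C := by
  have h := modularMatrix_spec g
  unfold IsModularMatrix at h
  have h2 : ω₁ * (blockC g)ᵀ + ω₂ * (blockD g)ᵀ = g.1.val * ω₂ := by
    have h3 := congrArg Matrix.toCols₂ h
    rw [Ω, Matrix.mul_fromCols, Matrix.toCols₂_fromCols] at h3
    rw [← h3]
    ext i j
    simp [Matrix.mul_apply, Fintype.sum_sum_type, Matrix.toCols₂, blockC, blockD, intMat,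
      Matrix.toBlocks₂₁, Matrix.toBlocks₂₂, Matrix.fromCols]
  have hZ : ω₁ = α • (C * Z) := by
    rw [ω₁, αbar_eq, Z_eq, Matrix.mul_smul, ← Matrix.mul_assoc, C_mul_inv, Matrix.one_mul,
      smul_smul]
    congr 1
    linear_combination (α - 1) * α_sq
  rw [hZ, ω₂, Matrix.smul_mul, Matrix.smul_mul, Matrix.mul_smul, ← smul_add] at h2
  have h4 := congrArg (fun M => α⁻¹ • M) h2
  simp only [smul_smul, inv_mul_cancel₀ α_ne_zero, one_smul] at h4
  rw [Matrix.mul_add, ← Matrix.mul_assoc, h4]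

/-- In C(Z ᵗc + ᵗd) = gC the matrices C, c, d are real. Subtracting the complex conjugate relation
eliminates d, and Z − Z̄ = (2α − 1) C⁻¹ ᵗC⁻¹. -/
theorem blockC_eq (g : G) :
    (2 * α - 1) • blockC g = Cᵀ * ((g.1.val)ᵀ - (g.1.val)ᴴ) * C := by
  have h1 := C_mul_block g
  have h2 := congrArg (fun M => M.map star) h1
  have hc : ((blockC g)ᵀ).map star = (blockC g)ᵀ := by
    rw [Matrix.transpose_map, blockC, intMat_map_star]
  have hd : ((blockD g)ᵀ).map star = (blockD g)ᵀ := by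
    rw [Matrix.transpose_map, blockD, intMat_map_star]
  have hZ : Z.map star = (-α ^ 2) • (((Cᵀ)⁻¹)ᵀ * (Cᵀ)⁻¹) := by
    have h2 : (starRingEnd ℂ) 2 = 2 := map_ofNat _ 2
    have h3 : (starRingEnd ℂ) α = 1 - α := star_α
    rw [Z_eq, C_transpose_inv]
    ext i j
    fin_cases i <;> fin_cases j <;>
      simp [Matrix.mul_apply, Fin.sum_univ_three, h2, h3]
  simp only [map_star_mul, C_map_star] at h2
  rw [show (Z * (blockC g)ᵀ + (blockD g)ᵀ).map star = Z.map star * (blockC g)ᵀ + (blockD g)ᵀ by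
    rw [Matrix.map_add _ (fun a b => star_add a b), map_star_mul, hc, hd]] at h2
  have h3 : C * ((Z - Z.map star) * (blockC g)ᵀ) = (g.1.val - (g.1.val).map star) * C := by
    rw [Matrix.sub_mul, Matrix.sub_mul, ← h1, ← h2]
    simp only [Matrix.mul_add, Matrix.mul_sub]
    abel
  have hZZ : Z - Z.map star = (2 * α - 1) • (((Cᵀ)⁻¹)ᵀ * (Cᵀ)⁻¹) := by
    rw [hZ, Z_eq, ← sub_smul]
    congr 1
    ring
  rw [hZZ, Matrix.smul_mul, Matrix.mul_smul, Matrix.mul_assoc, ← Matrix.mul_assoc C, C_mul_inv,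
    Matrix.one_mul] at h3
  have h4 := congrArg (fun M => Cᵀ * M) h3
  simp only [Matrix.mul_smul, ← Matrix.mul_assoc, transpose_C_mul_inv, Matrix.one_mul] at h4
  have h5 := congrArg Matrix.transpose h4
  rw [Matrix.transpose_smul, Matrix.transpose_transpose] at h5
  rw [h5, Matrix.transpose_mul, Matrix.transpose_mul, Matrix.transpose_transpose,
    Matrix.transpose_sub, ← Matrix.mul_assoc]
  rfl

/-- The quadratic form of the modular factor. -/
theorem modular_factor (g : G) (z : V) :
    (2 * α - 1) * (normCoord z ⬝ᵥ (((blockC g * Z + blockD g)⁻¹ * blockC g) *ᵥ normCoord z)) =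
      (1 - α) ^ 2 / 4 * (z ⬝ᵥ z - ((g⁻¹).1.val *ᵥ z) ⬝ᵥ ((g⁻¹).1.val *ᵥ z)) := by
  set h := (g⁻¹).1.val with hh
  have hg : g.1.val * h = 1 := by
    rw [hh, ← Units.val_mul, ← Subgroup.coe_mul, mul_inv_cancel]; simp
  have hg' : h * g.1.val = 1 := mul_eq_one_comm.1 hg
  have hH : (g.1.val)ᴴ = h := by
    rw [← Matrix.mul_one (g.1.val)ᴴ, ← hg, ← Matrix.mul_assoc, G_unitary, Matrix.one_mul]
  -- Transposing `C_mul_block` exhibits cZ + d as ᵗg conjugated by ᵗC, so its inverse is obtained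
  -- from g⁻¹.
  have hD : (blockC g * Z + blockD g) * Cᵀ = Cᵀ * (g.1.val)ᵀ := by
    have := congrArg Matrix.transpose (C_mul_block g)
    rwa [Matrix.transpose_mul, Matrix.transpose_mul, Matrix.transpose_add, Matrix.transpose_mul,
      Matrix.transpose_transpose, Matrix.transpose_transpose, Z_transpose] at this
  have hinv : (blockC g * Z + blockD g)⁻¹ = Cᵀ * hᵀ * (Cᵀ)⁻¹ := by
    apply Matrix.inv_eq_right_inv
    rw [← Matrix.mul_assoc, ← Matrix.mul_assoc, hD, Matrix.mul_assoc Cᵀ, ← Matrix.transpose_mul,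
      hg', Matrix.transpose_one, Matrix.mul_one, transpose_C_mul_inv]
  have hmain : (2 * α - 1) • ((blockC g * Z + blockD g)⁻¹ * blockC g) =
      Cᵀ * (1 - hᵀ * h) * C := by
    rw [← Matrix.mul_smul, blockC_eq, hinv, hH, Matrix.mul_assoc (Cᵀ * hᵀ), ← Matrix.mul_assoc _ _ C,
      ← Matrix.mul_assoc _ Cᵀ, inv_transpose_C_mul, Matrix.one_mul, Matrix.mul_assoc,
      ← Matrix.mul_assoc hᵀ, Matrix.mul_sub hᵀ, ← Matrix.transpose_mul, hg, Matrix.transpose_one,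
      Matrix.mul_assoc]
  have hv : C *ᵥ normCoord z = ((1 - α) / 2) • z := by
    rw [normCoord, ω₂_inv, Matrix.smul_mulVec, Matrix.mulVec_smul, Matrix.mulVec_mulVec, C_mul_inv,
      Matrix.one_mulVec]
  rw [← smul_eq_mul, ← dotProduct_smul, ← Matrix.smul_mulVec, hmain, ← Matrix.mulVec_mulVec,
    ← Matrix.mulVec_mulVec, Matrix.dotProduct_mulVec, Matrix.vecMul_transpose, hv,
    Matrix.mulVec_smul, dotProduct_smul, smul_dotProduct, Matrix.sub_mulVec, Matrix.one_mulVec,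
    dotProduct_sub, ← Matrix.mulVec_mulVec, Matrix.dotProduct_mulVec, Matrix.vecMul_transpose]
  simp only [smul_eq_mul]
  ring

/-- By `modular_factor` the exponential in the modular action is exactly the Gaussian at g⁻¹z
divided by the Gaussian at z. -/
theorem gaussMul_thetaAction (k : ℕ) (g : G) (f : V → ℂ) :
    gaussMul k (thetaAction k g f) = act g (gaussMul k f) := by
  funext z
  rw [gaussMul_apply, act_apply, gaussMul_apply]
  simp only [thetaAction, LinearMap.coe_mk, AddHom.coe_mk, ← mul_assoc, ← Complex.exp_add]
  congr 2
  have h := modular_factor g z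
  rw [show (Real.pi : ℂ) * I * k = kap k * (2 * α - 1) by rw [kap_mul]; ring, mul_assoc, h]
  ring

theorem finrank_H0Inv {k : ℕ} (hk : Even k) :
    Module.finrank ℂ (H0Inv k) = Module.finrank ℂ (rep k).invariants := by
  refine LinearEquiv.finrank_eq (LinearEquiv.ofBijective
    (LinearMap.codRestrict _ (LinearMap.codRestrict (NT k)
      ((gaussMul k).toLinearMap ∘ₗ (H0Inv k).subtype) fun f => ?_) fun f => ?_) ⟨?_, ?_⟩)
  · exact (gaussMul_mem_NT hk _).2 f.2.1
  · intro g
    refine Subtype.ext ?_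
    rw [rep_coe]
    change act g (gaussMul k f.1) = gaussMul k f.1
    rw [← gaussMul_thetaAction, f.2.2]
  · intro f h hfh
    refine Subtype.ext ((gaussMul k).injective ?_)
    exact congrArg (fun F => F.1.1) hfh
  · rintro ⟨⟨F, hF⟩, hinv⟩
    obtain ⟨f, rfl⟩ := (gaussMul k).surjective F
    refine ⟨⟨f, (gaussMul_mem_NT hk f).1 hF, fun g => (gaussMul k).injective ?_⟩, rfl⟩
    rw [gaussMul_thetaAction]
    exact congrArg Subtype.val (hinv g)

end KleinTheta

/-! ### The Heisenberg operators on functions on (ℤ/N)ᵈ -/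

namespace FiniteHeisenberg

variable {N : ℕ} [NeZero N] {d : Type} [Fintype d] [DecidableEq d]

theorem sum_stdAddChar (y : d → ZMod N) :
    ∑ b : d → ZMod N, ZMod.stdAddChar (y ⬝ᵥ b) =
      if y = 0 then (Fintype.card (d → ZMod N) : ℂ) else 0 := by
  let ψ : AddChar (d → ZMod N) ℂ :=
    ZMod.stdAddChar.compAddMonoidHom
      { toFun := fun b => y ⬝ᵥ b, map_zero' := dotProduct_zero _, map_add' := dotProduct_add _ }
  have h := AddChar.sum_eq_ite ψ
  have h2 : ψ = 0 ↔ y = 0 := by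
    constructor
    · intro h
      funext i
      have h1 := DFunLike.congr_fun h (Pi.single i 1)
      have h3 : ZMod.stdAddChar (y ⬝ᵥ Pi.single i (1 : ZMod N)) = (1 : ℂ) := h1
      rw [dotProduct_single, mul_one, ← AddChar.map_zero_eq_one (ZMod.stdAddChar (N := N))] at h3
      exact ZMod.injective_stdAddChar h3
    · rintro rfl
      ext b
      change ZMod.stdAddChar ((0 : d → ZMod N) ⬝ᵥ b) = (1 : ℂ)
      rw [zero_dotProduct, AddChar.map_zero_eq_one]
  simp only [h2] at h
  exact h

/-- The operator that multiplies by the character `b` and then translates by `a`. -/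
def op (a b : d → ZMod N) : Module.End ℂ ((d → ZMod N) → ℂ) where
  toFun f := fun x => ZMod.stdAddChar ((x - a) ⬝ᵥ b) * f (x - a)
  map_add' f g := by funext x; simp only [Pi.add_apply]; ring
  map_smul' c f := by funext x; simp only [Pi.smul_apply, smul_eq_mul, RingHom.id_apply]; ring

/-- The inverse of `op`. -/
def opInv (a b : d → ZMod N) : Module.End ℂ ((d → ZMod N) → ℂ) where
  toFun f := fun x => ZMod.stdAddChar (-(x ⬝ᵥ b)) * f (x + a)
  map_add' f g := by funext x; simp only [Pi.add_apply]; ring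
  map_smul' c f := by funext x; simp only [Pi.smul_apply, smul_eq_mul, RingHom.id_apply]; ring

theorem op_apply (a b : d → ZMod N) (f : (d → ZMod N) → ℂ) (x) :
    op a b f x = ZMod.stdAddChar ((x - a) ⬝ᵥ b) * f (x - a) := rfl

theorem opInv_apply (a b : d → ZMod N) (f : (d → ZMod N) → ℂ) (x) :
    opInv a b f x = ZMod.stdAddChar (-(x ⬝ᵥ b)) * f (x + a) := rfl

theorem op_mul_opInv (a b : d → ZMod N) : op a b * opInv a b = 1 := by
  refine LinearMap.ext fun f => funext fun x => ?_
  rw [Module.End.mul_apply, op_apply, opInv_apply, ← mul_assoc, ← AddChar.map_add_eq_mul]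
  simp

theorem opInv_mul_op (a b : d → ZMod N) : opInv a b * op a b = 1 := by
  refine LinearMap.ext fun f => funext fun x => ?_
  rw [Module.End.mul_apply, opInv_apply, op_apply, ← mul_assoc, ← AddChar.map_add_eq_mul]
  simp

theorem trace_eq_sum (A : Module.End ℂ ((d → ZMod N) → ℂ)) :
    LinearMap.trace ℂ _ A = ∑ x, A (Pi.single x 1) x := by
  rw [LinearMap.trace_eq_matrix_trace ℂ (Pi.basisFun ℂ (d → ZMod N)), Matrix.trace]
  simp [LinearMap.toMatrix_apply]

theorem apply_eq_sum (A : Module.End ℂ ((d → ZMod N) → ℂ)) (f : (d → ZMod N) → ℂ) (x) :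
    A f x = ∑ y, f y * A (Pi.single y 1) x := by
  have h : f = ∑ y, f y • Pi.single y (1 : ℂ) := by
    funext z
    simp [Pi.single_apply]
  conv_lhs => rw [h]
  simp [map_sum]

/-- Summing over the characters b annihilates all but the diagonal entry of A at x − a, and summing
over the translations a then yields the trace. This is Schur's lemma for the Heisenberg
representation, made explicit. -/
theorem twirl (A : Module.End ℂ ((d → ZMod N) → ℂ)) :
    ∑ p : (d → ZMod N) × (d → ZMod N), op p.1 p.2 * A * opInv p.1 p.2 =
      ((Fintype.card (d → ZMod N) : ℂ) * LinearMap.trace ℂ _ A) • 1 := by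
  refine LinearMap.ext fun f => funext fun x => ?_
  rw [LinearMap.sum_apply, Finset.sum_apply, Fintype.sum_prod_type]
  have h1 : ∀ a b : d → ZMod N, (op a b * A * opInv a b) f x =
      ∑ y, ZMod.stdAddChar ((x - a - y) ⬝ᵥ b) * (f (y + a) * A (Pi.single y 1) (x - a)) := by
    intro a b
    rw [Module.End.mul_apply, Module.End.mul_apply, op_apply, apply_eq_sum A, Finset.mul_sum]
    refine Finset.sum_congr rfl fun y _ => ?_
    rw [opInv_apply, sub_dotProduct (x - a) y b, sub_eq_add_neg ((x - a) ⬝ᵥ b),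
      AddChar.map_add_eq_mul]
    ring
  have h2 : ∀ a : d → ZMod N, ∑ b, (op a b * A * opInv a b) f x =
      (Fintype.card (d → ZMod N) : ℂ) * (f x * A (Pi.single (x - a) 1) (x - a)) := by
    intro a
    simp only [h1]
    rw [Finset.sum_comm]
    simp only [← Finset.sum_mul, sum_stdAddChar, sub_eq_zero (a := x - a)]
    rw [Finset.sum_eq_single (x - a)]
    · simp
    · intro y _ hy
      simp [hy.symm]
    · simp
  simp only [h2]
  rw [← Finset.mul_sum, ← Finset.mul_sum, LinearMap.smul_apply, Module.End.one_apply, Pi.smul_apply,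
    trace_eq_sum, smul_eq_mul,
    Fintype.sum_equiv (Equiv.subLeft x) (fun a => A (Pi.single (x - a) 1) (x - a))
      (fun y => A (Pi.single y 1) y) fun a => rfl]
  ring

theorem trace_op_mul_opInv (a b a' b' : d → ZMod N) :
    LinearMap.trace ℂ _ (op a b * opInv a' b') =
      if a = a' ∧ b = b' then (Fintype.card (d → ZMod N) : ℂ) else 0 := by
  rw [trace_eq_sum]
  by_cases ha : a = a'
  · subst ha
    have h1 : ∀ x : d → ZMod N, (op a b * opInv a b') (Pi.single x 1) x =
        ZMod.stdAddChar ((b - b') ⬝ᵥ (x - a)) := fun x => by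
      rw [Module.End.mul_apply, op_apply, opInv_apply, sub_add_cancel, Pi.single_eq_same, mul_one,
        ← AddChar.map_add_eq_mul, ← sub_eq_add_neg, ← dotProduct_sub, dotProduct_comm]
    simp only [h1]
    rw [Fintype.sum_equiv (Equiv.subRight a) (fun x => ZMod.stdAddChar ((b - b') ⬝ᵥ (x - a)))
      (fun y => ZMod.stdAddChar ((b - b') ⬝ᵥ y)) fun a => rfl, sum_stdAddChar]
    simp [sub_eq_zero]
  · have h1 : ∀ x : d → ZMod N, (op a b * opInv a' b') (Pi.single x 1) x = 0 := fun x => by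
      rw [Module.End.mul_apply, op_apply, opInv_apply, Pi.single_eq_of_ne, mul_zero, mul_zero]
      intro h
      exact ha (by linear_combination (exp := 1) -h)
    simp [h1, ha]

/-- An operator that normalizes the Heisenberg operators has `‖tr A · tr A⁻¹‖` at most the number
of fixed points of the induced permutation. -/
theorem norm_trace_mul_trace_le (A A' : Module.End ℂ ((d → ZMod N) → ℂ)) (hA : A * A' = 1)
    (σ : (d → ZMod N) × (d → ZMod N) → (d → ZMod N) × (d → ZMod N))
    (c : (d → ZMod N) × (d → ZMod N) → ℂ) (hc : ∀ p, ‖c p‖ = 1)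
    (h : ∀ p, A * op p.1 p.2 = c p • (op (σ p).1 (σ p).2 * A)) :
    ‖LinearMap.trace ℂ _ A * LinearMap.trace ℂ _ A'‖ ≤
      (Finset.univ.filter fun p => σ p = p).card := by
  have h1 : ∀ p, A * opInv p.1 p.2 * A' = (c p)⁻¹ • opInv (σ p).1 (σ p).2 := by
    intro p
    have hcp : c p ≠ 0 := fun h0 => by simpa [h0] using hc p
    have h2 : op (σ p).1 (σ p).2 * A * opInv p.1 p.2 = (c p)⁻¹ • A := by
      have h3 := congrArg (fun M => M * opInv p.1 p.2) (h p)
      simp only [mul_assoc, op_mul_opInv, mul_one, smul_mul_assoc] at h3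
      rw [mul_assoc, eq_inv_smul_iff₀ hcp]
      exact h3.symm
    have h4 := congrArg (fun M => opInv (σ p).1 (σ p).2 * M * A') h2
    simp only [← mul_assoc, opInv_mul_op, one_mul, mul_smul_comm, smul_mul_assoc] at h4
    rw [h4, mul_assoc, hA, mul_one]
  have h2 := congrArg (fun M => LinearMap.trace ℂ _ (M * A')) (twirl A)
  have hX : (Fintype.card (d → ZMod N) : ℂ) ≠ 0 := Nat.cast_ne_zero.2 Fintype.card_ne_zero
  -- Multiply the twirl of A by A' and take traces. Each summand becomes a multiple of the trace of
  -- `op` at p times `opInv` at σ p, which vanishes unless σ p = p.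
  have h3 : LinearMap.trace ℂ _ A * LinearMap.trace ℂ _ A' =
      ∑ p ∈ Finset.univ.filter (fun p => σ p = p), (c p)⁻¹ := by
    simp only [Finset.sum_mul, mul_assoc] at h2
    simp only [← mul_assoc A, h1, mul_smul_comm, map_sum, map_smul, trace_op_mul_opInv,
      smul_mul_assoc, one_mul, smul_eq_mul] at h2
    rw [mul_assoc] at h2
    refine mul_left_cancel₀ hX (h2.symm.trans ?_)
    rw [Finset.sum_filter, Finset.mul_sum]
    refine Finset.sum_congr rfl fun p _ => ?_
    have : (p.1 = (σ p).1 ∧ p.2 = (σ p).2) ↔ σ p = p := by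
      rw [Prod.ext_iff]; exact ⟨fun h => ⟨h.1.symm, h.2.symm⟩, fun h => ⟨h.1.symm, h.2.symm⟩⟩
    simp only [this]
    split_ifs <;> ring
  rw [h3]
  refine (norm_sum_le _ _).trans ?_
  simp [hc]

/-- The Heisenberg operators act irreducibly. -/
theorem eq_top_of_op_mem (R : Submodule ℂ ((d → ZMod N) → ℂ)) (hR : ∀ a b, ∀ f ∈ R, op a b f ∈ R)
    (hne : R ≠ ⊥) : R = ⊤ := by
  obtain ⟨f, hf, hf0⟩ := Submodule.exists_mem_ne_zero_of_ne_bot hne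
  obtain ⟨x₀, hx₀⟩ := Function.ne_iff.1 hf0
  -- The character sum isolates the value of f at x₀; translations then carry this delta function to
  -- all others.
  have h1 : Pi.single x₀ (1 : ℂ) ∈ R := by
    have h2 : ∑ b, ZMod.stdAddChar (-(x₀ ⬝ᵥ b)) • op 0 b f ∈ R :=
      R.sum_mem fun b _ => R.smul_mem _ (hR 0 b f hf)
    have h3 : ∑ b, ZMod.stdAddChar (-(x₀ ⬝ᵥ b)) • op 0 b f =
        ((Fintype.card (d → ZMod N) : ℂ) * f x₀) • Pi.single x₀ (1 : ℂ) := by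
      funext x
      have h4 : ∀ b : d → ZMod N, (ZMod.stdAddChar (-(x₀ ⬝ᵥ b)) • op 0 b f) x =
          ZMod.stdAddChar ((x - x₀) ⬝ᵥ b) * f x := fun b => by
        rw [Pi.smul_apply, op_apply, sub_zero, smul_eq_mul, ← mul_assoc, ← AddChar.map_add_eq_mul,
          sub_dotProduct, neg_add_eq_sub]
      rw [Finset.sum_apply]
      simp only [h4]
      rw [← Finset.sum_mul, sum_stdAddChar]
      by_cases hx : x = x₀
      · subst hx; simp
      · simp [sub_eq_zero, hx]
    rw [h3] at h2
    have hX : (Fintype.card (d → ZMod N) : ℂ) ≠ 0 := Nat.cast_ne_zero.2 Fintype.card_ne_zero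
    exact (R.smul_mem_iff (mul_ne_zero hX hx₀)).1 h2
  rw [eq_top_iff]
  intro g _
  have h : g = ∑ y, g y • op (y - x₀) 0 (Pi.single x₀ (1 : ℂ)) := by
    funext z
    have : ∀ y, z - (y - x₀) = x₀ ↔ y = z := fun y => by
      rw [sub_eq_iff_eq_add, add_sub_cancel, eq_comm]
    simp [op_apply, Pi.single_apply, this]
  rw [h]
  exact R.sum_mem fun y _ => R.smul_mem _ (hR _ _ _ h1)

end FiniteHeisenberg

/-! ### Theta functions as functions on (ℤ/k)³ -/

namespace KleinTheta

open Complex TorusFourier FiniteHeisenberg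

/-- The classical theta function of `F`, in the coordinate `v`. -/
def pullback (k : ℕ) (F : V → ℂ) (v : V) : ℂ := (gaussMul k).symm F (ω₂ *ᵥ v)

theorem normCoord_ω₂ (v : V) : normCoord (ω₂ *ᵥ v) = v := by
  have h : ω₂⁻¹ * ω₂ = 1 := by
    rw [ω₂_inv, ω₂, Matrix.smul_mul, Matrix.mul_smul, inv_mul_C, smul_smul, ← α_inv,
      inv_mul_cancel₀ α_ne_zero, one_smul]
  rw [normCoord, Matrix.mulVec_mulVec, h, Matrix.one_mulVec]

theorem ω₂_normCoord (v : V) : ω₂ *ᵥ normCoord v = v := by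
  have h : ω₂ * ω₂⁻¹ = 1 := by
    rw [ω₂_inv, ω₂, Matrix.smul_mul, Matrix.mul_smul, C_mul_inv, smul_smul, ← α_inv,
      mul_inv_cancel₀ α_ne_zero, one_smul]
  rw [normCoord, Matrix.mulVec_mulVec, h, Matrix.one_mulVec]

theorem ω₂_mulVec_Z (a : V) : ω₂ *ᵥ (Z *ᵥ a) = ω₁ *ᵥ a := by
  rw [Z, ← Matrix.mulVec_mulVec]
  exact ω₂_normCoord (ω₁ *ᵥ a)

section H0

variable {k : ℕ} {f : V → ℂ} (hf : f ∈ H0 k)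
include hf

theorem isPeriodic_of_mem_H0 : IsPeriodic fun v : V => f (ω₂ *ᵥ v) := fun v m => by
  have h0 : intVec 0 = 0 := by funext i; simp [intVec]
  have := hf.2 (ω₂ *ᵥ v) 0 m
  simp only [h0, Matrix.mulVec_zero, dotProduct_zero, add_zero, mul_zero, neg_zero,
    Complex.exp_zero, one_mul] at this
  simp only [Matrix.mulVec_add]
  exact this

theorem differentiable_of_mem_H0 : Differentiable ℂ fun v : V => f (ω₂ *ᵥ v) := by
  refine hf.1.comp ?_
  unfold Matrix.mulVec dotProduct
  fun_prop

theorem quasiPeriodic_of_mem_H0 (v : V) (a : Fin 3 → ℤ) :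
    f (ω₂ *ᵥ (v + Z *ᵥ intVec a)) = exp (-(Real.pi * I * k * (intVec a ⬝ᵥ (Z *ᵥ intVec a)))) *
      (expDot (-(k : ℤ) • a) v * f (ω₂ *ᵥ v)) := by
  have h0 : intVec 0 = 0 := by funext i; simp [intVec]
  have := hf.2 (ω₂ *ᵥ v) a 0
  rw [h0, Matrix.mulVec_zero, add_zero, normCoord_ω₂] at this
  rw [Matrix.mulVec_add, ω₂_mulVec_Z, this, ← mul_assoc, expDot, ← Complex.exp_add]
  congr 2
  have : (fun i => (((-(k : ℤ) • a) i : ℤ) : ℂ)) ⬝ᵥ v = -k * (v ⬝ᵥ intVec a) := by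
    simp only [dotProduct, intVec, Finset.mul_sum]
    exact Finset.sum_congr rfl fun i _ => by simp; ring
  rw [this]
  ring

/-- The n-th coefficient of v ↦ f(v + Za) is computed twice: by translation, and by
quasi-periodicity, whose factor exp(−2πik a·v) shifts the index by ka. -/
theorem fourierCoeff_add_smul (n a : Fin 3 → ℤ) :
    fourierCoeff (fun v => f (ω₂ *ᵥ v)) (n + (k : ℤ) • a) =
      exp (Real.pi * I * k * (intVec a ⬝ᵥ (Z *ᵥ intVec a))) * expDot n (Z *ᵥ intVec a) *
        fourierCoeff (fun v => f (ω₂ *ᵥ v)) n := by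
  have h1 := fourierCoeff_comp_add (differentiable_of_mem_H0 hf) (isPeriodic_of_mem_H0 hf)
    (Z *ᵥ intVec a) n
  simp only [quasiPeriodic_of_mem_H0 hf] at h1
  have h2 := fourierCoeff_smul (exp (-(Real.pi * I * k * (intVec a ⬝ᵥ (Z *ᵥ intVec a)))))
    (fun v => expDot (-(k : ℤ) • a) v * f (ω₂ *ᵥ v)) n
  rw [fourierCoeff_expDot_mul (isPeriodic_of_mem_H0 hf), neg_smul, sub_neg_eq_add] at h2
  have h3 := h2.symm.trans ((congrArg (fun x => fourierCoeff
    (exp (-(Real.pi * I * k * (intVec a ⬝ᵥ (Z *ᵥ intVec a)))) •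
      fun v => expDot x v * f (ω₂ *ᵥ v)) n) (neg_smul (k : ℤ) a).symm).trans h1)
  rw [mul_assoc, ← h3, ← mul_assoc, ← Complex.exp_add, add_neg_cancel, Complex.exp_zero, one_mul]

end H0

theorem intVec_add (a b : Fin 3 → ℤ) : intVec (a + b) = intVec a + intVec b := by
  funext i; simp [intVec]

theorem intVec_smul (m : ℤ) (a : Fin 3 → ℤ) : intVec (m • a) = (m : ℂ) • intVec a := by
  funext i; simp [intVec]

theorem dot_Z_comm (x y : V) : x ⬝ᵥ (Z *ᵥ y) = y ⬝ᵥ (Z *ᵥ x) := by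
  rw [Matrix.dotProduct_mulVec, ← Matrix.mulVec_transpose, Z_transpose, dotProduct_comm]

/-- The Fourier coefficients of a theta function, normalized so as to be `k`-periodic. -/
def thetaCoeff (k : ℕ) (F : V → ℂ) (n : Fin 3 → ℤ) : ℂ :=
  exp (-(Real.pi * I / k * (intVec n ⬝ᵥ (Z *ᵥ intVec n)))) * fourierCoeff (pullback k F) n

section NT

variable {k : ℕ} (hk : Even k)
include hk

theorem symm_mem_H0 {F : V → ℂ} (hF : F ∈ NT k) : (gaussMul k).symm F ∈ H0 k :=
  (gaussMul_mem_NT hk _).1 (by simpa using hF)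

/-- Completing the square: the factor in `fourierCoeff_add_smul` is the quotient of exp(πi/k ᵗnZn)
at n + ka and at n. -/
theorem thetaCoeff_add_smul (hk0 : k ≠ 0) {F : V → ℂ} (hF : F ∈ NT k) (n a : Fin 3 → ℤ) :
    thetaCoeff k F (n + (k : ℤ) • a) = thetaCoeff k F n := by
  have hk0' : (k : ℂ) ≠ 0 := Nat.cast_ne_zero.2 hk0
  have h := fourierCoeff_add_smul (symm_mem_H0 hk hF) n a
  unfold thetaCoeff
  rw [show fourierCoeff (pullback k F) (n + (k : ℤ) • a) = _ from h, ← mul_assoc, ← mul_assoc,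
    expDot, ← Complex.exp_add, ← Complex.exp_add]
  congr 2
  rw [show (fun i => ((n i : ℤ) : ℂ)) = intVec n from rfl, intVec_add, intVec_smul]
  simp only [Matrix.mulVec_add, add_dotProduct, dotProduct_add, Matrix.mulVec_smul,
    smul_dotProduct, dotProduct_smul, smul_eq_mul]
  rw [dot_Z_comm (intVec a) (intVec n)]
  push_cast
  field_simp
  ring

theorem thetaCoeff_congr (hk0 : k ≠ 0) {F : V → ℂ} (hF : F ∈ NT k) {n m : Fin 3 → ℤ}
    (h : (fun i => (n i : ZMod k)) = fun i => (m i : ZMod k)) :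
    thetaCoeff k F n = thetaCoeff k F m := by
  have h1 : ∀ i, ∃ a : ℤ, n i = m i + k * a := fun i => by
    have := (ZMod.intCast_eq_intCast_iff_dvd_sub _ _ _).1 (congrFun h i).symm
    obtain ⟨a, ha⟩ := this
    exact ⟨a, by linarith⟩
  choose a ha using h1
  have : n = m + (k : ℤ) • a := by
    funext i; simp [ha]
  rw [this, thetaCoeff_add_smul hk hk0 hF]

theorem eq_zero_of_thetaCoeff {F : V → ℂ} (hF : F ∈ NT k) (h : ∀ n, thetaCoeff k F n = 0) :
    F = 0 := by
  have hf := symm_mem_H0 hk hF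
  have h1 := eq_zero_of_fourierCoeff_eq_zero (differentiable_of_mem_H0 hf)
    (isPeriodic_of_mem_H0 hf) fun n => (mul_eq_zero.1 (h n)).resolve_left (Complex.exp_ne_zero _)
  have h2 : (gaussMul k).symm F = 0 := by
    funext z
    rw [← ω₂_normCoord z]
    exact congrFun h1 (normCoord z)
  simpa using h2

theorem thetaCoeff_add {F H : V → ℂ} (hF : F ∈ NT k) (hH : H ∈ NT k) (n : Fin 3 → ℤ) :
    thetaCoeff k (F + H) n = thetaCoeff k F n + thetaCoeff k H n := by
  have hf := symm_mem_H0 hk hF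
  have hh := symm_mem_H0 hk hH
  have : pullback k (F + H) = pullback k F + pullback k H := by
    funext v; simp [pullback]
  have h1 : fourierCoeff (pullback k F + pullback k H) n = _ :=
    fourierCoeff_add (isPeriodic_of_mem_H0 hf) (isPeriodic_of_mem_H0 hh)
      (differentiable_of_mem_H0 hf).continuous (differentiable_of_mem_H0 hh).continuous n
  rw [thetaCoeff, this, h1, mul_add]
  rfl

end NT

theorem thetaCoeff_smul (k : ℕ) (c : ℂ) (F : V → ℂ) (n : Fin 3 → ℤ) :
    thetaCoeff k (c • F) n = c * thetaCoeff k F n := by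
  have : pullback k (c • F) = c • pullback k F := by
    funext v; simp [pullback]
  rw [thetaCoeff, this, fourierCoeff_smul, mul_left_comm]
  rfl

/-- Theta functions of degree `k` as functions on `(ℤ/k)³`. -/
def coeffMap {k : ℕ} (hk : Even k) : NT k →ₗ[ℂ] ((Fin 3 → ZMod k) → ℂ) where
  toFun F := fun x => thetaCoeff k F.1 fun i => ((x i).cast : ℤ)
  map_add' F H := by funext x; exact thetaCoeff_add hk F.2 H.2 _
  map_smul' c F := by funext x; exact thetaCoeff_smul k c F.1 _

theorem coeffMap_intCast {k : ℕ} (hk : Even k) (hk0 : k ≠ 0) (F : NT k) (n : Fin 3 → ℤ) :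
    coeffMap hk F (fun i => (n i : ZMod k)) = thetaCoeff k F.1 n :=
  thetaCoeff_congr hk hk0 F.2 (by funext i; simp)

theorem exists_intCast {k : ℕ} (x : Fin 3 → ZMod k) : ∃ n : Fin 3 → ℤ, (fun i => (n i : ZMod k)) = x :=
  ⟨fun i => ((x i).cast : ℤ), by funext i; simp⟩

theorem coeffMap_injective {k : ℕ} (hk : Even k) (hk0 : k ≠ 0) :
    Function.Injective (coeffMap hk) := by
  rw [← LinearMap.ker_eq_bot, LinearMap.ker_eq_bot']
  intro F hF
  refine Subtype.ext (eq_zero_of_thetaCoeff hk F.2 fun n => ?_)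
  rw [← coeffMap_intCast hk hk0, hF]
  rfl

/-- The torsion point `(ω₁ a + ω₂ b)/k`. -/
def torsion (k : ℕ) (a b : Fin 3 → ℤ) : V := (((k : ℝ)⁻¹ : ℝ) : ℂ) • period a b

/-- The commutator of translations by λ/k and by λ' is exp(2πi m) with m the integral symplectic
pairing, so the two commute. -/
theorem heis_torsion_mem {k : ℕ} (a b : Fin 3 → ℤ) {F : V → ℂ} (hF : F ∈ NT k) :
    heis k (torsion k a b) F ∈ NT k := by
  refine ⟨heis_differentiable k _ hF.1, fun a' b' => ?_⟩
  -- For k = 0 the convention 0⁻¹ = 0 makes the torsion point zero.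
  rcases Nat.eq_zero_or_pos k with rfl | hk
  · simp only [torsion, Nat.cast_zero, inv_zero, ofReal_zero, zero_smul, heis_zero]
    exact hF.2 a' b'
  have hk0 : (k : ℂ) ≠ 0 := Nat.cast_ne_zero.2 hk.ne'
  have h1 := heis_period_heis_period k 1 (k : ℝ)⁻¹ a' b' a b F
  have h2 := heis_period_heis_period k (k : ℝ)⁻¹ 1 a b a' b' F
  simp only [ofReal_one, one_smul, hF.2] at h1 h2
  rw [torsion, h1, h2, add_comm]
  congr 1
  rw [Complex.exp_eq_exp_iff_exists_int]
  refine ⟨-(a' ⬝ᵥ b - b' ⬝ᵥ a), ?_⟩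
  rw [dotProduct_comm a b', dotProduct_comm b a']
  push_cast
  field_simp
  ring

/-- The Heisenberg operators on theta functions. -/
def heisEnd (k : ℕ) (a b : Fin 3 → ℤ) : Module.End ℂ (NT k) :=
  (heis k (torsion k a b)).restrict fun _ hF => heis_torsion_mem a b hF

theorem pullback_eq (k : ℕ) (f : V → ℂ) (v : V) : pullback k (gaussMul k f) v = f (ω₂ *ᵥ v) := by
  rw [pullback, LinearEquiv.symm_apply_apply]

theorem thetaCoeff_heis_ω₂ {k : ℕ} (hk : Even k) {F : V → ℂ} (hF : F ∈ NT k)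
    (b n : Fin 3 → ℤ) :
    thetaCoeff k (heis k (torsion k 0 b) F) n =
      exp (2 * Real.pi * I * ((n ⬝ᵥ b : ℤ) : ℂ) / k) * thetaCoeff k F n := by
  obtain ⟨f, rfl⟩ := (gaussMul k).surjective F
  have hf := (gaussMul_mem_NT hk f).1 hF
  have h : pullback k (heis k (torsion k 0 b) (gaussMul k f)) =
      fun v => (fun u => f (ω₂ *ᵥ u)) (v + (((k : ℝ)⁻¹ : ℝ) : ℂ) • intVec b) := by
    funext v
    rw [torsion, period_zero_left, heis_ω₂_gaussMul, pullback_eq]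
    simp only [Matrix.mulVec_add, Matrix.mulVec_smul]
  have h2 : pullback k (gaussMul k f) = fun u => f (ω₂ *ᵥ u) := funext (pullback_eq k f)
  rw [thetaCoeff, thetaCoeff, h, h2, fourierCoeff_comp_add (differentiable_of_mem_H0 hf)
    (isPeriodic_of_mem_H0 hf), mul_left_comm]
  congr 1
  rw [expDot, dotProduct_smul]
  congr 1
  have : (fun i => ((n i : ℤ) : ℂ)) ⬝ᵥ intVec b = ((n ⬝ᵥ b : ℤ) : ℂ) := by
    simp [dotProduct, intVec]
  rw [this, smul_eq_mul]
  push_cast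
  ring

/-- The translation by ω₁a/k introduces the exponential `expDot a`, which shifts the index; the
remaining factors are absorbed by the normalization of the coefficients. -/
theorem thetaCoeff_heis_ω₁ {k : ℕ} (hk : Even k) (hk0 : k ≠ 0) {F : V → ℂ} (hF : F ∈ NT k)
    (a n : Fin 3 → ℤ) :
    thetaCoeff k (heis k (torsion k a 0) F) n = thetaCoeff k F (n - a) := by
  have hk0' : (k : ℂ) ≠ 0 := Nat.cast_ne_zero.2 hk0
  obtain ⟨f, rfl⟩ := (gaussMul k).surjective F
  have hf := (gaussMul_mem_NT hk f).1 hF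
  set c : ℂ := (((k : ℝ)⁻¹ : ℝ) : ℂ) with hc
  have hck : c = (k : ℂ)⁻¹ := by rw [hc]; push_cast; rfl
  set g : V → ℂ := fun u => f (ω₂ *ᵥ u) with hg
  have h : pullback k (heis k (torsion k a 0) (gaussMul k f)) =
      exp (Real.pi * I / k * (intVec a ⬝ᵥ (Z *ᵥ intVec a))) • fun v => expDot a v *
        (fun v => g (v + c • (Z *ᵥ intVec a))) v := by
    funext v
    rw [torsion, period_zero_right, heis_ω₁_gaussMul, pullback_eq, Pi.smul_apply, smul_eq_mul,
      ← mul_assoc, expDot, ← Complex.exp_add, normCoord_ω₂]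
    simp only [hg]
    rw [Matrix.mulVec_add, Matrix.mulVec_smul, ω₂_mulVec_Z]
    congr 2
    rw [← hc, hck, show (fun i => ((a i : ℤ) : ℂ)) = intVec a from rfl, dotProduct_comm v]
    field_simp
    ring
  have h2 : pullback k (gaussMul k f) = g := funext (pullback_eq k f)
  have hgd : Differentiable ℂ g := differentiable_of_mem_H0 hf
  have hgp : IsPeriodic g := isPeriodic_of_mem_H0 hf
  rw [thetaCoeff, thetaCoeff, h, h2, fourierCoeff_smul, fourierCoeff_expDot_mul (hgp.comp_add _),
    fourierCoeff_comp_add hgd hgp, ← mul_assoc, ← mul_assoc, expDot, ← Complex.exp_add,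
    ← Complex.exp_add]
  congr 2
  have h3 : intVec (n - a) = intVec n - intVec a := by funext i; simp [intVec]
  rw [show (fun i => (((n - a) i : ℤ) : ℂ)) = intVec (n - a) from rfl, h3, hck]
  simp only [Matrix.mulVec_sub, sub_dotProduct, dotProduct_sub, dotProduct_smul, smul_eq_mul]
  rw [dot_Z_comm (intVec a) (intVec n)]
  field_simp
  ring

/-- Splitting the translation by (ω₁a + ω₂b)/k into its two directions costs a root of unity, by the
composition law. Only its modulus matters later. -/
theorem coeffMap_heisEnd {k : ℕ} [NeZero k] (hk : Even k) (a b : Fin 3 → ℤ) :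
    ∃ c : ℂ, ‖c‖ = 1 ∧ ∀ F, coeffMap hk (heisEnd k a b F) =
      c • op (fun i => (a i : ZMod k)) (fun i => (b i : ZMod k)) (coeffMap hk F) := by
  have hk0 : k ≠ 0 := NeZero.ne k
  refine ⟨exp ((Real.pi / k * ((a ⬝ᵥ b : ℤ) : ℝ) : ℝ) * I), norm_exp_ofReal_mul_I _, fun F => ?_⟩
  have h1 : (heisEnd k a b F).1 = exp ((Real.pi / k * ((a ⬝ᵥ b : ℤ) : ℝ) : ℝ) * I) •
      heis k (torsion k a 0) (heis k (torsion k 0 b) F.1) := by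
    have := heis_period_heis_period k (k : ℝ)⁻¹ (k : ℝ)⁻¹ a 0 0 b F.1
    rw [torsion, torsion, this, smul_smul, ← Complex.exp_add, ← smul_add, period_add, add_zero,
      zero_add]
    change heis k (torsion k a b) F.1 = _
    rw [torsion]
    have hk0' : (k : ℂ) ≠ 0 := Nat.cast_ne_zero.2 hk0
    rw [show ((Real.pi / k * ((a ⬝ᵥ b : ℤ) : ℝ) : ℝ) : ℂ) * I +
      -(Real.pi * I * k * ((k : ℝ)⁻¹ : ℝ) * ((k : ℝ)⁻¹ : ℝ) * ((a ⬝ᵥ b - 0 ⬝ᵥ 0 : ℤ) : ℂ)) = 0 by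
        rw [zero_dotProduct, sub_zero]
        push_cast
        field_simp
        ring, Complex.exp_zero, one_smul]
  funext x
  obtain ⟨n, rfl⟩ := exists_intCast x
  have h2 : (fun i => (n i : ZMod k)) - (fun i => (a i : ZMod k)) =
      fun i => (((n - a) i : ℤ) : ZMod k) := by funext i; simp
  rw [coeffMap_intCast hk hk0, h1, thetaCoeff_smul,
    thetaCoeff_heis_ω₁ hk hk0 (heis_torsion_mem 0 b F.2), thetaCoeff_heis_ω₂ hk F.2,
    Pi.smul_apply, op_apply, h2, coeffMap_intCast hk hk0, smul_eq_mul]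
  congr 2
  have h3 : (fun i => (((n - a) i : ℤ) : ZMod k)) ⬝ᵥ (fun i => (b i : ZMod k)) =
      (((n - a) ⬝ᵥ b : ℤ) : ZMod k) := by simp [dotProduct]
  rw [h3, ZMod.stdAddChar_coe]

end KleinTheta

namespace KleinTheta

open Complex TorusFourier FiniteHeisenberg

/-! ### A nonzero theta function -/

theorem jacobiTheta₂_add_int_mul (z τ : ℂ) (n : ℤ) :
    jacobiTheta₂ (z + n * τ) τ =
      exp (-(Real.pi * I * (n ^ 2 * τ + 2 * n * z))) * jacobiTheta₂ z τ := by
  induction n using Int.induction_on with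
  | zero => simp
  | succ n ih =>
    have h := jacobiTheta₂_add_left' (z + n * τ) τ
    push_cast at ih ⊢
    rw [show z + ((n : ℂ) + 1) * τ = z + n * τ + τ by ring, h, ih, ← mul_assoc, ← Complex.exp_add]
    congr 2
    ring
  | pred n ih =>
    have h := jacobiTheta₂_add_left' (z + ((-n - 1 : ℤ) : ℂ) * τ) τ
    rw [show z + ((-n - 1 : ℤ) : ℂ) * τ + τ = z + ((-n : ℤ) : ℂ) * τ by push_cast; ring, ih] at h
    rw [← mul_right_inj' (Complex.exp_ne_zero _), ← h, ← mul_assoc, ← Complex.exp_add]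
    congr 2
    push_cast
    ring

theorem jacobiTheta₂_add_int (z τ : ℂ) (n : ℤ) : jacobiTheta₂ (z + n) τ = jacobiTheta₂ z τ := by
  have h : Function.Periodic (fun z => jacobiTheta₂ z τ) 1 := fun z => jacobiTheta₂_add_left z τ
  simpa using h.int_mul n z

theorem exists_intCast_latVec (b : Fin 3 → ℤ) (j : Fin 3) : ∃ m : ℤ, latVec b j = m := by
  rw [latVec, C]
  fin_cases j
  · exact ⟨b 0, by simp [Matrix.mulVec, dotProduct, Fin.sum_univ_three, intVec]⟩
  · exact ⟨-b 0 + b 1, by simp [Matrix.mulVec, dotProduct, Fin.sum_univ_three, intVec]⟩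
  · exact ⟨-b 1 + 2 * b 2, by simp [Matrix.mulVec, dotProduct, Fin.sum_univ_three, intVec]⟩

theorem dualVec_eq (a : Fin 3 → ℤ) :
    dualVec a = ![(a 0 + a 1 + a 2 / 2 : ℂ), (a 1 + a 2 / 2 : ℂ), (a 2 / 2 : ℂ)] := by
  rw [dualVec, C_transpose_inv]
  funext j
  fin_cases j <;> simp [Matrix.mulVec, dotProduct, Fin.sum_univ_three, intVec] <;> ring

theorem exists_intCast_two_mul_dualVec (a : Fin 3 → ℤ) (j : Fin 3) :
    ∃ m : ℤ, 2 * dualVec a j = m := by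
  rw [dualVec_eq]
  fin_cases j
  · exact ⟨2 * a 0 + 2 * a 1 + a 2, by simp; ring⟩
  · exact ⟨2 * a 1 + a 2, by simp; ring⟩
  · exact ⟨a 2, by simp; ring⟩

/-- The product of Jacobi theta functions, a theta function of degree two. -/
def thetaProd (z : V) : ℂ := ∏ j, jacobiTheta₂ ((1 - α) / 2 * z j) (-(1 - α) ^ 2 / 2)

theorem im_modulus : (-(1 - α) ^ 2 / 2).im = Real.sqrt 7 / 4 := by
  have h : -(1 - α) ^ 2 / 2 = (1 + α) / 2 := by linear_combination (-1 / 2) * α_sq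
  rw [h, α]
  simp
  ring

theorem im_modulus_pos : 0 < (-(1 - α) ^ 2 / 2).im := by
  rw [im_modulus]; positivity

/-- The imaginary part of Z is diagonalized by ᵗC⁻¹: ᵗaZa is a multiple of the sum of squares of the
entries of `dualVec a`. As 2ᵗC⁻¹a and Cb are integral, every period moves the coordinate (1 − α)zⱼ/2
by an element of ℤτ + ℤ with τ = −(1 − α)²/2, so one-variable theta functions multiply to one on ℂ³.
-/
theorem thetaProd_mem : thetaProd ∈ H0 2 := by
  refine ⟨?_, fun z a b => ?_⟩
  · have h : Differentiable ℂ fun y => jacobiTheta₂ y (-(1 - α) ^ 2 / 2) := fun y =>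
      differentiableAt_jacobiTheta₂_fst y im_modulus_pos
    have h1 : ∀ j : Fin 3, Differentiable ℂ fun z : V =>
        jacobiTheta₂ ((1 - α) / 2 * z j) (-(1 - α) ^ 2 / 2) := fun j => h.comp (by fun_prop)
    have h2 : thetaProd = fun z => _ := funext fun z => Fin.prod_univ_three _
    rw [h2]
    exact ((h1 0).mul (h1 1)).mul (h1 2)
  · choose m hm using exists_intCast_latVec b
    choose n hn using exists_intCast_two_mul_dualVec a
    have h1 : ∀ j, (1 - α) / 2 * (z + ω₁ *ᵥ intVec a + ω₂ *ᵥ intVec b) j =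
        (1 - α) / 2 * z j + n j * (-(1 - α) ^ 2 / 2) + m j := fun j => by
      rw [ω₁_mulVec, ω₂_mulVec, ← hm, ← hn]
      simp only [Pi.add_apply, Pi.smul_apply, smul_eq_mul]
      linear_combination (-1 / 2 * latVec b j) * α_sq
    simp only [thetaProd, h1, jacobiTheta₂_add_int, jacobiTheta₂_add_int_mul,
      Finset.prod_mul_distrib, ← Complex.exp_sum]
    congr 2
    rw [normCoord_dot, intVec_Z]
    simp only [← hn, dotProduct, Fin.sum_univ_three]
    push_cast
    ring

/-- The value is θ(τ)³, and |θ(τ) − 1| ≤ 2x/(1 − x) with x = exp(−π Im τ) = exp(−π√7/4). This is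
less than 1 because x < 1/3. -/
theorem thetaProd_zero_ne : thetaProd 0 ≠ 0 := by
  have h1 : thetaProd 0 = jacobiTheta (-(1 - α) ^ 2 / 2) ^ 3 := by
    simp [thetaProd, jacobiTheta_eq_jacobiTheta₂]
  rw [h1]
  refine pow_ne_zero _ fun h0 => ?_
  have h := norm_jacobiTheta_sub_one_le im_modulus_pos
  rw [h0, zero_sub, norm_neg, norm_one, im_modulus] at h
  set x := Real.exp (-Real.pi * (Real.sqrt 7 / 4)) with hx
  have h7 : (2.6 : ℝ) ≤ Real.sqrt 7 := Real.le_sqrt_of_sq_le (by norm_num)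
  have hy : (1.9 : ℝ) ≤ Real.pi * (Real.sqrt 7 / 4) := by
    nlinarith [Real.pi_gt_three]
  have h3 : (3 : ℝ) < Real.exp (Real.pi * (Real.sqrt 7 / 4)) := by
    have := Real.quadratic_le_exp_of_nonneg (by linarith : 0 ≤ Real.pi * (Real.sqrt 7 / 4))
    nlinarith
  have hx3 : x < 1 / 3 := by
    rw [hx, neg_mul, Real.exp_neg, inv_lt_comm₀ (Real.exp_pos _) (by norm_num)]
    norm_num
    exact h3
  have h4 : 0 < 1 - x := by linarith
  rw [div_mul_eq_mul_div, le_div_iff₀ h4] at h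
  linarith

theorem pow_mem_H0 {f : V → ℂ} {k : ℕ} (hf : f ∈ H0 k) (m : ℕ) : f ^ m ∈ H0 (k * m) := by
  refine ⟨hf.1.pow m, fun z a b => ?_⟩
  rw [Pi.pow_apply, Pi.pow_apply, hf.2, mul_pow, ← Complex.exp_nat_mul]
  congr 2
  push_cast
  ring

theorem NT_ne_bot {k : ℕ} (hk : Even k) : ∃ F : NT k, F ≠ 0 := by
  obtain ⟨m, rfl⟩ := hk.two_dvd
  refine ⟨⟨gaussMul (2 * m) (thetaProd ^ m), (gaussMul_mem_NT hk _).2 (pow_mem_H0 thetaProd_mem m)⟩,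
    fun h => ?_⟩
  have h1 := congrArg Subtype.val h
  rw [ZeroMemClass.coe_zero, LinearEquiv.map_eq_zero_iff] at h1
  exact pow_ne_zero m thetaProd_zero_ne (congrFun h1 0)

/-- The image is stable under the finite Heisenberg operators and contains the image of a power of
`thetaProd`, hence it is everything by irreducibility. -/
theorem coeffMap_surjective {k : ℕ} [NeZero k] (hk : Even k) :
    Function.Surjective (coeffMap hk) := by
  rw [← LinearMap.range_eq_top]
  refine eq_top_of_op_mem _ ?_ ?_
  · rintro a b _ ⟨F, rfl⟩
    obtain ⟨a, rfl⟩ := exists_intCast a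
    obtain ⟨b, rfl⟩ := exists_intCast b
    obtain ⟨c, hc, h⟩ := coeffMap_heisEnd hk a b
    have hc0 : c ≠ 0 := fun h0 => by simp [h0] at hc
    refine ⟨c⁻¹ • heisEnd k a b F, ?_⟩
    rw [map_smul, h, smul_smul, inv_mul_cancel₀ hc0, one_smul]
  · obtain ⟨F, hF⟩ := NT_ne_bot hk
    intro h
    rw [LinearMap.range_eq_bot] at h
    exact hF (coeffMap_injective hk (NeZero.ne k) (by rw [h]; rfl))

/-- Theta functions of even degree `k` are the functions on `(ℤ/k)³`. -/
def coeffEquiv {k : ℕ} [NeZero k] (hk : Even k) : NT k ≃ₗ[ℂ] ((Fin 3 → ZMod k) → ℂ) :=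
  LinearEquiv.ofBijective (coeffMap hk)
    ⟨coeffMap_injective hk (NeZero.ne k), coeffMap_surjective hk⟩

/-! ### Block diagonal elements act by permutations -/

theorem mulVec_intVec (B : Matrix (Fin 3) (Fin 3) ℤ) (n : Fin 3 → ℤ) :
    intMat B *ᵥ intVec n = intVec (B *ᵥ n) := intMat_mulVec B n

theorem IsPeriodMatrix.mul_ω₁ {g : G} {A B : Matrix (Fin 3) (Fin 3) ℤ}
    (h : IsPeriodMatrix g (Matrix.fromBlocks A 0 0 B)) : g.1.val * ω₁ = ω₁ * intMat A := by
  have h0 : intMat (0 : Matrix (Fin 3) (Fin 3) ℤ) = 0 := by ext; simp [intMat]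
  have h1 : intMat (Matrix.fromBlocks A 0 0 B) = Matrix.fromBlocks (intMat A) 0 0 (intMat B) := by
    rw [intMat, Matrix.fromBlocks_map]
    simp [intMat]
  unfold IsPeriodMatrix at h
  rw [h1, Ω, Matrix.mul_fromCols, Matrix.fromCols_mul_fromBlocks] at h
  simpa using congrArg Matrix.toCols₁ h

theorem IsPeriodMatrix.mul_ω₂ {g : G} {A B : Matrix (Fin 3) (Fin 3) ℤ}
    (h : IsPeriodMatrix g (Matrix.fromBlocks A 0 0 B)) : g.1.val * ω₂ = ω₂ * intMat B := by
  have h1 : intMat (Matrix.fromBlocks A 0 0 B) = Matrix.fromBlocks (intMat A) 0 0 (intMat B) := by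
    rw [intMat, Matrix.fromBlocks_map]
    simp [intMat]
  unfold IsPeriodMatrix at h
  rw [h1, Ω, Matrix.mul_fromCols, Matrix.fromCols_mul_fromBlocks] at h
  simpa using congrArg Matrix.toCols₂ h

/-- From gC = CB with C and B real, g is real; being unitary, it is orthogonal and leaves the
Gaussian factor unchanged. -/
theorem IsPeriodMatrix.dotProduct_mulVec {g : G} {A B : Matrix (Fin 3) (Fin 3) ℤ}
    (h : IsPeriodMatrix g (Matrix.fromBlocks A 0 0 B)) (z : V) :
    (g.1.val *ᵥ z) ⬝ᵥ (g.1.val *ᵥ z) = z ⬝ᵥ z := by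
  have h2 := h.mul_ω₂
  rw [ω₂, Matrix.mul_smul, Matrix.smul_mul] at h2
  have h3 : g.1.val * C = C * intMat B := smul_right_injective _ α_ne_zero h2
  have h4 := congrArg (fun M => M.map star) h3
  simp only [map_star_mul, C_map_star, intMat_map_star] at h4
  have h5 : (g.1.val).map star = g.1.val := by
    rw [← Matrix.mul_one ((g.1.val).map star), ← C_mul_inv, ← Matrix.mul_assoc, h4, ← h3,
      Matrix.mul_assoc, C_mul_inv, Matrix.mul_one]
  have h6 : (g.1.val)ᵀ * g.1.val = 1 := by
    rw [← G_unitary g, Matrix.conjTranspose, Matrix.transpose_map, h5]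
  rw [Matrix.dotProduct_mulVec, ← Matrix.mulVec_transpose, Matrix.mulVec_mulVec, h6,
    Matrix.one_mulVec]

/-- In the coordinate v, g is the unimodular substitution B, which permutes Fourier coefficients
through ᵗB. -/
theorem thetaCoeff_act {k : ℕ} (hk : Even k) {g : G} {A B : Matrix (Fin 3) (Fin 3) ℤ}
    (h : IsPeriodMatrix g (Matrix.fromBlocks A 0 0 B)) (hAB : A * Bᵀ = 1)
    {F : V → ℂ} (hF : F ∈ NT k) (n : Fin 3 → ℤ) :
    thetaCoeff k (act g F) n = thetaCoeff k F (Bᵀ *ᵥ n) := by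
  have hF' := act_mem_NT g hF
  have hf := symm_mem_H0 hk hF'
  have h1 : pullback k F = fun v => pullback k (act g F) (B.map (fun x => (x : ℂ)) *ᵥ v) := by
    funext v
    have h2 : ω₂ *ᵥ (intMat B *ᵥ v) = g.1.val *ᵥ (ω₂ *ᵥ v) := by
      rw [Matrix.mulVec_mulVec, Matrix.mulVec_mulVec, h.mul_ω₂]
    change _ = pullback k (act g F) (intMat B *ᵥ v)
    rw [pullback, pullback, h2, gaussMul_symm_apply, gaussMul_symm_apply, h.dotProduct_mulVec,
      act_apply, inv_mulVec_mulVec]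
  have hBA : Bᵀ * A = 1 := mul_eq_one_comm.1 hAB
  have hB : B * Aᵀ = 1 := by
    have := congrArg Matrix.transpose hAB
    rwa [Matrix.transpose_mul, Matrix.transpose_transpose, Matrix.transpose_one] at this
  have h3 : fourierCoeff (pullback k F) (Bᵀ *ᵥ n) = fourierCoeff (pullback k (act g F)) n := by
    rw [h1]
    exact fourierCoeff_comp_mulVec (isPeriodic_of_mem_H0 hf)
      (differentiable_of_mem_H0 hf).continuous B Aᵀ hB n
  -- This invariance makes the normalizing factors of the coefficients at n and at ᵗBn agree.
  have h4 : intMat B * Z * (intMat B)ᵀ = Z := by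
    have h5 : intMat B * Z = Z * intMat A := by
      have h6 : ω₂ * (intMat B * Z) = ω₂ * (Z * intMat A) := by
        have h7 : ω₂ * Z = ω₁ := by
          rw [Z, ← Matrix.mul_assoc, ω₂_inv, ω₂, Matrix.smul_mul, Matrix.mul_smul, C_mul_inv,
            smul_smul, ← α_inv, mul_inv_cancel₀ α_ne_zero, one_smul, Matrix.one_mul]
        rw [← Matrix.mul_assoc, ← h.mul_ω₂, Matrix.mul_assoc, h7, h.mul_ω₁, ← Matrix.mul_assoc, h7]
      have h8 : ω₂⁻¹ * ω₂ = 1 := by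
        rw [ω₂_inv, ω₂, Matrix.smul_mul, Matrix.mul_smul, inv_mul_C, smul_smul, ← α_inv,
          inv_mul_cancel₀ α_ne_zero, one_smul]
      have h9 := congrArg (fun M => ω₂⁻¹ * M) h6
      simpa only [← Matrix.mul_assoc, h8, Matrix.one_mul] using h9
    have h10 : intMat A * (intMat B)ᵀ = 1 := by
      rw [← intMat_one, ← hAB, intMat_mul]; rfl
    rw [h5, Matrix.mul_assoc, h10, Matrix.mul_one]
  rw [thetaCoeff, thetaCoeff, h3, ← mulVec_intVec, show intMat Bᵀ = (intMat B)ᵀ from rfl,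
    Matrix.mulVec_mulVec, Matrix.mulVec_transpose, ← Matrix.dotProduct_mulVec, Matrix.mulVec_mulVec,
    ← Matrix.mul_assoc, h4]

/-- The character of the representation on theta functions of degree `k`. -/
def chi (k : ℕ) (g : G) : ℂ := LinearMap.trace ℂ (NT k) (rep k g)

theorem chi_eq_trace_conj {k : ℕ} [NeZero k] (hk : Even k) (g : G) :
    chi k g = LinearMap.trace ℂ _ ((coeffEquiv hk).conj (rep k g)) :=
  (LinearMap.trace_conj' _ _).symm

theorem chi_eq_card {k : ℕ} [NeZero k] (hk : Even k) {g : G} {A B : Matrix (Fin 3) (Fin 3) ℤ}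
    (h : IsPeriodMatrix g (Matrix.fromBlocks A 0 0 B)) (hAB : A * Bᵀ = 1) :
    chi k g = (Finset.univ.filter fun x : Fin 3 → ZMod k =>
      (Bᵀ.map (fun m => (m : ZMod k))) *ᵥ x = x).card := by
  rw [chi_eq_trace_conj hk, trace_eq_sum]
  have h1 : ∀ x y : Fin 3 → ZMod k, (coeffEquiv hk).conj (rep k g) (Pi.single x 1) y =
      (Pi.single x 1 : (Fin 3 → ZMod k) → ℂ) ((Bᵀ.map (fun m => (m : ZMod k))) *ᵥ y) := by
    intro x y
    rw [LinearEquiv.conj_apply_apply]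
    obtain ⟨F, hF⟩ := (coeffEquiv hk).surjective (Pi.single x 1)
    rw [← hF, LinearEquiv.symm_apply_apply]
    obtain ⟨n, rfl⟩ := exists_intCast y
    change coeffMap hk (rep k g F) _ = coeffMap hk F _
    have h2 : (Bᵀ.map (fun m => (m : ZMod k))) *ᵥ (fun i => (n i : ZMod k)) =
        fun i => (((Bᵀ *ᵥ n) i : ℤ) : ZMod k) := by
      funext i
      simp [Matrix.mulVec, dotProduct]
    rw [h2, coeffMap_intCast hk (NeZero.ne k), coeffMap_intCast hk (NeZero.ne k), rep_coe,
      thetaCoeff_act hk h hAB F.2]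
  simp only [h1, Pi.single_apply]
  rw [Finset.card_filter]
  push_cast
  rfl

/-- By `act_heis`, conjugation by g carries the translation by a torsion point to that by its image,
so it permutes the Heisenberg operators, up to scalars of modulus one, as M permutes (ℤ/k)⁶. -/
theorem norm_chi_mul_chi_inv_le {k : ℕ} [NeZero k] (hk : Even k) {g : G}
    {M : Matrix (Fin 3 ⊕ Fin 3) (Fin 3 ⊕ Fin 3) ℤ} (h : IsPeriodMatrix g M) :
    ‖chi k g * chi k g⁻¹‖ ≤ (Finset.univ.filter fun x : Fin 3 ⊕ Fin 3 → ZMod k =>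
      (M.map (fun m => (m : ZMod k))) *ᵥ x = x).card := by
  set σ : (Fin 3 → ZMod k) × (Fin 3 → ZMod k) → (Fin 3 → ZMod k) × (Fin 3 → ZMod k) := fun p =>
    ((M.map (fun m => (m : ZMod k)) *ᵥ Sum.elim p.1 p.2) ∘ Sum.inl,
      (M.map (fun m => (m : ZMod k)) *ᵥ Sum.elim p.1 p.2) ∘ Sum.inr) with hσ
  have h1 : (coeffEquiv hk).conj (rep k g) * (coeffEquiv hk).conj (rep k g⁻¹) = 1 := by
    rw [Module.End.mul_eq_comp, ← LinearEquiv.conj_comp, ← Module.End.mul_eq_comp, ← map_mul,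
      mul_inv_cancel, map_one]
    exact LinearEquiv.conj_id _
  have key : ∀ p, ∃ c : ℂ, ‖c‖ = 1 ∧ (coeffEquiv hk).conj (rep k g) * op p.1 p.2 =
      c • (op (σ p).1 (σ p).2 * (coeffEquiv hk).conj (rep k g)) := by
    rintro ⟨a, b⟩
    obtain ⟨a, rfl⟩ := exists_intCast a
    obtain ⟨b, rfl⟩ := exists_intCast b
    obtain ⟨c, hc, hop⟩ := coeffMap_heisEnd hk a b
    obtain ⟨c', hc', hop'⟩ := coeffMap_heisEnd hk ((M *ᵥ Sum.elim a b) ∘ Sum.inl)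
      ((M *ᵥ Sum.elim a b) ∘ Sum.inr)
    have hc0 : c ≠ 0 := fun h0 => by simp [h0] at hc
    have hcast : M.map (fun m => (m : ZMod k)) *ᵥ
        (Sum.elim (fun i => (a i : ZMod k)) fun i => (b i : ZMod k)) =
        fun i => (((M *ᵥ Sum.elim a b) i : ℤ) : ZMod k) := by
      funext i
      simp [Matrix.mulVec, dotProduct]
    have hcomm : ∀ F : NT k, rep k g (heisEnd k a b F) =
        heisEnd k ((M *ᵥ Sum.elim a b) ∘ Sum.inl) ((M *ᵥ Sum.elim a b) ∘ Sum.inr) (rep k g F) := by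
      intro F
      refine Subtype.ext ?_
      change act g (heis k (torsion k a b) F.1) = heis k (torsion k _ _) (act g F.1)
      have h3 := h.mulVec_period (Sum.elim a b)
      rw [Sum.elim_comp_inl, Sum.elim_comp_inr] at h3
      rw [act_heis, torsion, Matrix.mulVec_smul, h3]
      rfl
    refine ⟨c⁻¹ * c', by simp [hc, hc'], LinearMap.ext fun f => ?_⟩
    obtain ⟨F, rfl⟩ := (coeffEquiv hk).surjective f
    have hop2 : op (fun i => (a i : ZMod k)) (fun i => (b i : ZMod k)) (coeffEquiv hk F) =
        c⁻¹ • coeffEquiv hk (heisEnd k a b F) := by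
      rw [eq_inv_smul_iff₀ hc0]
      exact (hop F).symm
    rw [Module.End.mul_apply, hop2, map_smul, LinearEquiv.conj_apply_apply,
      LinearEquiv.symm_apply_apply, hcomm, LinearMap.smul_apply, Module.End.mul_apply,
      LinearEquiv.conj_apply_apply, LinearEquiv.symm_apply_apply, mul_smul]
    congr 1
    simp only [hσ, hcast]
    exact hop' _
  choose c hc hcop using key
  have h2 := norm_trace_mul_trace_le _ _ h1 σ c hc hcop
  rw [← chi_eq_trace_conj hk, ← chi_eq_trace_conj hk] at h2
  refine h2.trans (Nat.cast_le.2 (Finset.card_le_card_of_injOn (fun p => Sum.elim p.1 p.2) ?_ ?_))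
  · rintro p hp
    simp only [Finset.coe_filter, Finset.mem_univ, true_and, Set.mem_ofPred_eq] at hp ⊢
    have e1 : (M.map (fun m => (m : ZMod k)) *ᵥ Sum.elim p.1 p.2) ∘ Sum.inl = p.1 :=
      congrArg Prod.fst hp
    have e2 : (M.map (fun m => (m : ZMod k)) *ᵥ Sum.elim p.1 p.2) ∘ Sum.inr = p.2 :=
      congrArg Prod.snd hp
    rw [← Sum.elim_comp_inl_inr (M.map (fun m => (m : ZMod k)) *ᵥ Sum.elim p.1 p.2), e1, e2]
  · rintro ⟨a, b⟩ _ ⟨a', b'⟩ _ hpq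
    have h3 := congrArg (· ∘ Sum.inl) hpq
    have h4 := congrArg (· ∘ Sum.inr) hpq
    exact Prod.ext (by simpa using h3) (by simpa using h4)

/-! ### Degree zero -/

/-- In degree zero the automorphy factor is 1 and the coefficient isomorphism is unavailable. A
Λ-periodic entire function has only a constant Fourier term, and constants are invariant. -/
theorem finrank_H0Inv_zero : Module.finrank ℂ (H0Inv 0) = 1 := by
  refine finrank_eq_one (⟨1, one_mem_H0Inv⟩ : H0Inv 0) ?_ ?_
  · intro h
    exact one_ne_zero (congrFun (congrArg Subtype.val h) 0)
  · rintro ⟨f, hf⟩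
    have hf0 := hf.1
    have hc : ∀ n ≠ 0, fourierCoeff (fun v => f (ω₂ *ᵥ v)) n = 0 := by
      intro n hn
      -- With k = 0 this reads cₙ = exp(2πi ᵗnZn) cₙ, and the exponential has modulus less than 1
      -- because Im Z is positive definite.
      have h := fourierCoeff_add_smul hf0 n n
      simp only [Nat.cast_zero, zero_smul, add_zero, mul_zero, zero_mul, Complex.exp_zero,
        one_mul] at h
      by_contra h0
      have h1 : expDot n (Z *ᵥ intVec n) = 1 := by
        have := mul_right_cancel₀ h0 ((one_mul _).trans h)
        exact this.symm
      obtain ⟨r, hr, hr0⟩ : ∃ r : ℝ, dualVec n ⬝ᵥ dualVec n = r ∧ 0 < r := by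
        refine ⟨(n 0 + n 1 + n 2 / 2 : ℝ) ^ 2 + (n 1 + n 2 / 2 : ℝ) ^ 2 + (n 2 / 2 : ℝ) ^ 2, ?_, ?_⟩
        · rw [dualVec_eq]
          simp [dotProduct, Fin.sum_univ_three]
          ring
        · by_contra hneg
          have h2 : (n 2 : ℝ) = 0 := by nlinarith
          have h3 : (n 1 : ℝ) = 0 := by nlinarith
          have h4 : (n 0 : ℝ) = 0 := by nlinarith
          refine hn (funext fun i => ?_)
          fin_cases i
          · exact_mod_cast h4
          · exact_mod_cast h3
          · exact_mod_cast h2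
      have h2 := congrArg norm h1
      rw [expDot, show (fun i => ((n i : ℤ) : ℂ)) = intVec n from rfl, intVec_Z, hr, norm_one,
        Complex.norm_exp, Real.exp_eq_one_iff] at h2
      have h3 : (-(1 - α) ^ 2).im = Real.sqrt 7 / 2 := by
        have := im_modulus
        rw [Complex.div_ofNat_im] at this
        linarith
      rw [show 2 * (Real.pi : ℂ) * I * (-(1 - α) ^ 2 * r) =
        ((2 * Real.pi * r : ℝ) : ℂ) * (I * -(1 - α) ^ 2) by push_cast; ring, Complex.re_ofReal_mul,
        Complex.I_mul_re, h3] at h2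
      have : 0 < 2 * Real.pi * r * (Real.sqrt 7 / 2) := by positivity
      linarith
    set c := fourierCoeff (fun v => f (ω₂ *ᵥ v)) 0 with hc0
    have hp := isPeriodic_of_mem_H0 hf0
    have hd := differentiable_of_mem_H0 hf0
    have hpc : IsPeriodic fun _ : V => -c := fun _ _ => rfl
    have h0 := eq_zero_of_fourierCoeff_eq_zero (hd.add (differentiable_const (-c))) (hp.add hpc)
      fun n => by
        rw [fourierCoeff_add hp hpc hd.continuous continuous_const, fourierCoeff_const]
        by_cases hn : n = 0
        · subst hn; simp [← hc0]
        · simp [hc n hn, hn]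
    refine ⟨c, Subtype.ext (funext fun z => ?_)⟩
    have h1 := congrFun h0 (normCoord z)
    simp only [Pi.add_apply, ω₂_normCoord, Pi.zero_apply] at h1
    change c * 1 = f z
    linear_combination -h1

end KleinTheta

namespace KleinTheta

/-! ### A decidable model of the group: matrices over `ℤ[α]` in the basis of roots -/

/-- The ring `ℤ[α]`. -/
abbrev QuadInt : Type := QuadraticAlgebra ℤ (-2) 1

/-- The embedding of `ℤ[α]` in `ℂ`. -/
def quadEmb : QuadInt →ₐ[ℤ] ℂ :=
  QuadraticAlgebra.lift ⟨α, by
    have := α_sq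
    simp only [neg_smul, one_smul]
    linear_combination this⟩

theorem quadEmb_mk (m n : ℤ) : quadEmb ⟨m, n⟩ = m + n * α := by
  simp [quadEmb, QuadraticAlgebra.lift]

/-- The matrix whose columns are the basic roots. -/
def rootBasis : Matrix (Fin 3) (Fin 3) ℂ := !![0, 0, 1; α, 0, 1; -α, 2, 1 - α]

theorem rootBasis_det : rootBasis.det = 2 * α := by
  rw [rootBasis, Matrix.det_fin_three]
  simp
  ring

/-- `N` is the matrix of `g` in the basis of roots. -/
def IsRootMatrix (g : G) (N : Matrix (Fin 3) (Fin 3) QuadInt) : Prop :=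
  g.1.val * rootBasis = rootBasis * N.map quadEmb

theorem IsRootMatrix.mul {g h : G} {M N} (hg : IsRootMatrix g M) (hh : IsRootMatrix h N) :
    IsRootMatrix (g * h) (M * N) := by
  unfold IsRootMatrix at *
  rw [Subgroup.coe_mul, Units.val_mul, Matrix.mul_assoc, hh, ← Matrix.mul_assoc, hg,
    Matrix.mul_assoc, Matrix.map_mul]

theorem isRootMatrix_one : IsRootMatrix 1 1 := by
  simp [IsRootMatrix, Matrix.map_one]

theorem IsRootMatrix.eq {g h : G} {N} (hg : IsRootMatrix g N) (hh : IsRootMatrix h N) : g = h := by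
  have hu : IsUnit rootBasis.det := by
    rw [rootBasis_det]
    exact (mul_ne_zero two_ne_zero α_ne_zero).isUnit
  refine Subtype.ext (Units.ext ?_)
  have h1 : g.1.val * rootBasis = h.1.val * rootBasis := hg.trans hh.symm
  have h2 := congrArg (fun M => M * rootBasis⁻¹) h1
  simpa only [Matrix.mul_assoc, Matrix.mul_nonsing_inv _ hu, Matrix.mul_one] using h2

/-- The three generating reflections. -/
def r₁ : G := ⟨refl φ₁, Subgroup.subset_closure (by simp)⟩
def r₂ : G := ⟨refl φ₂, Subgroup.subset_closure (by simp)⟩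
def r₃ : G := ⟨refl φ₃, Subgroup.subset_closure (by simp)⟩

def N₁ : Matrix (Fin 3) (Fin 3) QuadInt := !![-1, ⟨1, -1⟩, -1; 0, 1, 0; 0, 0, 1]
def N₂ : Matrix (Fin 3) (Fin 3) QuadInt := !![1, 0, 0; ⟨0, 1⟩, -1, ⟨-1, 1⟩; 0, 0, 1]
def N₃ : Matrix (Fin 3) (Fin 3) QuadInt := !![1, 0, 0; 0, 1, 0; -1, ⟨0, -1⟩, -1]

theorem isRootMatrix_r₁ : IsRootMatrix r₁ N₁ := by
  have h1 := α_sq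
  change reflMatrix φ₁ * rootBasis = _
  rw [refl_φ₁, rootBasis, N₁]
  ext i j
  fin_cases i <;> fin_cases j <;>
    simp [Matrix.mul_apply, Fin.sum_univ_three, quadEmb_mk] <;> grind

theorem isRootMatrix_r₂ : IsRootMatrix r₂ N₂ := by
  have h1 := α_sq
  change reflMatrix φ₂ * rootBasis = _
  rw [refl_φ₂, rootBasis, N₂]
  ext i j
  fin_cases i <;> fin_cases j <;>
    simp [Matrix.mul_apply, Fin.sum_univ_three, quadEmb_mk] <;> grind

theorem isRootMatrix_r₃ : IsRootMatrix r₃ N₃ := by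
  have h1 := α_sq
  change reflMatrix φ₃ * rootBasis = _
  rw [refl_φ₃, rootBasis, N₃, αbar_eq]
  ext i j
  fin_cases i <;> fin_cases j <;>
    simp [Matrix.mul_apply, Fin.sum_univ_three, quadEmb_mk] <;> grind

/-- Names of some elements of `G`: the generators `a`, `x`, `s`, the transposition `y` and the
cyclic permutation `c` of the coordinates, `e = diag(-1, 1, 1)` and `i = -1`. -/
inductive Letter | a | x | s | y | e | i | c
  deriving DecidableEq

/-- The element of `G` named by a letter. -/
def letterG : Letter → G
  | .a => r₁
  | .x => r₂
  | .s => r₃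
  | .y => r₁ * r₂ * r₁ * r₃ * r₂ * r₃ * r₁ * r₂ * r₁
  | .e => r₃ * r₂ * r₃ * r₁ * r₂ * r₁ * r₃ * r₂ * r₃
  | .i => r₁ * r₂ * r₁ * r₂ * r₃ * r₂ * r₃ * r₁ * r₂ * r₁ * r₃ * r₂ * r₃
  | .c => r₁ * r₂ * r₁ * r₃ * r₂ * r₃ * r₁ * r₂

/-- The matrix of a letter in the basis of roots. -/
def letterN : Letter → Matrix (Fin 3) (Fin 3) QuadInt
  | .a => N₁
  | .x => N₂
  | .s => N₃
  | .y => !![-1, 0, 0; ⟨-1, -1⟩, 1, 0; ⟨0, 1⟩, 0, 1]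
  | .e => !![1, 0, ⟨1, -1⟩; 0, 1, ⟨2, -1⟩; 0, 0, -1]
  | .i => !![-1, 0, 0; 0, -1, 0; 0, 0, -1]
  | .c => !![1, ⟨-1, 1⟩, 1; ⟨1, 1⟩, ⟨-2, 1⟩, ⟨1, 1⟩; ⟨0, -1⟩, 2, ⟨1, -1⟩]

theorem IsRootMatrix.congr {g : G} {N N'} (hg : IsRootMatrix g N) (h : N = N') :
    IsRootMatrix g N' := h ▸ hg

theorem isRootMatrix_letter_y : IsRootMatrix (letterG .y) (letterN .y) :=
  ((((((((isRootMatrix_r₁.mul isRootMatrix_r₂).mul isRootMatrix_r₁).mul isRootMatrix_r₃).mul isRootMatrix_r₂).mul isRootMatrix_r₃).mul isRootMatrix_r₁).mul isRootMatrix_r₂).mul isRootMatrix_r₁).congr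
    (by decide +kernel)

theorem isRootMatrix_letter_e : IsRootMatrix (letterG .e) (letterN .e) :=
  ((((((((isRootMatrix_r₃.mul isRootMatrix_r₂).mul isRootMatrix_r₃).mul isRootMatrix_r₁).mul isRootMatrix_r₂).mul isRootMatrix_r₁).mul isRootMatrix_r₃).mul isRootMatrix_r₂).mul isRootMatrix_r₃).congr
    (by decide +kernel)

theorem isRootMatrix_letter_i : IsRootMatrix (letterG .i) (letterN .i) :=
  ((((((((((((isRootMatrix_r₁.mul isRootMatrix_r₂).mul isRootMatrix_r₁).mul isRootMatrix_r₂).mul isRootMatrix_r₃).mul isRootMatrix_r₂).mul isRootMatrix_r₃).mul isRootMatrix_r₁).mul isRootMatrix_r₂).mul isRootMatrix_r₁).mul isRootMatrix_r₃).mul isRootMatrix_r₂).mul isRootMatrix_r₃).congr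
    (by decide +kernel)

theorem isRootMatrix_letter_c : IsRootMatrix (letterG .c) (letterN .c) :=
  (((((((isRootMatrix_r₁.mul isRootMatrix_r₂).mul isRootMatrix_r₁).mul isRootMatrix_r₃).mul isRootMatrix_r₂).mul isRootMatrix_r₃).mul isRootMatrix_r₁).mul isRootMatrix_r₂).congr
    (by decide +kernel)

theorem isRootMatrix_letter : ∀ l : Letter, IsRootMatrix (letterG l) (letterN l)
  | .a => isRootMatrix_r₁
  | .x => isRootMatrix_r₂
  | .s => isRootMatrix_r₃
  | .y => isRootMatrix_letter_y
  | .e => isRootMatrix_letter_e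
  | .i => isRootMatrix_letter_i
  | .c => isRootMatrix_letter_c

/-- The element of `G` named by a word. -/
def wordG (w : List Letter) : G := (w.map letterG).prod

/-- The matrix of a word in the basis of roots. -/
def wordN (w : List Letter) : Matrix (Fin 3) (Fin 3) QuadInt := (w.map letterN).prod

theorem isRootMatrix_word (w : List Letter) : IsRootMatrix (wordG w) (wordN w) := by
  induction w with
  | nil => exact isRootMatrix_one
  | cons l w ih => exact (isRootMatrix_letter l).mul ih

/-- The roots form a basis of ℂ³, so a relation in `G` follows from an identity of matrices over
ℤ[α], which is decidable. -/
theorem wordG_eq {w w' : List Letter} (h : wordN w = wordN w') : wordG w = wordG w' :=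
  (isRootMatrix_word w).eq (h ▸ isRootMatrix_word w')

theorem wordG_append (w w' : List Letter) : wordG (w ++ w') = wordG w * wordG w' := by
  simp [wordG]

theorem wordG_singleton (l : Letter) : wordG [l] = letterG l := by
  simp [wordG]

/-- All products of a word from `l` with a word from `l'`. -/
def wordProd (l l' : List (List Letter)) : List (List Letter) :=
  l.flatMap fun w => l'.map fun w' => w ++ w'

end KleinTheta

/-! ### Averaging over `G` = H ∪ HsH, with H the monomial subgroup -/

namespace KleinTheta

section Average

open Letter

variable {M : Type*} [AddCommGroup M] [Module ℂ M] (ρ : Representation ℂ G M)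

/-- The operator by which a word acts. -/
def wordOp (w : List Letter) : Module.End ℂ M := ρ (wordG w)

/-- The sum of the operators by which the words in a list act. -/
def sumOp (l : List (List Letter)) : Module.End ℂ M := (l.map (wordOp ρ)).sum

theorem wordOp_append (w w' : List Letter) : wordOp ρ (w ++ w') = wordOp ρ w * wordOp ρ w' := by
  rw [wordOp, wordG_append, map_mul]; rfl

theorem wordOp_nil : wordOp ρ [] = 1 := map_one ρ

theorem wordOp_eq {w w' : List Letter} (h : wordN w = wordN w') : wordOp ρ w = wordOp ρ w' := by
  rw [wordOp, wordG_eq h]; rfl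

theorem sumOp_map_append (w : List Letter) (l : List (List Letter)) :
    sumOp ρ (l.map (w ++ ·)) = wordOp ρ w * sumOp ρ l := by
  simp only [sumOp, List.map_map, ← List.sum_map_mul_left]
  exact congrArg List.sum (List.map_congr_left fun x _ => wordOp_append ρ w x)

theorem sumOp_wordProd (l l' : List (List Letter)) :
    sumOp ρ (wordProd l l') = sumOp ρ l * sumOp ρ l' := by
  induction l with
  | nil => simp [sumOp, wordProd]
  | cons w l ih =>
    have h : sumOp ρ (wordProd (w :: l) l') =
        sumOp ρ (l'.map (w ++ ·)) + sumOp ρ (wordProd l l') := by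
      simp [sumOp, wordProd]
    rw [h, ih, sumOp_map_append]
    simp [sumOp, add_mul]

/-- The operator of a word depends only on the matrix of the word, so sums over words may be
compared through their multisets of matrices. -/
theorem sumOp_eq_of_perm {l l' : List (List Letter)} (h : (l.map wordN).Perm (l'.map wordN)) :
    sumOp ρ l = sumOp ρ l' := by
  have h1 : ∃ F : Matrix (Fin 3) (Fin 3) QuadInt → Module.End ℂ M,
      ∀ w, F (wordN w) = wordOp ρ w := by
    classical
    refine ⟨fun N => if h : ∃ w, wordN w = N then wordOp ρ h.choose else 0, fun w => ?_⟩
    have hw : ∃ w', wordN w' = wordN w := ⟨w, rfl⟩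
    simp only [dif_pos hw]
    exact wordOp_eq ρ hw.choose_spec
  obtain ⟨F, hF⟩ := h1
  have h2 := (h.map F).sum_eq
  simp only [List.map_map, Function.comp_def, hF] at h2
  exact h2

theorem sumOp_mul_of_forall {l : List (List Letter)} {T : Module.End ℂ M}
    (h : ∀ w ∈ l, wordOp ρ w * T = T) : sumOp ρ l * T = (l.length : ℂ) • T := by
  induction l with
  | nil => simp [sumOp]
  | cons w l ih =>
    have h1 := ih fun w hw => h w (List.mem_cons_of_mem _ hw)
    simp only [sumOp, List.map_cons, List.sum_cons, add_mul, List.length_cons] at h1 ⊢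
    rw [h1, h w List.mem_cons_self]
    push_cast
    rw [add_smul, one_smul, add_comm]

/-- Conjugacy data `(w, u, r)`: up to sign, the word `u` conjugates the word `w` to `r`. This list
treats half of the monomial subgroup of `G`. -/
def monomialTable : List (List Letter × List Letter × List Letter) :=
  [([], [], []), ([y], [s, e], [x]), ([x], [], [x]), ([x, y], [s], [x]), ([e], [c, y], [x]),
   ([e, y], [c], [a, x]), ([e, x], [c], [x]), ([e, x, y], [c, y], [a, x]), ([c], [], [c]),
   ([c, y], [s, c, x], [x]), ([c, x], [e, x], [c]), ([c, x, y], [y], [a, x]), ([c, e], [x], [c]),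
   ([c, e, y], [s, c], [x]), ([c, e, x], [e], [c]), ([c, e, x, y], [x, y], [a, x]),
   ([c, c], [y], [c]), ([c, c, y], [s, c, x, y], [x]), ([c, c, x], [e, x, y], [c]),
   ([c, c, x, y], [], [a, x]), ([c, c, e], [e, y], [c]), ([c, c, e, y], [x], [a, x]),
   ([c, c, e, x], [x, y], [c]), ([c, c, e, x, y], [s, c, y], [x])]

/-- The analogue of `monomialTable` for the translate of the monomial subgroup by `s`. -/
def translateTable : List (List Letter × List Letter × List Letter) :=
  [([s], [c, s, e, x], [x]), ([s, y], [c, s, e], [x]), ([s, x], [c, s, e, x], [a, x]),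
   ([s, x, y], [c, s, e], [a, x]), ([s, e], [e, s, c, c, e], [c]),
   ([s, e, y], [e, y, s, c, e], [c]), ([s, e, x], [e, x, s, c], [c]),
   ([s, e, x, y], [e, s, c, c, e, x], [c]), ([s, c], [s, c, c, x], [a, x]),
   ([s, c, y], [s, c], [c]), ([s, c, x], [], [s, c, x]), ([s, c, x, y], [s, x], [c, c, e, s]),
   ([s, c, e], [s, c, x, y], [c]), ([s, c, e, y], [y, s, c], [a, x]),
   ([s, c, e, x], [s, y], [c, c, e, s]), ([s, c, e, x, y], [x, y], [s, c, x]),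
   ([s, c, c], [y, s, c, x], [a, x]), ([s, c, c, y], [s, c, y], [c]),
   ([s, c, c, x], [y], [s, c, x]), ([s, c, c, x, y], [x, s], [c, c, e, s]),
   ([s, c, c, e], [s], [c, c, e, s]), ([s, c, c, e, y], [x], [s, c, x]),
   ([s, c, c, e, x], [s, c, x], [c]), ([s, c, c, e, x, y], [s, c, c], [a, x])]

/-- Words for the elements of the monomial subgroup of `G`, of order 48. -/
def monomialWords : List (List Letter) := wordProd [[], [i]] (monomialTable.map (·.1))

/-- Words for the elements of a subgroup of order 8 which is normalized by `s`. -/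
def dihedralWords : List (List Letter) :=
  wordProd [[], [i]] (wordProd [[], [x]] [[], [y]])

/-- Words for coset representatives of the subgroup `dihedralWords` of `monomialWords`. -/
def cosetWords : List (List Letter) := wordProd [[], [c], [c, c]] [[], [e]]

theorem sumOp_monomialWords_eq :
    sumOp ρ monomialWords = sumOp ρ cosetWords * sumOp ρ dihedralWords := by
  rw [← sumOp_wordProd]
  exact sumOp_eq_of_perm ρ (by decide +kernel)

theorem sumOp_dihedralWords_mul :
    sumOp ρ dihedralWords * wordOp ρ [s] = wordOp ρ [s] * sumOp ρ dihedralWords := by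
  have h1 : wordOp ρ [s] = sumOp ρ [[s]] := by simp [sumOp]
  rw [h1, ← sumOp_wordProd, ← sumOp_wordProd]
  exact sumOp_eq_of_perm ρ (by decide +kernel)

theorem letter_mul_sumOp_monomialWords {l : Letter} (hl : l ≠ a) (hl' : l ≠ s) :
    wordOp ρ [l] * sumOp ρ monomialWords = sumOp ρ monomialWords := by
  rw [← sumOp_map_append]
  refine sumOp_eq_of_perm ρ ?_
  cases l
  · exact absurd rfl hl
  · decide +kernel
  · exact absurd rfl hl'
  · decide +kernel
  · decide +kernel
  · decide +kernel
  · decide +kernel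

theorem word_mul_sumOp_monomialWords {w : List Letter} (hw : a ∉ w ∧ s ∉ w) :
    wordOp ρ w * sumOp ρ monomialWords = sumOp ρ monomialWords := by
  induction w with
  | nil => rw [wordOp_nil, one_mul]
  | cons l w ih =>
    simp only [List.mem_cons, not_or] at hw
    rw [show l :: w = [l] ++ w from rfl, wordOp_append, mul_assoc, ih ⟨hw.1.2, hw.2.2⟩,
      letter_mul_sumOp_monomialWords ρ (Ne.symm hw.1.1) (Ne.symm hw.2.1)]

theorem not_mem_monomialWords : ∀ w ∈ monomialWords, a ∉ w ∧ s ∉ w := by decide +kernel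

theorem not_mem_dihedralWords : ∀ w ∈ dihedralWords, a ∉ w ∧ s ∉ w := by decide +kernel

/-- A multiple of the projection to the invariants. -/
def averageOp : Module.End ℂ M :=
  sumOp ρ monomialWords + sumOp ρ cosetWords * (wordOp ρ [s] * sumOp ρ monomialWords)

theorem monomialWords_mul_self :
    sumOp ρ monomialWords * sumOp ρ monomialWords = (48 : ℂ) • sumOp ρ monomialWords := by
  rw [sumOp_mul_of_forall ρ fun w hw =>
    word_mul_sumOp_monomialWords ρ (not_mem_monomialWords w hw),
    show monomialWords.length = 48 by decide +kernel]
  norm_num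

/-- Write H as coset representatives times a subgroup D of order 8. The sum over D commutes with s
and then is absorbed by the sum over H, at the cost of a factor 8. -/
theorem monomialWords_mul_s_mul :
    sumOp ρ monomialWords * (wordOp ρ [s] * sumOp ρ monomialWords) =
      (8 : ℂ) • (sumOp ρ cosetWords * (wordOp ρ [s] * sumOp ρ monomialWords)) := by
  have h := sumOp_mul_of_forall ρ fun w hw =>
    word_mul_sumOp_monomialWords ρ (not_mem_dihedralWords w hw)
  rw [show dihedralWords.length = 8 by decide +kernel] at h
  conv_lhs => rw [sumOp_monomialWords_eq]
  rw [mul_assoc, ← mul_assoc (sumOp ρ dihedralWords), sumOp_dihedralWords_mul, mul_assoc,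
    ← sumOp_monomialWords_eq, h]
  simp only [mul_smul_comm]
  norm_num

/-- In this form the operator has the sum over H as a left factor in its second term, so invariance
under H on the left is visible. -/
theorem eight_smul_averageOp : (8 : ℂ) • averageOp ρ =
    (8 : ℂ) • sumOp ρ monomialWords +
      sumOp ρ monomialWords * (wordOp ρ [s] * sumOp ρ monomialWords) := by
  rw [monomialWords_mul_s_mul, averageOp, smul_add]

theorem letter_mul_averageOp {l : Letter} (hl : l ≠ a) (hl' : l ≠ s) :
    wordOp ρ [l] * averageOp ρ = averageOp ρ := by
  have h : (8 : ℂ) • (wordOp ρ [l] * averageOp ρ) = (8 : ℂ) • averageOp ρ := by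
    rw [← mul_smul_comm, eight_smul_averageOp, mul_add, mul_smul_comm, ← mul_assoc,
      letter_mul_sumOp_monomialWords ρ hl hl']
  exact smul_right_injective _ (by norm_num : (8 : ℂ) ≠ 0) h

/-- A relation sws = vsu with u in H shows that s maps the coset wsH to vsH. -/
theorem word_mul_s_mul {w v u : List Letter} (h : wordN (s :: w ++ [s]) = wordN (v ++ [s] ++ u))
    (hu : a ∉ u ∧ s ∉ u) :
    wordOp ρ [s] * (wordOp ρ w * (wordOp ρ [s] * sumOp ρ monomialWords)) =
      wordOp ρ v * (wordOp ρ [s] * sumOp ρ monomialWords) := by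
  have h1 := wordOp_eq ρ h
  rw [show s :: w ++ [s] = [s] ++ (w ++ [s]) from rfl, wordOp_append, wordOp_append,
    wordOp_append, wordOp_append] at h1
  calc _ = wordOp ρ [s] * (wordOp ρ w * wordOp ρ [s]) * sumOp ρ monomialWords := by
        simp only [mul_assoc]
    _ = _ := by rw [h1, mul_assoc, word_mul_sumOp_monomialWords ρ hu, mul_assoc]

/-- Left multiplication by s permutes the seven cosets H and vsH: it exchanges H with sH and cesH
with ccesH, and fixes esH, csH and ccsH. -/
theorem s_mul_averageOp : wordOp ρ [s] * averageOp ρ = averageOp ρ := by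
  have h1 : wordOp ρ [s] * wordOp ρ [s] = 1 := by
    rw [← wordOp_append, ← wordOp_nil]
    exact wordOp_eq ρ (by decide +kernel)
  have he := word_mul_s_mul ρ (w := [e]) (v := [e]) (u := [e]) (by decide +kernel) (by decide)
  have hc := word_mul_s_mul ρ (w := [c]) (v := [c]) (u := [c, c, y]) (by decide +kernel)
    (by decide)
  have hce := word_mul_s_mul ρ (w := [c, e]) (v := [c, c, e]) (u := [i, c, x, y])
    (by decide +kernel) (by decide)
  have hcc := word_mul_s_mul ρ (w := [c, c]) (v := [c, c]) (u := [c, y]) (by decide +kernel)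
    (by decide)
  have hcce := word_mul_s_mul ρ (w := [c, c, e]) (v := [c, e]) (u := [c, e, x, y])
    (by decide +kernel) (by decide)
  have hC : ∀ T : Module.End ℂ M, sumOp ρ cosetWords * T = T + wordOp ρ [e] * T +
      wordOp ρ [c] * T + wordOp ρ [c, e] * T + wordOp ρ [c, c] * T + wordOp ρ [c, c, e] * T := by
    intro T
    simp [sumOp, cosetWords, wordProd, add_mul, wordOp_nil, add_assoc]
  rw [averageOp, hC]
  simp only [mul_add, he, hc, hce, hcc, hcce]
  rw [← mul_assoc, h1, one_mul]
  abel

theorem rho_averageOp (g : G) : ρ g * averageOp ρ = averageOp ρ := by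
  have hx := letter_mul_averageOp ρ (l := x) (by decide) (by decide)
  have hs := s_mul_averageOp ρ
  have hy := letter_mul_averageOp ρ (l := y) (by decide) (by decide)
  have hc := letter_mul_averageOp ρ (l := c) (by decide) (by decide)
  -- The generator a equals yc, a product of letters already treated.
  have ha : wordOp ρ [a] * averageOp ρ = averageOp ρ := by
    rw [wordOp_eq ρ (show wordN [a] = wordN ([y] ++ [c]) by decide +kernel), wordOp_append,
      mul_assoc, hc, hy]
  simp only [wordOp, wordG_singleton, letterG] at hx hs ha
  obtain ⟨g, hg⟩ := g
  induction hg using Subgroup.closure_induction with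
  | mem u hu =>
    rcases hu with rfl | rfl | rfl
    · exact ha
    · exact hx
    · exact hs
  | one => exact (congrArg (· * averageOp ρ) (map_one ρ)).trans (one_mul _)
  | mul u v hu hv hu' hv' =>
    rw [show (⟨u * v, _⟩ : G) = ⟨u, hu⟩ * ⟨v, hv⟩ from rfl, map_mul, mul_assoc, hv', hu']
  | inv u hu hu' =>
    conv_lhs => rw [← hu', ← mul_assoc, ← map_mul]
    rw [show (⟨u⁻¹, _⟩ : G) * ⟨u, hu⟩ = 1 from inv_mul_cancel (⟨u, hu⟩ : G), map_one, one_mul]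

theorem sumOp_apply_of_mem_invariants {v : M} (hv : v ∈ ρ.invariants) (l : List (List Letter)) :
    sumOp ρ l v = (l.length : ℂ) • v := by
  induction l with
  | nil => simp [sumOp]
  | cons w l ih =>
    have h1 : wordOp ρ w v = v := hv (wordG w)
    simp only [sumOp, List.map_cons, List.sum_cons, LinearMap.add_apply, List.length_cons] at ih ⊢
    rw [ih, h1]
    push_cast
    rw [add_smul, one_smul, add_comm]

theorem averageOp_apply_of_mem_invariants {v : M} (hv : v ∈ ρ.invariants) :
    averageOp ρ v = (336 : ℂ) • v := by
  have h1 : wordOp ρ [s] v = v := hv (wordG [s])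
  rw [averageOp, LinearMap.add_apply, Module.End.mul_apply, Module.End.mul_apply,
    sumOp_apply_of_mem_invariants ρ hv, map_smul, map_smul, h1,
    sumOp_apply_of_mem_invariants ρ hv, show monomialWords.length = 48 by decide +kernel,
    show cosetWords.length = 6 by decide +kernel, smul_smul, ← add_smul]
  norm_num

/-- The operator maps into the invariants and is multiplication by 48 + 6·48 = 336 on them, so it is
336 times a projection. Neither the order of `G` nor the distinctness of the words is used. -/
theorem trace_averageOp [FiniteDimensional ℂ M] :
    LinearMap.trace ℂ M (averageOp ρ) = 336 * Module.finrank ℂ ρ.invariants := by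
  have h : LinearMap.IsProj ρ.invariants ((336 : ℂ)⁻¹ • averageOp ρ) := by
    refine ⟨fun v g => ?_, fun v hv => ?_⟩
    · have h1 := LinearMap.congr_fun (rho_averageOp ρ g) v
      rw [LinearMap.smul_apply, map_smul]
      exact congrArg _ h1
    · rw [LinearMap.smul_apply, averageOp_apply_of_mem_invariants ρ hv, smul_smul,
        inv_mul_cancel₀ (by norm_num), one_smul]
  have h1 := h.trace
  rw [map_smul, smul_eq_mul] at h1
  rw [← h1, ← mul_assoc, mul_inv_cancel₀ (by norm_num), one_mul]

/-- The trace of a word. -/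
def wordTr (w : List Letter) : ℂ := LinearMap.trace ℂ M (wordOp ρ w)

/-- The sum of the traces of plus and minus a word. -/
def evenTr (w : List Letter) : ℂ := wordTr ρ w + wordTr ρ (i :: w)

theorem trace_sumOp (l : List (List Letter)) :
    LinearMap.trace ℂ M (sumOp ρ l) = (l.map (wordTr ρ)).sum := by
  rw [sumOp, map_list_sum, List.map_map]; rfl

theorem wordTr_eq_of_conj {w u r : List Letter} (h : wordN (u ++ w) = wordN (r ++ u)) :
    wordTr ρ w = wordTr ρ r := by
  have h1 := wordG_eq h
  rw [wordG_append, wordG_append] at h1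
  have h2 : wordG w = (wordG u)⁻¹ * (wordG r * wordG u) := by rw [← h1, inv_mul_cancel_left]
  rw [wordTr, wordOp, h2, map_mul, LinearMap.trace_mul_comm, ← map_mul, mul_assoc, mul_inv_cancel,
    mul_one]
  rfl

/-- The word `u` conjugates the word `w` to `r`, up to sign. -/
def ConjUpToSign (t : List Letter × List Letter × List Letter) : Prop :=
  (wordN (t.2.1 ++ t.1) = wordN (t.2.2 ++ t.2.1) ∧
      wordN (t.2.1 ++ (i :: t.1)) = wordN ((i :: t.2.2) ++ t.2.1)) ∨
    (wordN (t.2.1 ++ t.1) = wordN ((i :: t.2.2) ++ t.2.1) ∧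
      wordN (t.2.1 ++ (i :: t.1)) = wordN (t.2.2 ++ t.2.1))

instance : DecidablePred ConjUpToSign := fun _ => inferInstanceAs (Decidable (_ ∨ _))

/-- Traces are taken over ±w together, so a conjugacy that introduces a sign merely exchanges the
two summands. -/
theorem evenTr_eq_of_conj {t : List Letter × List Letter × List Letter} (h : ConjUpToSign t) :
    evenTr ρ t.1 = evenTr ρ t.2.2 := by
  rcases h with h | h
  · rw [evenTr, wordTr_eq_of_conj ρ h.1, wordTr_eq_of_conj ρ h.2, evenTr]
  · rw [evenTr, wordTr_eq_of_conj ρ h.1, wordTr_eq_of_conj ρ h.2, evenTr, add_comm]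

theorem conjUpToSign_monomialTable : ∀ t ∈ monomialTable, ConjUpToSign t := by decide +kernel

theorem conjUpToSign_translateTable : ∀ t ∈ translateTable, ConjUpToSign t := by decide +kernel

theorem trace_sumOp_monomialWords : LinearMap.trace ℂ M (sumOp ρ monomialWords) =
    (monomialTable.map fun t => evenTr ρ t.2.2).sum := by
  rw [trace_sumOp, ← List.map_congr_left fun t ht =>
    evenTr_eq_of_conj ρ (conjUpToSign_monomialTable t ht)]
  simp only [evenTr, List.sum_map_add]
  simp [monomialWords, wordProd, Function.comp_def]

theorem trace_s_mul_sumOp_monomialWords :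
    LinearMap.trace ℂ M (wordOp ρ [s] * sumOp ρ monomialWords) =
      (translateTable.map fun t => evenTr ρ t.2.2).sum := by
  rw [← sumOp_map_append, sumOp_eq_of_perm ρ (l' := wordProd [[], [i]] (translateTable.map (·.1)))
    (by decide +kernel), trace_sumOp, ← List.map_congr_left fun t ht =>
    evenTr_eq_of_conj ρ (conjUpToSign_translateTable t ht)]
  simp only [evenTr, List.sum_map_add]
  simp [wordProd, Function.comp_def]

/-- The dimension of the space of invariants of a representation of `G` in terms of the traces of
representatives of the conjugacy classes up to sign. -/
theorem finrank_invariants_eq [FiniteDimensional ℂ M] :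
    336 * (Module.finrank ℂ ρ.invariants : ℂ) =
      evenTr ρ [] + 21 * evenTr ρ [x] + 56 * evenTr ρ [c] + 42 * evenTr ρ [a, x] +
        24 * (evenTr ρ [s, c, x] + evenTr ρ [c, c, e, s]) := by
  -- By cyclicity, the trace of the double coset term is 48 times that of the single coset sH. After
  -- division by 8, the total is the trace over H plus 6 times the trace over sH, so the two
  -- conjugacy tables suffice.
  have h1 := congrArg (LinearMap.trace ℂ M) (eight_smul_averageOp ρ)
  rw [map_add, LinearMap.trace_mul_comm, mul_assoc, monomialWords_mul_self, mul_smul_comm,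
    map_smul, map_smul, map_smul, trace_averageOp, trace_sumOp_monomialWords,
    trace_s_mul_sumOp_monomialWords] at h1
  simp only [monomialTable, translateTable, List.map_cons, List.map_nil, List.sum_cons,
    List.sum_nil, smul_eq_mul] at h1
  linear_combination (1 / 8) * h1

end Average

end KleinTheta

namespace KleinTheta

/-! ### Numbers of fixed points modulo `k` -/

/-- The number of points of `(ℤ/k)ⁿ` fixed by an integer matrix. -/
def fixCard {n : Type*} [Fintype n] [DecidableEq n] (k : ℕ) [NeZero k] (M : Matrix n n ℤ) : ℕ :=
  (Finset.univ.filter fun x : n → ZMod k => (M.map (fun m => (m : ZMod k))) *ᵥ x = x).card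

theorem card_torsion_zmod (k d : ℕ) [NeZero k] :
    (Finset.univ.filter fun t : ZMod k => (d : ZMod k) * t = 0).card = k.gcd d := by
  have h := IsAddCyclic.card_nsmulAddMonoidHom_ker (G := ZMod k) d
  rw [Nat.card_zmod] at h
  rw [← h, ← Fintype.card_subtype, ← Nat.card_eq_fintype_card]
  refine Nat.card_congr (Equiv.subtypeEquivRight fun t => ?_)
  simp [AddMonoidHom.mem_ker, nsmul_eq_mul]

/-- A fixed vector is determined by its j-th coordinate, which is 7-torsion in ℤ/k. -/
theorem fixCard_le_gcd_seven (k : ℕ) [NeZero k] {n : Type*} [Fintype n] [DecidableEq n]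
    (M : Matrix n n ℤ) (j : n) (v : n → ZMod k)
    (h : ∀ x : n → ZMod k, (M.map (fun m => (m : ZMod k))) *ᵥ x = x →
      7 * x j = 0 ∧ ∀ l, x l = v l * x j) :
    fixCard k M ≤ k.gcd 7 := by
  rw [← card_torsion_zmod, fixCard]
  refine Finset.card_le_card_of_injOn (fun x => x j) (fun x hx => ?_) fun x hx y hy hxy => ?_
  · simp only [Finset.coe_filter, Finset.mem_univ, true_and, Set.mem_ofPred_eq] at hx ⊢
    exact_mod_cast (h x hx).1
  · simp only [Finset.coe_filter, Finset.mem_univ, true_and, Set.mem_ofPred_eq] at hx hy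
    funext l
    rw [(h x hx).2 l, (h y hy).2 l]
    exact congrArg _ hxy

/-- An integral row reduction of M − 1 is valid modulo every k at once. -/
theorem mulVec_eq_zero_of_mul_sub_one {k : ℕ} {n : Type*} [Fintype n] [DecidableEq n]
    {U M H : Matrix n n ℤ} (h : U * (M - 1) = H) {x : n → ZMod k}
    (hx : (M.map (fun m => (m : ZMod k))) *ᵥ x = x) :
    (H.map (fun m => (m : ZMod k))) *ᵥ x = 0 := by
  have h1 : H.map (Int.castRingHom (ZMod k)) = U.map (Int.castRingHom (ZMod k)) *
      (M.map (Int.castRingHom (ZMod k)) - 1) := by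
    rw [← h, Matrix.map_mul, Matrix.map_sub _ (by simp), Matrix.map_one _ (by simp) (by simp)]
  change H.map (Int.castRingHom (ZMod k)) *ᵥ x = 0
  change M.map (Int.castRingHom (ZMod k)) *ᵥ x = x at hx
  rw [h1, ← Matrix.mulVec_mulVec, Matrix.sub_mulVec, hx, Matrix.one_mulVec, sub_self,
    Matrix.mulVec_zero]

section

variable (k : ℕ) [NeZero k]

theorem fixCard_one : fixCard k (1 : Matrix (Fin 3) (Fin 3) ℤ) = k ^ 3 := by
  simp [fixCard, Matrix.map_one, ZMod.card]

theorem fixCard_eq_card_of_equiv {s : Finset (ZMod k)} {M : Matrix (Fin 3) (Fin 3) ℤ}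
    (v : Fin 3 → ZMod k) (j : Fin 3) (hv : v j = 1)
    (h : ∀ x : Fin 3 → ZMod k, (M.map (fun m => (m : ZMod k))) *ᵥ x = x ↔
      (x j ∈ s ∧ ∀ l, x l = v l * x j)) :
    fixCard k M = s.card := by
  rw [fixCard]
  refine Finset.card_bij' (fun x _ => x j) (fun t _ l => v l * t) ?_ ?_ ?_ ?_
  · intro x hx
    exact ((h x).1 (by simpa using hx)).1
  · intro t ht
    simp only [Finset.mem_filter, Finset.mem_univ, true_and]
    refine (h _).2 ⟨?_, fun l => ?_⟩
    · simpa [hv] using ht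
    · simp [hv]
  · intro x hx
    funext l
    exact (((h x).1 (by simpa using hx)).2 l).symm
  · intro t ht
    simp [hv]

theorem fixCard_eq_prod {s : Fin 3 → Finset (ZMod k)} {M : Matrix (Fin 3) (Fin 3) ℤ}
    (h : ∀ x : Fin 3 → ZMod k, (M.map (fun m => (m : ZMod k))) *ᵥ x = x ↔ ∀ l, x l ∈ s l) :
    fixCard k M = ∏ l, (s l).card := by
  rw [fixCard, ← Fintype.card_piFinset]
  congr 1
  ext x
  simp [h, Fintype.mem_piFinset]

theorem fixCard_refl : fixCard k !![1, 0, 0; 0, 1, 1; 0, 0, -1] = k ^ 2 := by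
  rw [fixCard_eq_prod k (s := ![Finset.univ, Finset.univ, {0}])]
  · simp [Fin.prod_univ_three, ZMod.card, sq]
  intro x
  simp [funext_iff, Fin.forall_fin_succ, Matrix.mulVec, dotProduct, Fin.sum_univ_three]
  grind

theorem fixCard_neg_refl (hk : Even k) : fixCard k !![-1, 0, 0; 0, -1, -1; 0, 0, 1] = 2 * k := by
  have h : fixCard k !![-1, 0, 0; 0, -1, -1; 0, 0, 1] =
      ((Finset.univ.filter fun t : ZMod k => ((2 : ℕ) : ZMod k) * t = 0) ×ˢ
        (Finset.univ : Finset (ZMod k))).card := by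
    rw [fixCard]
    refine Finset.card_bij' (fun x _ => (x 0, x 1)) (fun t _ => ![t.1, t.2, -2 * t.2])
      (fun x => ?_) (fun t => ?_) (fun x => ?_) fun t _ => rfl <;>
    simp [funext_iff, Fin.forall_fin_succ, Matrix.mulVec, dotProduct, Fin.sum_univ_three] <;>
    grind
  rw [h, Finset.card_product, card_torsion_zmod, Nat.gcd_eq_right hk.two_dvd]
  simp [ZMod.card]

theorem fixCard_neg_one (hk : Even k) : fixCard k !![-1, 0, 0; 0, -1, 0; 0, 0, -1] = 8 := by
  rw [fixCard_eq_prod k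
    (s := fun _ => Finset.univ.filter fun t : ZMod k => ((2 : ℕ) : ZMod k) * t = 0)]
  · rw [card_torsion_zmod, Nat.gcd_eq_right hk.two_dvd]
    simp
  intro x
  simp [funext_iff, Fin.forall_fin_succ, Matrix.mulVec, dotProduct, Fin.sum_univ_three]
  grind

theorem fixCard_cyclic : fixCard k !![0, 1, 0; -1, -1, 0; 2, 2, 1] = k := by
  rw [fixCard_eq_card_of_equiv k (s := Finset.univ) ![0, 0, 1] 2 rfl]
  · simp [ZMod.card]
  intro x
  simp [funext_iff, Fin.forall_fin_succ, Matrix.mulVec, dotProduct, Fin.sum_univ_three]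
  grind

theorem fixCard_neg_cyclic (hk : Even k) : fixCard k !![0, -1, 0; 1, 1, 0; -2, -2, -1] = 2 := by
  rw [fixCard_eq_card_of_equiv k
    (s := Finset.univ.filter fun t : ZMod k => ((2 : ℕ) : ZMod k) * t = 0) ![0, 0, 1] 2 rfl]
  · rw [card_torsion_zmod, Nat.gcd_eq_right hk.two_dvd]
  intro x
  simp [funext_iff, Fin.forall_fin_succ, Matrix.mulVec, dotProduct, Fin.sum_univ_three]
  grind

theorem fixCard_quarter_turn : fixCard k !![1, 1, 0; 0, 1, 1; 0, -2, -1] = k := by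
  rw [fixCard_eq_card_of_equiv k (s := Finset.univ) ![1, 0, 0] 0 rfl]
  · simp [ZMod.card]
  intro x
  simp [funext_iff, Fin.forall_fin_succ, Matrix.mulVec, dotProduct, Fin.sum_univ_three]
  grind

theorem fixCard_neg_quarter_turn : fixCard k !![-1, -1, 0; 0, -1, -1; 0, 2, 1] = k.gcd 4 := by
  rw [fixCard_eq_card_of_equiv k
    (s := Finset.univ.filter fun t : ZMod k => ((4 : ℕ) : ZMod k) * t = 0) ![1, -2, 4] 0 rfl,
    card_torsion_zmod]
  intro x
  simp [funext_iff, Fin.forall_fin_succ, Matrix.mulVec, dotProduct, Fin.sum_univ_three]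
  grind

end

/-! ### The traces of the elements of `G` on theta functions -/

open Letter

/-- The transposed modular matrix of a letter. -/
def letterM : Letter → Matrix (Fin 3 ⊕ Fin 3) (Fin 3 ⊕ Fin 3) ℤ
  | .a => γ₁ᵀ
  | .x => γ₂ᵀ
  | .s => γ₃ᵀ
  | .y => γ₁ᵀ * γ₂ᵀ * γ₁ᵀ * γ₃ᵀ * γ₂ᵀ * γ₃ᵀ * γ₁ᵀ * γ₂ᵀ * γ₁ᵀ
  | .e => γ₃ᵀ * γ₂ᵀ * γ₃ᵀ * γ₁ᵀ * γ₂ᵀ * γ₁ᵀ * γ₃ᵀ * γ₂ᵀ * γ₃ᵀ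
  | .i => γ₁ᵀ * γ₂ᵀ * γ₁ᵀ * γ₂ᵀ * γ₃ᵀ * γ₂ᵀ * γ₃ᵀ * γ₁ᵀ * γ₂ᵀ * γ₁ᵀ * γ₃ᵀ * γ₂ᵀ * γ₃ᵀ
  | .c => γ₁ᵀ * γ₂ᵀ * γ₁ᵀ * γ₃ᵀ * γ₂ᵀ * γ₃ᵀ * γ₁ᵀ * γ₂ᵀ

theorem isPeriodMatrix_r₁ : IsPeriodMatrix r₁ γ₁ᵀ := isModularMatrix_φ₁.symm

theorem isPeriodMatrix_r₂ : IsPeriodMatrix r₂ γ₂ᵀ := isModularMatrix_φ₂.symm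

theorem isPeriodMatrix_r₃ : IsPeriodMatrix r₃ γ₃ᵀ := isModularMatrix_φ₃.symm

theorem isPeriodMatrix_letter : ∀ l : Letter, IsPeriodMatrix (letterG l) (letterM l)
  | .a => isPeriodMatrix_r₁
  | .x => isPeriodMatrix_r₂
  | .s => isPeriodMatrix_r₃
  | .y => (((((((isPeriodMatrix_r₁.mul isPeriodMatrix_r₂).mul isPeriodMatrix_r₁).mul
      isPeriodMatrix_r₃).mul isPeriodMatrix_r₂).mul isPeriodMatrix_r₃).mul isPeriodMatrix_r₁).mul
      isPeriodMatrix_r₂).mul isPeriodMatrix_r₁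
  | .e => (((((((isPeriodMatrix_r₃.mul isPeriodMatrix_r₂).mul isPeriodMatrix_r₃).mul
      isPeriodMatrix_r₁).mul isPeriodMatrix_r₂).mul isPeriodMatrix_r₁).mul isPeriodMatrix_r₃).mul
      isPeriodMatrix_r₂).mul isPeriodMatrix_r₃
  | .i => (((((((((((isPeriodMatrix_r₁.mul isPeriodMatrix_r₂).mul isPeriodMatrix_r₁).mul
      isPeriodMatrix_r₂).mul isPeriodMatrix_r₃).mul isPeriodMatrix_r₂).mul isPeriodMatrix_r₃).mul
      isPeriodMatrix_r₁).mul isPeriodMatrix_r₂).mul isPeriodMatrix_r₁).mul isPeriodMatrix_r₃).mul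
      isPeriodMatrix_r₂).mul isPeriodMatrix_r₃
  | .c => ((((((isPeriodMatrix_r₁.mul isPeriodMatrix_r₂).mul isPeriodMatrix_r₁).mul
      isPeriodMatrix_r₃).mul isPeriodMatrix_r₂).mul isPeriodMatrix_r₃).mul isPeriodMatrix_r₁).mul
      isPeriodMatrix_r₂

/-- The transposed modular matrix of a word. -/
def wordM (w : List Letter) : Matrix (Fin 3 ⊕ Fin 3) (Fin 3 ⊕ Fin 3) ℤ := (w.map letterM).prod

theorem isPeriodMatrix_word (w : List Letter) : IsPeriodMatrix (wordG w) (wordM w) := by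
  induction w with
  | nil =>
    simp only [IsPeriodMatrix, wordG, wordM, List.map_nil, List.prod_nil, intMat_one,
      Matrix.mul_one]
    exact Matrix.one_mul Ω
  | cons l w ih => exact (isPeriodMatrix_letter l).mul ih

section

variable {k : ℕ} [NeZero k] (hk : Even k)
include hk

theorem chi_word_eq {w : List Letter} {A B : Matrix (Fin 3) (Fin 3) ℤ}
    (h : wordM w = Matrix.fromBlocks A 0 0 Bᵀ ∧ A * B = 1) :
    chi k (wordG w) = fixCard k B := by
  have h1 := isPeriodMatrix_word w
  rw [h.1] at h1
  exact chi_eq_card hk h1 h.2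

theorem chi_nil : chi k (wordG []) = k ^ 3 := by
  rw [chi_word_eq hk (A := 1) (B := 1) (by decide +kernel), fixCard_one]
  push_cast
  rfl

theorem chi_i : chi k (wordG [i]) = 8 := by
  rw [chi_word_eq hk (A := -1) (B := !![-1, 0, 0; 0, -1, 0; 0, 0, -1]) (by decide +kernel),
    fixCard_neg_one k hk]
  rfl

theorem chi_x : chi k (wordG [x]) = k ^ 2 := by
  rw [chi_word_eq hk (A := !![1, 0, 0; 0, 1, 1; 0, 0, -1]) (B := !![1, 0, 0; 0, 1, 1; 0, 0, -1])
    (by decide +kernel), fixCard_refl]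
  push_cast
  rfl

theorem chi_ix : chi k (wordG [i, x]) = 2 * k := by
  rw [chi_word_eq hk (A := !![-1, 0, 0; 0, -1, -1; 0, 0, 1])
    (B := !![-1, 0, 0; 0, -1, -1; 0, 0, 1]) (by decide +kernel), fixCard_neg_refl k hk]
  push_cast
  rfl

theorem chi_c : chi k (wordG [c]) = k := by
  rw [chi_word_eq hk (A := !![-1, -1, 0; 1, 0, 0; 0, 2, 1])
    (B := !![0, 1, 0; -1, -1, 0; 2, 2, 1]) (by decide +kernel), fixCard_cyclic]

theorem chi_ic : chi k (wordG [i, c]) = 2 := by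
  rw [chi_word_eq hk (A := !![1, 1, 0; -1, 0, 0; 0, -2, -1])
    (B := !![0, -1, 0; 1, 1, 0; -2, -2, -1]) (by decide +kernel), fixCard_neg_cyclic k hk]
  rfl

theorem chi_ax : chi k (wordG [a, x]) = k := by
  rw [chi_word_eq hk (A := !![1, 1, 1; 0, -1, -1; 0, 2, 1])
    (B := !![1, 1, 0; 0, 1, 1; 0, -2, -1]) (by decide +kernel), fixCard_quarter_turn]

theorem chi_iax : chi k (wordG [i, a, x]) = 3 + (-1) ^ (k / 2) := by
  rw [chi_word_eq hk (A := !![-1, -1, -1; 0, 1, 1; 0, -2, -1])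
    (B := !![-1, -1, 0; 0, -1, -1; 0, 2, 1]) (by decide +kernel), fixCard_neg_quarter_turn]
  -- The number of fixed points is gcd(2m, 4) = 2 gcd(m, 2), which is 4 or 2 according to the parity
  -- of m.
  obtain ⟨m, rfl⟩ := hk.two_dvd
  rw [Nat.mul_div_cancel_left _ two_pos, show 4 = 2 * 2 from rfl, Nat.gcd_mul_left]
  rcases m.even_or_odd with hm | hm
  · rw [Nat.gcd_eq_right hm.two_dvd, hm.neg_one_pow]
    norm_num
  · rw [Nat.coprime_iff_gcd_eq_one.1 hm.coprime_two_right, hm.neg_one_pow]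
    norm_num

theorem norm_chi_seven_mul_le :
    ‖chi k (wordG [s, c, x]) * chi k (wordG [s, c, x])⁻¹‖ ≤ k.gcd 7 := by
  refine (norm_chi_mul_chi_inv_le hk (isPeriodMatrix_word [s, c, x])).trans ?_
  refine Nat.cast_le.2 (fixCard_le_gcd_seven k _ (.inr 1)
    (Sum.elim ![-1, -4, -1] ![-4, 1, 0]) fun x hx => ?_)
  -- U row-reduces M − 1 to an echelon form with pivots 1, 1, 1, 1, 7, 1. The fifth coordinate is
  -- thus free up to 7-torsion, and the vector of multipliers above is read off from its column.
  have h := mulVec_eq_zero_of_mul_sub_one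
    (U := Matrix.fromBlocks !![-1, -2, -1; -3, -9, -4; -2, -3, -1] !![0, -1, 0; -1, -4, 2; -1, -2, 3]
      !![-4, -10, -4; -6, -16, -7; 0, -1, -1] !![-2, -5, 4; -2, -8, 5; 0, 0, -1])
    (H := Matrix.fromBlocks 1 !![0, 1, 0; 0, 4, 0; 0, 1, 0] 0 !![1, 4, 0; 0, 7, 0; 0, 0, 1])
    (by decide +kernel) hx
  have h0 := congrFun h (.inl 0)
  have h1 := congrFun h (.inl 1)
  have h2 := congrFun h (.inl 2)
  have h3 := congrFun h (.inr 0)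
  have h4 := congrFun h (.inr 1)
  have h5 := congrFun h (.inr 2)
  simp [Matrix.mulVec, dotProduct, Fin.sum_univ_three, Matrix.one_apply]
    at h0 h1 h2 h3 h4 h5
  refine ⟨h4, fun l => ?_⟩
  rcases l with l | l <;> fin_cases l <;> simp <;> grind

theorem norm_chi_fourteen_mul_le :
    ‖chi k (wordG [i, s, c, x]) * chi k (wordG [i, s, c, x])⁻¹‖ ≤ 1 := by
  refine (norm_chi_mul_chi_inv_le hk (isPeriodMatrix_word [i, s, c, x])).trans ?_
  refine Nat.cast_le_one.2 (Finset.card_le_one.2 fun u hu v hv => ?_)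
  have h : ∀ z : Fin 3 ⊕ Fin 3 → ZMod k,
      ((wordM [i, s, c, x]).map (fun m => (m : ZMod k))) *ᵥ z = z → z = 0 := by
    intro z hz
    -- Here U is an integral inverse of M − 1, so only 0 is fixed for any k.
    have h := mulVec_eq_zero_of_mul_sub_one
      (U := Matrix.fromBlocks !![1, 0, 0; -1, -1, 0; 2, 1, 0] !![2, -1, 1; -1, 0, 0; 1, 0, 0]
        !![-4, -2, -2; -2, 0, -1; -2, -1, -1] !![-2, 1, -2; 0, 0, -1; 0, 0, -1])
      (H := 1) (by decide +kernel) hz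
    simpa [Matrix.map_one] using h
  rw [h u (Finset.mem_filter.1 hu).2, h v (Finset.mem_filter.1 hv).2]

end

end KleinTheta

namespace KleinTheta

/-! ### The traces of the elements of order seven and fourteen -/

/-- The trace of an idempotent endomorphism is its rank. -/
theorem exists_trace_eq_natCast {M : Type*} [AddCommGroup M] [Module ℂ M] [FiniteDimensional ℂ M]
    {P : Module.End ℂ M} (hP : IsIdempotentElem P) : ∃ m : ℕ, LinearMap.trace ℂ M P = m :=
  ⟨_, (LinearMap.IsIdempotentElem.isProj_range P hP).trace⟩

/-- The traces of mutually inverse endomorphisms of finite order are complex conjugate. -/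
theorem trace_eq_star_trace_of_pow_eq_one {M : Type*} [AddCommGroup M] [Module ℂ M]
    [FiniteDimensional ℂ M] {n : ℕ} (hn : n ≠ 0) {A B : Module.End ℂ M} (hA : A ^ n = 1)
    (hAB : B * A = 1) : LinearMap.trace ℂ M B = star (LinearMap.trace ℂ M A) := by
  obtain ⟨ζ, hζ⟩ : ∃ ζ : ℂ, IsPrimitiveRoot ζ n := ⟨_, Complex.isPrimitiveRoot_exp n hn⟩
  have hζ1 : ζ ≠ 0 := hζ.ne_zero hn
  have hζs : star ζ = ζ⁻¹ := by
    rw [Complex.inv_def, Complex.normSq_eq_norm_sq, hζ.norm'_eq_one hn]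
    simp
  -- These are the projections to the eigenspaces of A for ζʲ. Their traces are natural numbers mⱼ,
  -- so the traces of A and B are Σ mⱼζʲ and Σ mⱼζ⁻ʲ.
  set P : ℕ → Module.End ℂ M := fun j => (n : ℂ)⁻¹ • ∑ i ∈ Finset.range n, (ζ⁻¹ ^ j • A) ^ i
    with hPdef
  have hn' : (n : ℂ) ≠ 0 := Nat.cast_ne_zero.2 hn
  have hpow : ∀ j, (ζ⁻¹ ^ j • A) ^ n = 1 := by
    intro j
    rw [smul_pow, hA, ← pow_mul, mul_comm, pow_mul, inv_pow, hζ.pow_eq_one]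
    simp
  have hfix : ∀ j, (ζ⁻¹ ^ j • A) * P j = P j := by
    intro j
    rw [hPdef]
    simp only [mul_smul_comm, Finset.mul_sum]
    congr 1
    -- Multiplying the sum of powers by ζ⁻ʲA shifts the exponents by one, and the new last term
    -- equals the old first one since the n-th power is 1.
    have h1 := Finset.sum_range_succ (fun i => (ζ⁻¹ ^ j • A) ^ i) n
    have h2 := Finset.sum_range_succ' (fun i => (ζ⁻¹ ^ j • A) ^ i) n
    rw [h1, hpow, pow_zero] at h2
    rw [add_right_cancel h2]
    exact Finset.sum_congr rfl fun i _ => (pow_succ' _ _).symm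
  have hAP : ∀ j, A * P j = ζ ^ j • P j := by
    intro j
    conv_rhs => rw [← hfix j]
    rw [smul_mul_assoc, smul_smul, ← mul_pow, mul_inv_cancel₀ hζ1, one_pow, one_smul]
  have hBP : ∀ j, B * P j = ζ⁻¹ ^ j • P j := by
    intro j
    have h1 : P j = ζ⁻¹ ^ j • (A * P j) := by
      rw [hAP, smul_smul, ← mul_pow, inv_mul_cancel₀ hζ1, one_pow, one_smul]
    conv_lhs => rw [h1, mul_smul_comm, ← mul_assoc, hAB, one_mul]
  have hidem : ∀ j, IsIdempotentElem (P j) := by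
    intro j
    have h1 : ∀ i, (ζ⁻¹ ^ j • A) ^ i * P j = P j := by
      intro i
      induction i with
      | zero => rw [pow_zero, one_mul]
      | succ i ih => rw [pow_succ, mul_assoc, hfix, ih]
    change P j * P j = P j
    conv_lhs => enter [1]; rw [hPdef]
    rw [smul_mul_assoc, Finset.sum_mul, Finset.sum_congr rfl fun i _ => h1 i, Finset.sum_const,
      Finset.card_range, ← Nat.cast_smul_eq_nsmul ℂ, smul_smul, inv_mul_cancel₀ hn', one_smul]
  have hsum : ∑ j ∈ Finset.range n, P j = 1 := by
    simp only [hPdef, ← Finset.smul_sum]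
    rw [Finset.sum_comm]
    have h1 : ∀ i ∈ Finset.range n, ∑ j ∈ Finset.range n, (ζ⁻¹ ^ j • A) ^ i =
        if i = 0 then (n : ℂ) • (1 : Module.End ℂ M) else 0 := by
      intro i hi
      have h2 : ∀ j, (ζ⁻¹ ^ j • A) ^ i = (ζ⁻¹ ^ i) ^ j • A ^ i := by
        intro j
        rw [smul_pow, ← pow_mul, ← pow_mul, mul_comm]
      simp only [h2, ← Finset.sum_smul]
      split_ifs with h0
      · subst h0
        simp
      · have h3 := hζ.inv.pow_ne_one_of_pos_of_lt h0 (Finset.mem_range.1 hi)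
        have h4 := geom_sum_mul (ζ⁻¹ ^ i) n
        rw [← pow_mul, mul_comm i, pow_mul, hζ.inv.pow_eq_one, one_pow, sub_self] at h4
        rw [(mul_eq_zero.1 h4).resolve_right (sub_ne_zero.2 h3), zero_smul]
    rw [Finset.sum_congr rfl h1, Finset.sum_ite_eq' , if_pos (Finset.mem_range.2 (by omega)),
      smul_smul, inv_mul_cancel₀ hn', one_smul]
  choose m hm using fun j => exists_trace_eq_natCast (hidem j)
  have hA' : LinearMap.trace ℂ M A = ∑ j ∈ Finset.range n, ζ ^ j * m j := by
    conv_lhs => rw [← mul_one A, ← hsum, Finset.mul_sum, map_sum]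
    simp only [hAP, map_smul, hm, smul_eq_mul]
  have hB' : LinearMap.trace ℂ M B = ∑ j ∈ Finset.range n, ζ⁻¹ ^ j * m j := by
    conv_lhs => rw [← mul_one B, ← hsum, Finset.mul_sum, map_sum]
    simp only [hBP, map_smul, hm, smul_eq_mul]
  rw [hA', hB', star_sum]
  simp [hζs]

section Frobenius

open Letter

variable {M : Type*} [AddCommGroup M] [Module ℂ M] (ρ : Representation ℂ G M)

/-- Conjugacy data for the elements of a subgroup of `G` of order 21. -/
def frobeniusTable : List (List Letter × List Letter × List Letter) :=
  [([], [], []), ([c], [], [c]), ([c, c], [y], [c]), ([s, c, x], [], [s, c, x]),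
   ([s, c, x, c], [s, c, x], [c]), ([s, c, x, c, c], [e, x, s, c, y], [c]),
   ([s, c, x, s, c, x], [c, c], [s, c, x]), ([s, c, x, s, c, x, c], [s, e], [c]),
   ([s, c, x, s, c, x, c, c], [e, s, x, c], [c]),
   ([s, c, x, s, c, x, s, c, x], [c], [c, c, e, s]),
   ([s, c, x, s, c, x, s, c, x, c], [e, s, c], [c]),
   ([s, c, x, s, c, x, s, c, x, c, c], [x, s, c, e], [c]),
   ([s, c, x, s, c, x, s, c, x, s, c, x], [c], [s, c, x]),
   ([s, c, x, s, c, x, s, c, x, s, c, x, c], [s, c, x, c], [c]),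
   ([s, c, x, s, c, x, s, c, x, s, c, x, c, c], [e, s, x], [c]),
   ([s, c, x, s, c, x, s, c, x, s, c, x, s, c, x], [c, c], [c, c, e, s]),
   ([s, c, x, s, c, x, s, c, x, s, c, x, s, c, x, c], [e, s, c, c], [c]),
   ([s, c, x, s, c, x, s, c, x, s, c, x, s, c, x, c, c], [s, c, e, y], [c]),
   ([s, c, x, s, c, x, s, c, x, s, c, x, s, c, x, s, c, x], [], [c, c, e, s]),
   ([s, c, x, s, c, x, s, c, x, s, c, x, s, c, x, s, c, x, c], [e, s], [c]),
   ([s, c, x, s, c, x, s, c, x, s, c, x, s, c, x, s, c, x, c, c], [y, s, e], [c])]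

theorem frobeniusTable_conj : ∀ t ∈ frobeniusTable,
    wordN (t.2.1 ++ t.1) = wordN (t.2.2 ++ t.2.1) ∧
      wordN (t.2.1 ++ (i :: t.1)) = wordN ((i :: t.2.2) ++ t.2.1) := by decide +kernel

/-- Words for the elements of a subgroup of order 21. -/
def frobeniusWords : List (List Letter) := frobeniusTable.map (·.1)

/-- Stability under its own words makes the normalized sum idempotent, and the trace of an
idempotent is its rank. -/
theorem exists_trace_sumOp_eq [FiniteDimensional ℂ M] {l : List (List Letter)} (hl : l ≠ [])
    (h : ∀ w ∈ l, wordOp ρ w * sumOp ρ l = sumOp ρ l) :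
    ∃ m : ℕ, LinearMap.trace ℂ M (sumOp ρ l) = l.length * m := by
  have hl' : (l.length : ℂ) ≠ 0 := by simpa using hl
  obtain ⟨m, hm⟩ := exists_trace_eq_natCast (P := (l.length : ℂ)⁻¹ • sumOp ρ l) (by
    change _ * _ = _
    rw [smul_mul_assoc, mul_smul_comm, sumOp_mul_of_forall ρ h, smul_smul (_⁻¹ : ℂ) (l.length : ℂ),
      inv_mul_cancel₀ hl', one_smul])
  refine ⟨m, ?_⟩
  rw [← hm, map_smul, smul_eq_mul, mul_inv_cancel_left₀ hl']

theorem mul_sumOp_frobeniusWords : ∀ w ∈ frobeniusWords,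
    wordOp ρ w * sumOp ρ frobeniusWords = sumOp ρ frobeniusWords := by
  have h : ∀ w ∈ frobeniusWords,
      ((frobeniusWords.map (w ++ ·)).map wordN).Perm (frobeniusWords.map wordN) := by
    decide +kernel
  intro w hw
  rw [← sumOp_map_append, sumOp_eq_of_perm ρ (h w hw)]

/-- Besides the identity, the group of order 21 has 14 elements of order three, all conjugate in `G`
to c, and six of order seven, three in each of two mutually inverse classes. -/
theorem exists_trace_frobenius [FiniteDimensional ℂ M] : ∃ m : ℕ,
    wordTr ρ [] + 3 * (wordTr ρ [s, c, x] + wordTr ρ [c, c, e, s]) + 14 * wordTr ρ [c] =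
      21 * m := by
  obtain ⟨m, hm⟩ := exists_trace_sumOp_eq ρ (by decide +kernel) (mul_sumOp_frobeniusWords ρ)
  refine ⟨m, ?_⟩
  have h1 : (frobeniusWords.map (wordTr ρ)).sum =
      (frobeniusTable.map fun t => wordTr ρ t.1).sum := by
    rw [frobeniusWords, List.map_map]; rfl
  rw [trace_sumOp, h1, List.map_congr_left fun t ht =>
    wordTr_eq_of_conj ρ (frobeniusTable_conj t ht).1,
    show frobeniusWords.length = 21 by decide +kernel] at hm
  simp only [frobeniusTable, List.map_cons, List.map_nil, List.sum_cons, List.sum_nil] at hm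
  push_cast at hm
  linear_combination hm

theorem wordOp_i_comm (w : List Letter) :
    wordOp ρ [i] * wordOp ρ w = wordOp ρ w * wordOp ρ [i] := by
  induction w with
  | nil => rw [wordOp_nil, one_mul, mul_one]
  | cons l w ih =>
    have h : wordOp ρ ([i] ++ [l]) = wordOp ρ ([l] ++ [i]) :=
      wordOp_eq ρ (by cases l <;> decide +kernel)
    rw [wordOp_append, wordOp_append] at h
    rw [show l :: w = [l] ++ w from rfl, wordOp_append, ← mul_assoc, h, mul_assoc, ih, mul_assoc]

theorem exists_trace_neg_frobenius [FiniteDimensional ℂ M] : ∃ m : ℤ,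
    wordTr ρ [i] + 3 * (wordTr ρ [i, s, c, x] + wordTr ρ [i, c, c, e, s]) + 14 * wordTr ρ [i, c] =
      21 * m := by
  obtain ⟨m, hm⟩ := exists_trace_frobenius ρ
  have hI : wordOp ρ [i] * wordOp ρ [i] = 1 := by
    rw [← wordOp_append, ← wordOp_nil]
    exact wordOp_eq ρ (by decide +kernel)
  have hT : sumOp ρ (wordProd [[], [i]] frobeniusWords) =
      sumOp ρ frobeniusWords + wordOp ρ [i] * sumOp ρ frobeniusWords := by
    rw [sumOp_wordProd]
    simp [sumOp, add_mul, wordOp_nil]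
  have hfix : ∀ w ∈ wordProd [[], [i]] frobeniusWords,
      wordOp ρ w * sumOp ρ (wordProd [[], [i]] frobeniusWords) =
        sumOp ρ (wordProd [[], [i]] frobeniusWords) := by
    have h1 : ∀ w ∈ frobeniusWords, wordOp ρ w * sumOp ρ (wordProd [[], [i]] frobeniusWords) =
        sumOp ρ (wordProd [[], [i]] frobeniusWords) := by
      intro w hw
      rw [hT, mul_add, mul_sumOp_frobeniusWords ρ w hw, ← mul_assoc, ← wordOp_i_comm, mul_assoc,
        mul_sumOp_frobeniusWords ρ w hw]
    intro w hw
    simp only [wordProd, List.flatMap_cons, List.flatMap_nil, List.append_nil, List.mem_append,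
      List.mem_map] at hw
    rcases hw with ⟨w, hw, rfl⟩ | ⟨w, hw, rfl⟩
    · exact h1 w hw
    · rw [wordOp_append, mul_assoc, h1 w hw, hT, mul_add, ← mul_assoc, hI, one_mul, add_comm]
  obtain ⟨n, hn⟩ := exists_trace_sumOp_eq ρ (by decide +kernel) hfix
  -- The sum over ±F, of 42 elements, has trace 42n and the sum over F has trace 21m; the difference
  -- is the trace over −F.
  refine ⟨2 * n - m, ?_⟩
  have h1 : LinearMap.trace ℂ M (sumOp ρ (wordProd [[], [i]] frobeniusWords)) =
      (frobeniusTable.map fun t => wordTr ρ t.1).sum +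
        (frobeniusTable.map fun t => wordTr ρ (i :: t.1)).sum := by
    rw [trace_sumOp]
    simp [wordProd, frobeniusWords, Function.comp_def]
  rw [h1, List.map_congr_left fun t ht => wordTr_eq_of_conj ρ (frobeniusTable_conj t ht).1,
    List.map_congr_left fun t ht => wordTr_eq_of_conj ρ (frobeniusTable_conj t ht).2,
    show (wordProd [[], [i]] frobeniusWords).length = 42 by decide +kernel] at hn
  simp only [frobeniusTable, List.map_cons, List.map_nil, List.sum_cons, List.sum_nil] at hn
  push_cast at hn ⊢
  linear_combination hn - hm

end Frobenius

end KleinTheta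

namespace KleinTheta

/-! ### The dimension of the space of invariant theta functions -/

open Letter

theorem finiteDimensional_NT {k : ℕ} [NeZero k] (hk : Even k) : FiniteDimensional ℂ (NT k) :=
  (coeffEquiv hk).symm.finiteDimensional

theorem wordG_seven_inv : (wordG [s, c, x])⁻¹ = wordG [c, c, e, s] := by
  refine inv_eq_of_mul_eq_one_right ?_
  rw [← wordG_append]
  exact wordG_eq (w' := []) (by decide +kernel)

theorem wordG_fourteen_inv : (wordG [i, s, c, x])⁻¹ = wordG [i, c, c, e, s] := by
  refine inv_eq_of_mul_eq_one_right ?_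
  rw [← wordG_append]
  exact wordG_eq (w' := []) (by decide +kernel)

/-- If `chi g * chi g⁻¹` is bounded by `b` and `chi g + chi g⁻¹` is an integer `t`, for an element
`g` of finite order, then `t² ≤ 4b`. -/
theorem sq_le_of_chi_add_chi_inv {k : ℕ} [NeZero k] (hk : Even k) {g : G} {n : ℕ} (hn : n ≠ 0)
    (hg : g ^ n = 1) {b : ℕ} (hb : ‖chi k g * chi k g⁻¹‖ ≤ b) {t : ℤ}
    (ht : chi k g + chi k g⁻¹ = t) : t ^ 2 ≤ 4 * b := by
  have := finiteDimensional_NT hk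
  have hs : chi k g⁻¹ = star (chi k g) := by
    refine trace_eq_star_trace_of_pow_eq_one hn ?_ ?_
    · rw [← map_pow, hg, map_one]
    · rw [← map_mul, inv_mul_cancel, map_one]
  rw [hs] at hb ht
  rw [norm_mul, norm_star] at hb
  have hre : (2 * (chi k g).re : ℝ) = t := by
    have := congrArg Complex.re ht
    simp at this
    linarith
  have h1 : (chi k g).re ^ 2 ≤ ‖chi k g‖ ^ 2 := by
    rw [← sq_abs]
    exact pow_le_pow_left₀ (abs_nonneg _) (Complex.abs_re_le_norm _) 2
  have h2 : (t : ℝ) ^ 2 ≤ 4 * b := by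
    rw [← hre]
    nlinarith
  exact_mod_cast h2

/-- Let t be the left side. Integrality over the group of order 21 gives k³ + 3t + 14k = 21m, hence
t ≡ 2k³ ≡ 2(k/7) modulo 7, while t² ≤ 4 gcd(k, 7). -/
theorem chi_seven {k : ℕ} [NeZero k] (hk : Even k) :
    chi k (wordG [s, c, x]) + chi k (wordG [c, c, e, s]) = 2 * (legendreSym 7 (k : ℤ) : ℂ) := by
  have := finiteDimensional_NT hk
  obtain ⟨m, hm⟩ := exists_trace_frobenius (rep k)
  change chi k (wordG []) + 3 * (chi k (wordG [s, c, x]) + chi k (wordG [c, c, e, s])) +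
    14 * chi k (wordG [c]) = 21 * m at hm
  rw [chi_nil hk, chi_c hk] at hm
  obtain ⟨q, hq⟩ : (3 : ℤ) ∣ (k : ℤ) ^ 3 + 14 * k := by
    have : ((k : ℤ) ^ 3 + 14 * k) % 3 = 0 := by
      rcases (by omega : (k : ℤ) % 3 = 0 ∨ (k : ℤ) % 3 = 1 ∨ (k : ℤ) % 3 = 2) with h | h | h <;>
        simp [Int.add_emod, Int.mul_emod, pow_succ, h]
    exact Int.dvd_of_emod_eq_zero this
  have hq' : (k : ℂ) ^ 3 + 14 * k = 3 * q := by exact_mod_cast hq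
  have ht : chi k (wordG [s, c, x]) + chi k (wordG [c, c, e, s]) = ((7 * m - q : ℤ) : ℂ) := by
    push_cast
    linear_combination (1 / 3) * hm - (1 / 3) * hq'
  have hb := sq_le_of_chi_add_chi_inv hk (g := wordG [s, c, x]) (n := 7) (by norm_num)
    (by
      simp only [pow_succ, pow_zero, one_mul, ← wordG_append]
      exact wordG_eq (w' := []) (by decide +kernel))
    (norm_chi_seven_mul_le hk) (t := 7 * m - q) (by rw [wordG_seven_inv, ht])
  have hl : ((legendreSym 7 (k : ℤ) : ℤ) : ZMod 7) = ((k ^ 3 : ℤ) : ZMod 7) := by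
    rw [legendreSym.eq_pow]
    norm_num
  have hl' : (7 : ℤ) ∣ (k : ℤ) ^ 3 - legendreSym 7 (k : ℤ) :=
    (ZMod.intCast_eq_intCast_iff_dvd_sub _ _ 7).1 hl
  -- If 7 divides k, then t² ≤ 28 and t ≡ 0 modulo 7, so t = 0. Otherwise |t| ≤ 2 and t ≡ ±2, which
  -- determines t.
  have hqm : (7 * m - q : ℤ) = 2 * legendreSym 7 (k : ℤ) := by
    by_cases h7 : 7 ∣ k
    · have h0 : legendreSym 7 (k : ℤ) = 0 := by
        rw [legendreSym.eq_zero_iff]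
        exact_mod_cast (ZMod.natCast_eq_zero_iff k 7).2 h7
      rw [Nat.gcd_eq_right h7] at hb
      rw [h0] at hl' ⊢
      push_cast at hb
      have h1 : (7 * m - q : ℤ) < 6 := by nlinarith
      have h2 : (-6 : ℤ) < 7 * m - q := by nlinarith
      omega
    · rw [(Nat.coprime_comm.1 ((Nat.Prime.coprime_iff_not_dvd (by norm_num)).2 h7) :
        k.gcd 7 = 1)] at hb
      have h0 : ((k : ℤ) : ZMod 7) ≠ 0 := by
        exact_mod_cast fun h => h7 ((ZMod.natCast_eq_zero_iff k 7).1 h)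
      push_cast at hb
      have h1 : (7 * m - q : ℤ) < 3 := by nlinarith
      have h2 : (-3 : ℤ) < 7 * m - q := by nlinarith
      rcases legendreSym.eq_one_or_neg_one 7 h0 with h | h <;> rw [h] at hl' ⊢ <;> omega
  rw [ht, hqm]
  push_cast
  rfl

/-- Integrality gives 8 + 3t + 28 = 21m, that is t = 7m − 12, and the bound t² ≤ 4 leaves only m =
2. -/
theorem chi_fourteen {k : ℕ} [NeZero k] (hk : Even k) :
    chi k (wordG [i, s, c, x]) + chi k (wordG [i, c, c, e, s]) = 2 := by
  have := finiteDimensional_NT hk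
  obtain ⟨m, hm⟩ := exists_trace_neg_frobenius (rep k)
  change chi k (wordG [i]) + 3 * (chi k (wordG [i, s, c, x]) + chi k (wordG [i, c, c, e, s])) +
    14 * chi k (wordG [i, c]) = 21 * m at hm
  rw [chi_i hk, chi_ic hk] at hm
  have ht : chi k (wordG [i, s, c, x]) + chi k (wordG [i, c, c, e, s]) = ((7 * m - 12 : ℤ) : ℂ) := by
    push_cast
    linear_combination (1 / 3) * hm
  have hb := sq_le_of_chi_add_chi_inv hk (g := wordG [i, s, c, x]) (n := 14) (by norm_num)
    (by
      simp only [pow_succ, pow_zero, one_mul, ← wordG_append]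
      exact wordG_eq (w' := []) (by decide +kernel))
    (b := 1) (by exact_mod_cast norm_chi_fourteen_mul_le hk) (t := 7 * m - 12)
    (by rw [wordG_fourteen_inv, ht])
  push_cast at hb
  have h1 : (7 * m - 12 : ℤ) < 3 := by nlinarith
  have h2 : (-3 : ℤ) < 7 * m - 12 := by nlinarith
  have h3 : m = 2 := by omega
  rw [ht, h3]
  norm_num

/-- The dimension of the space of invariant theta functions of even degree `k`. -/
theorem finrank_H0Inv_eq {k : ℕ} (hk : Even k) : 336 * (Module.finrank ℂ (H0Inv k) : ℂ) =
    k ^ 3 + 21 * k ^ 2 + 140 * k + 294 + 42 * (-1) ^ (k / 2) + 48 * legendreSym 7 (k : ℤ) := by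
  -- In degree zero the formula holds as 294 + 42 = 336, with Legendre symbol 0.
  rcases eq_or_ne k 0 with rfl | h0
  · rw [finrank_H0Inv_zero]
    simp
    norm_num
  have : NeZero k := ⟨h0⟩
  have := finiteDimensional_NT hk
  rw [finrank_H0Inv hk, finrank_invariants_eq]
  change chi k (wordG []) + chi k (wordG [i]) + 21 * (chi k (wordG [x]) + chi k (wordG [i, x])) +
    56 * (chi k (wordG [c]) + chi k (wordG [i, c])) +
    42 * (chi k (wordG [a, x]) + chi k (wordG [i, a, x])) +
    24 * (chi k (wordG [s, c, x]) + chi k (wordG [i, s, c, x]) +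
      (chi k (wordG [c, c, e, s]) + chi k (wordG [i, c, c, e, s]))) = _
  rw [chi_nil hk, chi_i hk, chi_x hk, chi_ix hk, chi_c hk, chi_ic hk, chi_ax hk, chi_iax hk]
  linear_combination 24 * chi_seven hk + 24 * chi_fourteen hk

end KleinTheta

namespace KleinTheta

/-! ### Hilbert series of weighted projective spaces and their second Veronese algebras -/

open PowerSeries

/-- Monomials of weight p form a basis. Recording wᵢdᵢ in place of the exponent dᵢ gives
decompositions of p with divisibility conditions, the shape in which coefficients of a product of
geometric series appear. -/
theorem finrank_weightedCoordRing {n : ℕ} {w : Fin n → ℕ} (hw : ∀ i, w i ≠ 0) (p : ℕ) :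
    Module.finrank ℂ (weightedCoordRing w p) =
      ((Finset.finsuppAntidiag Finset.univ p).filter fun l => ∀ i, w i ∣ l i).card := by
  have h1 : weightedCoordRing w p =
      MvPolynomial.restrictSupport ℂ {d : Fin n →₀ ℕ | Finsupp.weight w d = p} :=
    MvPolynomial.weightedHomogeneousSubmodule_eq_finsupp_supported ℂ w p
  have := (Finsupp.finite_of_nat_weight_eq w hw p).fintype
  rw [h1, Module.finrank_eq_card_basis
    (MvPolynomial.basisRestrictSupport ℂ {d : Fin n →₀ ℕ | Finsupp.weight w d = p}),
    ← Set.toFinset_card]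
  have hwt : ∀ d : Fin n →₀ ℕ, Finsupp.weight w d = ∑ i, w i * d i := by
    intro d
    rw [Finsupp.weight_apply, Finsupp.sum_fintype _ _ (by simp)]
    exact Finset.sum_congr rfl fun i _ => mul_comm _ _
  refine Finset.card_bij' (fun d _ => Finsupp.equivFunOnFinite.symm fun i => w i * d i)
    (fun l _ => Finsupp.equivFunOnFinite.symm fun i => l i / w i) ?_ ?_ ?_ ?_
  · intro d hd
    simp only [Set.mem_toFinset, Set.mem_ofPred_eq, hwt] at hd
    simp [Finset.mem_finsuppAntidiag, hd]
  · intro l hl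
    simp only [Finset.mem_filter, Finset.mem_finsuppAntidiag] at hl
    simp only [Set.mem_toFinset, Set.mem_ofPred_eq, hwt, Finsupp.equivFunOnFinite_symm_apply_apply]
    rw [← hl.1.1]
    exact Finset.sum_congr rfl fun i _ => Nat.mul_div_cancel' (hl.2 i)
  · intro d _
    ext i
    simp [Nat.mul_div_cancel_left _ (Nat.pos_of_ne_zero (hw i))]
  · intro l hl
    simp only [Finset.mem_filter] at hl
    ext i
    simp [Nat.mul_div_cancel' (hl.2 i)]

/-- The geometric series `∑ X^(wn)`. -/
def geomSeries (w : ℕ) : PowerSeries ℚ := mk fun n => if w ∣ n then 1 else 0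

theorem geomSeries_mul {w : ℕ} (hw : w ≠ 0) : geomSeries w * (1 - X ^ w) = 1 := by
  ext n
  rw [mul_sub, mul_one, map_sub, coeff_mul_X_pow', geomSeries, coeff_mk, coeff_mk, coeff_one]
  rcases lt_or_ge n w with h | h
  · rw [if_neg (not_le.2 h), sub_zero]
    congr 1
    exact propext ⟨fun h1 => Nat.eq_zero_of_dvd_of_lt h1 h, fun h1 => h1 ▸ dvd_zero w⟩
  · rw [if_pos h, if_neg (by omega : n ≠ 0), sub_eq_zero]
    congr 1
    exact propext (Nat.dvd_sub_iff_left h dvd_rfl).symm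

theorem hilbertSeries_weightedCoordRing_mul {n : ℕ} {w : Fin n → ℕ} (hw : ∀ i, w i ≠ 0) :
    hilbertSeries (weightedCoordRing w) * ∏ i, (1 - X ^ w i) = 1 := by
  have h : hilbertSeries (weightedCoordRing w) = ∏ i, geomSeries (w i) := by
    ext p
    rw [hilbertSeries, coeff_mk, hilbertFunction, finrank_weightedCoordRing hw, coeff_prod,
      Finset.card_filter]
    push_cast
    refine Finset.sum_congr rfl fun l _ => ?_
    simp [geomSeries, Finset.prod_ite_zero]
  rw [h, ← Finset.prod_mul_distrib]
  exact Finset.prod_eq_one fun i _ => geomSeries_mul (hw i)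

/-- The even part of a power series, with `X²` replaced by `X`. -/
def evenPart (f : PowerSeries ℚ) : PowerSeries ℚ := mk fun n => coeff (2 * n) f

/-- Taking the even part is linear over power series in X². -/
theorem evenPart_mul_one_sub (f : PowerSeries ℚ) (m : ℕ) :
    evenPart (f * (1 - X ^ (2 * m))) = evenPart f * (1 - X ^ m) := by
  ext n
  simp only [evenPart, mul_sub, mul_one, map_sub, coeff_mul_X_pow', coeff_mk]
  congr 1
  rcases lt_or_ge n m with h | h
  · rw [if_neg (by omega), if_neg (by omega)]
  · rw [if_pos (by omega), if_pos h, Nat.mul_sub]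

theorem hilbertSeries_veronese_two {n : ℕ} (w : Fin n → ℕ) :
    hilbertSeries (veronese 2 (weightedCoordRing w)) =
      evenPart (hilbertSeries (weightedCoordRing w)) := by
  ext p
  simp only [hilbertSeries, evenPart, coeff_mk]
  rfl

theorem hilbertSeries_veronese_mul :
    hilbertSeries (veronese 2 (weightedCoordRing ![1, 2, 4, 7])) *
        ((1 - X) ^ 2 * (1 - X ^ 2) * (1 - X ^ 7)) = 1 + X ^ 4 := by
  have h := hilbertSeries_weightedCoordRing_mul (w := ![1, 2, 4, 7])
    (by simp [Fin.forall_fin_succ])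
  rw [Fin.prod_univ_four] at h
  -- Multiplying by (1 + X)(1 + X⁷) makes all factors of the denominator even. The even part of this
  -- numerator is 1 + X⁸, which becomes 1 + X⁴.
  have h1 : hilbertSeries (weightedCoordRing ![1, 2, 4, 7]) * (1 - X ^ (2 * 1)) *
      (1 - X ^ (2 * 1)) * (1 - X ^ (2 * 2)) * (1 - X ^ (2 * 7)) = (1 + X) * (1 + X ^ 7) := by
    simp at h
    linear_combination ((1 + X) * (1 + X ^ 7)) * h
  have h2 := congrArg evenPart h1
  simp only [evenPart_mul_one_sub, ← hilbertSeries_veronese_two] at h2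
  have h3 : evenPart ((1 + X) * (1 + X ^ 7)) = 1 + X ^ 4 := by
    ext n
    rw [show (1 + X) * (1 + X ^ 7) = (1 + X ^ 1 + X ^ 7 + X ^ 8 : PowerSeries ℚ) by ring]
    simp only [evenPart, coeff_mk, map_add, coeff_one, coeff_X_pow]
    rw [if_neg (by omega : 2 * n ≠ 1), if_neg (by omega : 2 * n ≠ 7), add_zero, add_zero]
    congr 2
    · simp
    · exact propext (by omega)
  rw [h3] at h2
  rw [← h2]
  ring

/-- The value at `2p` of the formula for the dimension of the space of invariants. -/
def dimFormula (p : ℕ) : ℚ :=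
  (8 * (p : ℚ) ^ 3 + 84 * (p : ℚ) ^ 2 + 280 * p + 294 + 42 * (-1) ^ p +
    48 * legendreSym 7 (p : ℤ)) / 336

theorem legendreSym_seven_add (p : ℕ) :
    legendreSym 7 ((p + 7 : ℕ) : ℤ) = legendreSym 7 (p : ℤ) := by
  rw [legendreSym.mod, legendreSym.mod 7 (p : ℤ)]
  congr 1
  push_cast
  omega

/-- The formula is a cubic polynomial plus terms of period 2 and 7, which satisfies the linear
recurrence of order 11 given by the denominator. So the coefficients from 11 on vanish identically,
and those below are computed. -/
theorem mk_dimFormula_mul :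
    mk dimFormula * ((1 - X) ^ 2 * (1 - X ^ 2) * (1 - X ^ 7)) = 1 + X ^ 4 := by
  have h : mk dimFormula * ((1 - X) ^ 2 * (1 - X ^ 2) * (1 - X ^ 7)) =
      mk dimFormula - (mk dimFormula * X ^ 1 + mk dimFormula * X ^ 1) +
      (mk dimFormula * X ^ 3 + mk dimFormula * X ^ 3) - mk dimFormula * X ^ 4 -
      mk dimFormula * X ^ 7 + (mk dimFormula * X ^ 8 + mk dimFormula * X ^ 8) -
      (mk dimFormula * X ^ 10 + mk dimFormula * X ^ 10) + mk dimFormula * X ^ 11 := by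
    ring
  rw [h]
  ext n
  simp only [map_add, map_sub, coeff_mul_X_pow', coeff_mk, coeff_one, coeff_X_pow]
  rcases lt_or_ge n 11 with hn | hn
  · interval_cases n <;> norm_num [dimFormula]
  · obtain ⟨m, rfl⟩ := Nat.exists_eq_add_of_le' hn
    have e : ∀ a b : ℕ, b ≤ a → m + a - b = m + (a - b) := fun a b h => by omega
    simp only [e _ _ (by norm_num : 1 ≤ 11), e _ _ (by norm_num : 3 ≤ 11),
      e _ _ (by norm_num : 4 ≤ 11), e _ _ (by norm_num : 7 ≤ 11), e _ _ (by norm_num : 8 ≤ 11),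
      e _ _ (by norm_num : 10 ≤ 11), e _ _ (by norm_num : 11 ≤ 11)]
    norm_num
    have h0 := legendreSym_seven_add m
    have h1 := legendreSym_seven_add (m + 1)
    have h3 := legendreSym_seven_add (m + 3)
    have h4 := legendreSym_seven_add (m + 4)
    simp only [add_assoc] at h0 h1 h3 h4
    norm_num at h0 h1 h3 h4
    simp only [dimFormula]
    push_cast
    simp only [h0, h1, h3, h4, pow_add]
    ring

theorem hilbertFunction_invTheta (p : ℕ) : (hilbertFunction invTheta p : ℚ) = dimFormula p := by
  have h := finrank_H0Inv_eq (even_two_mul p)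
  rw [Nat.mul_div_cancel_left _ two_pos] at h
  -- 2 = 3² modulo 7 is a square, so doubling p does not change the symbol.
  have h2 : legendreSym 7 ((2 * p : ℕ) : ℤ) = legendreSym 7 (p : ℤ) := by
    rw [Nat.cast_mul, legendreSym.mul]
    norm_num
  rw [h2] at h
  have h3 : 336 * (hilbertFunction invTheta p : ℚ) = ((2 * p : ℕ) : ℚ) ^ 3 +
      21 * ((2 * p : ℕ) : ℚ) ^ 2 + 140 * ((2 * p : ℕ) : ℚ) + 294 + 42 * (-1) ^ p +
      48 * legendreSym 7 (p : ℤ) := by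
    exact_mod_cast h
  rw [dimFormula, eq_div_iff (by norm_num)]
  push_cast at h3
  linear_combination h3

end KleinTheta

end

open KleinTheta PowerSeries in
theorem theorem3p3 :
    (∀ k : ℕ, Even k →
      (hilbertFunction invTheta (k / 2) : ℚ) =
        1 / 336 * ((k : ℚ) ^ 3 + 21 * (k : ℚ) ^ 2 + 140 * (k : ℚ) + 294
          + (-1) ^ (k / 2) * 42 + 48 * (legendreSym 7 (k : ℤ) : ℚ))) ∧
    hilbertFunction invTheta = hilbertFunction (veronese 2 (weightedCoordRing ![1, 2, 4, 7])) ∧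
    hilbertSeries (veronese 2 (weightedCoordRing ![1, 2, 4, 7])) *
        ((1 - X) ^ 2 * (1 - X ^ 2) * (1 - X ^ 7)) = 1 + X ^ 4 := by
  refine ⟨fun k hk => ?_, ?_, hilbertSeries_veronese_mul⟩
  · have h := finrank_H0Inv_eq hk
    have h1 : 336 * (hilbertFunction invTheta (k / 2) : ℚ) = (k : ℚ) ^ 3 + 21 * (k : ℚ) ^ 2 +
        140 * (k : ℚ) + 294 + 42 * (-1) ^ (k / 2) + 48 * (legendreSym 7 (k : ℤ) : ℚ) := by
      rw [hilbertFunction, invTheta, Nat.mul_div_cancel' hk.two_dvd]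
      exact_mod_cast h
    linear_combination (1 / 336) * h1
  -- The common denominator has constant term 1 and can be cancelled, so the two series with
  -- numerator 1 + X⁴ coincide.
  · have hD : (1 - X) ^ 2 * (1 - X ^ 2) * (1 - X ^ 7) ≠ (0 : PowerSeries ℚ) := by
      intro h
      simpa using congrArg constantCoeff h
    have h := mul_right_cancel₀ hD (mk_dimFormula_mul.trans hilbertSeries_veronese_mul.symm)
    funext p
    have h1 := congrArg (coeff p) h
    rw [coeff_mk, ← hilbertFunction_invTheta, hilbertSeries, coeff_mk] at h1
    exact_mod_cast h1
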